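/- Let $k$ be a field and $r\ge 0$ an integer. Let $A$ be a connected $\mathbb N^r$-graded $k$-algebra (so $A=\bigoplus_{\xi\in\mathbb N^r}A_\xi$ and $A_0=k$), equipped with a connected filtration: an exhaustive ascending filtration $k=F_0A\subset F_1A\subset\cdots$, $\bigcup_n F_nA=A$, by finite dimensional graded subspaces with $F_mA\cdot F_nA\subset F_{m+n}A$ (and $F_nA=0$ for $n<0$). Let $\operatorname{gr}A=\bigoplus_{(\xi,p)}F_pA_\xi/F_{p-1}A_\xi$, where $F_pA_\xi=F_pA\cap A_\xi$, be the associated $\mathbb Z^{r+1}$-graded algebra, and assume that $\operatorname{gr}A$ is left noetherian. Modules are left modules. A filtered $\mathbb Z^r$-graded $A$-module is a $\mathbb Z^r$-graded module $M$ with an ascending filtration $\{F_nM\}_{n\in\mathbb Z}$ by graded subspaces such that $F_mA\cdot F_nM\subset F_{m+n}M$; its associated graded module is the $\mathbb Z^{r+1}$-graded $\operatorname{gr}A$-module $\operatorname{gr}M=\bigoplus_{(\xi,p)}F_pM_\xi/F_{p-1}M_\xi$, where $F_pM_\xi=F_pM\cap M_\xi$. For graded modules $N,M$ over a graded algebra write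 $\operatorname{GrHom}(N,M)=\bigoplus_\xi\operatorname{Hom}(N,M[\xi])$, where $M[\xi]_\zeta=M_{\zeta+\xi}$ and $\operatorname{Hom}$ stands for the homogeneous module maps of degree $0$, and let $\operatorname{GrExt}^i$ be its $i$-th right derived functor, with $\operatorname{GrExt}^i=0$ for $i<0$. Say that $\chi(M)$ holds if for every $i\ge 0$ the total space $\bigoplus_\xi\operatorname{GrExt}^i(k,M)_\xi$ is finite dimensional, where $k$ is the quotient of the algebra by the ideal generated by the homogeneous elements of nonzero degree. Let $N$ and $M$ be filtered $\mathbb Z^r$-graded $A$-modules. Suppose that $N$ is finitely generated with a standard filtration, i.e. $F_nN=(F_nA)V$ for some finite dimensional graded subspace $V\subset N$ that generates $N$ over $A$, and that the filtration of $M$ is exhaustive and discrete ($\bigcup_n F_nM=M$, and $F_nM=0$ for $n\ll0$). Then the following hold. 1. For every $\xi\in\mathbb Z^r$ there is a spectral sequence of $k$-vector spaces, with differentials $d^s\colon E^s_{p,q}\to E^s_{p-s,q+s-1}$ for $s\ge1$, that converges: $$E^1_{p,q}\cong\operatorname{GrExt}^{-p-q}_{\operatorname{gr}A}(\operatorname{gr}N,\operatorname{gr}M)_{(\xi,p)}\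 \Rightarrow\ \operatorname{GrExt}^{-p-q}_A(N,M)_\xi ,\qquad p,q\in\mathbb Z.$$ That is, each $H_n=\operatorname{GrExt}_A^{-n}(N,M)_\xi$ has an exhaustive ascending filtration $\{F_pH_n\}_{p\in\mathbb Z}$ by subspaces with $F_pH_n=0$ for $p\ll0$, and $E^\infty_{p,q}\cong F_pH_{p+q}/F_{p-1}H_{p+q}$. If moreover every $M_\zeta$ is finite dimensional (for instance, if $M$ is finitely generated), then these filtrations are finite. 2. For each $i\ge0$ and each $\xi\in\mathbb Z^r$, $$\dim_k\operatorname{GrExt}^i_A(N,M)_\xi\le\sum_{p\in\mathbb Z}\dim_k\operatorname{GrExt}^i_{\operatorname{gr}A}(\operatorname{gr}N,\operatorname{gr}M)_{(\xi,p)}.$$ 3. The projective and injective dimensions in the categories of graded modules satisfy $\operatorname{pd}_AN\le\operatorname{pd}_{\operatorname{gr}A}\operatorname{gr}N$ and $\operatorname{id}_AM\le\operatorname{id}_{\operatorname{gr}A}\operatorname{gr}M$. 4. If $\chi(\operatorname{gr}M)$ holds, then $\chi(M)$ holds. -/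

import Mathlib

open CategoryTheory CategoryTheory.Limits DirectSum

universe u

noncomputable section

/-! ### Graded modules -/

/-- Projections onto the pieces of a family of subspaces exhibit it as an internal grading. -/
theorem isInternal_of_proj {k M G : Type*} [Field k] [AddCommGroup M] [Module k M]
    [DecidableEq G] (D : G → Submodule k M) (P : G → M →ₗ[k] M)
    (hsame : ∀ i, ∀ x ∈ D i, P i x = x) (hne : ∀ i j, i ≠ j → ∀ x ∈ D j, P i x = 0)
    (htop : ∀ x, x ∈ ⨆ i, D i) : DirectSum.IsInternal D := by
  rw [DirectSum.isInternal_submodule_iff_iSupIndep_and_iSup_eq_top]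
  refine ⟨fun i => ?_, eq_top_iff.2 fun x _ => htop x⟩
  rw [Submodule.disjoint_def]
  intro x hx hx'
  have h0 : (⨆ (j) (_ : j ≠ i), D j) ≤ LinearMap.ker (P i) :=
    iSup_le fun j => iSup_le fun hj y hy => hne i j (Ne.symm hj) y hy
  rw [← hsame i x hx]
  exact h0 hx'

/-- The component of degree `i`, as a linear map. -/
def gradedProj {k M G : Type*} [Field k] [AddCommGroup M] [Module k M]
    [DecidableEq G] (D : G → Submodule k M) [DirectSum.Decomposition D] (i : G) : M →ₗ[k] M :=
  (D i).subtype ∘ₗ DirectSum.component k G (fun i => D i) i ∘ₗ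
    (DirectSum.decomposeLinearEquiv D).toLinearMap

theorem gradedProj_apply {k M G : Type*} [Field k] [AddCommGroup M] [Module k M]
    [DecidableEq G] (D : G → Submodule k M) [DirectSum.Decomposition D] (i : G) (x : M) :
    gradedProj D i x = (DirectSum.decompose D x i : M) := rfl

theorem mem_iSup_of_decompose {k M G : Type*} [Field k] [AddCommGroup M] [Module k M]
    [DecidableEq G] (D : G → Submodule k M) [DirectSum.Decomposition D]
    (p : Submodule k M) (x : M) (h : ∀ i, (DirectSum.decompose D x i : M) ∈ p) : x ∈ p := by
  classical
  rw [← DirectSum.sum_support_decompose D x]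
  exact Submodule.sum_mem _ fun i _ => h i

section GradedModules

variable {k A : Type u} {G : Type} [Field k] [Ring A] [Algebra k A] [AddCommGroup G] [DecidableEq G]

/-- A `G`-graded left module over the `G`-graded `k`-algebra `A = ⨁ i, 𝒜 i`. -/
structure GrMod (𝒜 : G → Submodule k A) [GradedAlgebra 𝒜] where
  carrier : Type u
  [addCommGroup : AddCommGroup carrier]
  [moduleBase : Module k carrier]
  [moduleAlg : Module A carrier]
  [tower : IsScalarTower k A carrier]
  /-- the homogeneous components -/
  deg : G → Submodule k carrier
  [dec : DirectSum.Decomposition deg]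
  [gradedSMul : SetLike.GradedSMul 𝒜 deg]

variable {𝒜 : G → Submodule k A} [GradedAlgebra 𝒜]

instance : CoeSort (GrMod 𝒜) (Type u) := ⟨GrMod.carrier⟩

attribute [instance] GrMod.addCommGroup GrMod.moduleBase GrMod.moduleAlg GrMod.tower GrMod.dec
  GrMod.gradedSMul

namespace GrMod

theorem smul_mem_deg (M : GrMod 𝒜) {i j : G} {a : A} {x : M} (ha : a ∈ 𝒜 i) (hx : x ∈ M.deg j) :
    a • x ∈ M.deg (i + j) :=
  SetLike.GradedSMul.smul_mem ha hx

/-- The `k`-space of `A`-linear maps `N → M` that are homogeneous of degree `0`. -/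
def homSpace (N M : GrMod 𝒜) : Submodule k (N →ₗ[A] M) where
  carrier := {f | ∀ i, ∀ x ∈ N.deg i, f x ∈ M.deg i}
  add_mem' hf hg i x hx := add_mem (hf i x hx) (hg i x hx)
  zero_mem' i _ _ := zero_mem (M.deg i)
  smul_mem' c _ hf i x hx := Submodule.smul_mem _ c (hf i x hx)

/-- The category of `G`-graded left `A`-modules with homogeneous maps of degree `0`. -/
instance : Category.{u} (GrMod 𝒜) where
  Hom N M := homSpace N M
  id N := ⟨LinearMap.id, fun _ _ hx => hx⟩
  comp f g := ⟨g.1 ∘ₗ f.1, fun i x hx => g.2 i _ (f.2 i x hx)⟩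

/-- The `A`-linear map underlying a morphism. -/
def lin {N M : GrMod 𝒜} (f : N ⟶ M) : N →ₗ[A] M := Subtype.val (p := (· ∈ homSpace N M)) f

/-- The morphism given by an `A`-linear map that preserves degrees. -/
def ofLin {N M : GrMod 𝒜} (f : N →ₗ[A] M) (hf : ∀ i, ∀ x ∈ N.deg i, f x ∈ M.deg i) : N ⟶ M :=
  Subtype.mk (p := (· ∈ homSpace N M)) f hf

theorem lin_mem {N M : GrMod 𝒜} (f : N ⟶ M) {i : G} {x : N} (hx : x ∈ N.deg i) :
    lin f x ∈ M.deg i :=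
  Subtype.prop (p := (· ∈ homSpace N M)) f i x hx

@[simp] theorem lin_ofLin {N M : GrMod 𝒜} (f : N →ₗ[A] M)
    (hf : ∀ i, ∀ x ∈ N.deg i, f x ∈ M.deg i) : lin (ofLin f hf) = f := rfl

@[simp] theorem lin_comp {N M L : GrMod 𝒜} (f : N ⟶ M) (g : M ⟶ L) :
    lin (f ≫ g) = lin g ∘ₗ lin f := rfl

@[simp] theorem lin_id (N : GrMod 𝒜) : lin (𝟙 N) = LinearMap.id := rfl

theorem lin_injective {N M : GrMod 𝒜} {f g : N ⟶ M} (h : lin f = lin g) : f = g :=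
  Subtype.ext (p := (· ∈ homSpace N M)) h

theorem hom_ext {N M : GrMod 𝒜} {f g : N ⟶ M} (h : ∀ x, lin f x = lin g x) : f = g :=
  lin_injective (LinearMap.ext h)

instance : Preadditive (GrMod 𝒜) where
  homGroup N M := inferInstanceAs (AddCommGroup (homSpace N M))
  add_comp _ _ _ f f' g := hom_ext fun x => (lin g).map_add (lin f x) (lin f' x)
  comp_add _ _ _ _ _ _ := rfl

@[simp] theorem lin_zero (N M : GrMod 𝒜) : lin (0 : N ⟶ M) = 0 := rfl

instance : Linear k (GrMod 𝒜) where
  homModule N M := inferInstanceAs (Module k (homSpace N M))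
  smul_comp _ _ _ c f g := hom_ext fun x => (lin g).map_smul_of_tower c (lin f x)
  comp_smul _ _ _ _ _ _ := rfl

theorem lin_decompose {N M : GrMod 𝒜} (f : N ⟶ M) (x : N) (i : G) :
    (DirectSum.decompose M.deg (lin f x) i : M) = lin f (DirectSum.decompose N.deg x i : N) := by
  induction x using DirectSum.Decomposition.inductionOn N.deg with
  | zero => simp
  | @homogeneous j m =>
    by_cases h : j = i
    · subst h
      rw [DirectSum.decompose_of_mem_same _ (lin_mem f m.2), DirectSum.decompose_coe,
        DirectSum.of_eq_same]
    · rw [DirectSum.decompose_of_mem_ne _ (lin_mem f m.2) h, DirectSum.decompose_coe,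
        DirectSum.of_eq_of_ne _ _ _ (Ne.symm h)]
      simp
  | add m m' h h' => simp [DirectSum.decompose_add, h, h']

/-- A homogeneous submodule of a graded module, as a graded module. -/
def sub (N : GrMod 𝒜) (p : Submodule A N) (hp : SetLike.IsHomogeneous N.deg p) : GrMod 𝒜 :=
  letI D : G → Submodule k p := fun i => (N.deg i).comap (p.subtype.restrictScalars k)
  haveI hD : DirectSum.IsInternal D := by
    refine isInternal_of_proj D (fun i => (gradedProj N.deg i).restrict
      (p := p.restrictScalars k) (q := p.restrictScalars k) fun x hx => hp i hx) ?_ ?_ ?_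
    · intro i x hx
      exact Subtype.ext (DirectSum.decompose_of_mem_same N.deg hx)
    · intro i j hij x hx
      exact Subtype.ext (DirectSum.decompose_of_mem_ne N.deg hx hij.symm)
    · intro x
      have key : (x : N) ∈ (⨆ i, D i).map (p.subtype.restrictScalars k) := by
        refine mem_iSup_of_decompose N.deg _ _ fun i => ?_
        exact ⟨⟨_, hp i x.2⟩, (le_iSup D i) (SetLike.coe_mem (DirectSum.decompose N.deg (x : N) i)),
          rfl⟩
      obtain ⟨y, hy, hyx⟩ := key
      rwa [← Subtype.ext hyx]
  { carrier := p
    deg := D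
    dec := hD.chooseDecomposition
    gradedSMul := ⟨fun {_ _ _ _} ha hx => N.smul_mem_deg ha hx⟩ }

/-- The quotient of a graded module by a homogeneous submodule, as a graded module. -/
def quot (N : GrMod 𝒜) (p : Submodule A N) (hp : SetLike.IsHomogeneous N.deg p) : GrMod 𝒜 :=
  letI D : G → Submodule k (N ⧸ p) := fun i => (N.deg i).map (p.mkQ.restrictScalars k)
  haveI hD : DirectSum.IsInternal D := by
    refine isInternal_of_proj D (fun i => (p.restrictScalars k).mapQ (p.restrictScalars k)
      (gradedProj N.deg i) fun x hx => hp i hx) ?_ ?_ ?_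
    · rintro i _ ⟨x, hx, rfl⟩
      exact congrArg (p.mkQ) (DirectSum.decompose_of_mem_same _ hx)
    · rintro i j hij _ ⟨x, hx, rfl⟩
      exact (congrArg (p.mkQ) (DirectSum.decompose_of_mem_ne _ hx hij.symm)).trans (map_zero _)
    · intro x
      obtain ⟨x, rfl⟩ := p.mkQ_surjective x
      refine mem_iSup_of_decompose N.deg ((⨆ i, D i).comap (p.mkQ.restrictScalars k)) x fun i => ?_
      exact (le_iSup D i) ⟨_, SetLike.coe_mem _, rfl⟩
  { carrier := N ⧸ p
    deg := D
    dec := hD.chooseDecomposition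
    gradedSMul := ⟨by
      rintro i j a _ ha ⟨x, hx, rfl⟩
      exact ⟨a • x, N.smul_mem_deg ha hx, rfl⟩⟩ }

/-- The suspension `M[ξ]`: the same module, with `M[ξ]_ζ = M_{ζ + ξ}`. -/
def shift (M : GrMod 𝒜) (ξ : G) : GrMod 𝒜 :=
  letI D : G → Submodule k M := fun ζ => M.deg (ζ + ξ)
  haveI hD : DirectSum.IsInternal D := by
    refine isInternal_of_proj D (fun ζ => gradedProj M.deg (ζ + ξ)) ?_ ?_ ?_
    · exact fun i x hx => DirectSum.decompose_of_mem_same _ hx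
    · exact fun i j hij x hx => DirectSum.decompose_of_mem_ne _ hx
        fun h => hij (add_right_cancel h).symm
    · refine fun x => mem_iSup_of_decompose M.deg _ _ fun i => (le_iSup D (i - ξ)) ?_
      change _ ∈ M.deg (i - ξ + ξ)
      rw [sub_add_cancel]
      exact SetLike.coe_mem _
  { carrier := M
    deg := D
    dec := hD.chooseDecomposition
    gradedSMul := ⟨fun {i j a x} ha hx => by
      change a • x ∈ M.deg (i + j + ξ)
      rw [add_assoc]
      exact M.smul_mem_deg ha hx⟩ }

/-- The direct sum of two graded modules. -/
def prod (N M : GrMod 𝒜) : GrMod 𝒜 :=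
  letI D : G → Submodule k (N × M) := fun i => (N.deg i).prod (M.deg i)
  haveI hD : DirectSum.IsInternal D := by
    refine isInternal_of_proj D (fun i => (gradedProj N.deg i).prodMap (gradedProj M.deg i)) ?_ ?_ ?_
    · exact fun i x hx => Prod.ext (DirectSum.decompose_of_mem_same _ hx.1)
        (DirectSum.decompose_of_mem_same _ hx.2)
    · exact fun i j hij x hx => Prod.ext (DirectSum.decompose_of_mem_ne _ hx.1 hij.symm)
        (DirectSum.decompose_of_mem_ne _ hx.2 hij.symm)
    · rintro ⟨x, y⟩
      have h1 : (x, (0 : M)) ∈ ⨆ i, D i :=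
        mem_iSup_of_decompose N.deg ((⨆ i, D i).comap (LinearMap.inl k N M)) x fun i =>
          (le_iSup D i) ⟨SetLike.coe_mem _, zero_mem _⟩
      have h2 : ((0 : N), y) ∈ ⨆ i, D i :=
        mem_iSup_of_decompose M.deg ((⨆ i, D i).comap (LinearMap.inr k N M)) y fun i =>
          (le_iSup D i) ⟨zero_mem _, SetLike.coe_mem _⟩
      simpa using add_mem h1 h2
  { carrier := N × M
    deg := D
    dec := hD.chooseDecomposition
    gradedSMul := ⟨fun {_ _ _ _} ha hx => ⟨N.smul_mem_deg ha hx.1, M.smul_mem_deg ha hx.2⟩⟩ }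

/-- The zero graded module. -/
def zero : GrMod 𝒜 :=
  letI D : G → Submodule k PUnit.{u + 1} := fun _ => ⊥
  haveI hD : DirectSum.IsInternal D :=
    isInternal_of_proj D (fun _ => 0) (fun _ _ _ => rfl) (fun _ _ _ _ _ => rfl)
      fun x => (Subsingleton.elim 0 x) ▸ zero_mem _
  { carrier := PUnit.{u + 1}
    deg := D
    dec := hD.chooseDecomposition
    gradedSMul := ⟨fun {_ _ _ _} _ _ => Subsingleton.elim _ _⟩ }

theorem ker_homogeneous {N M : GrMod 𝒜} (f : N ⟶ M) :
    SetLike.IsHomogeneous N.deg (LinearMap.ker (lin f)) := by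
  intro i x hx
  rw [LinearMap.mem_ker] at hx ⊢
  rw [← lin_decompose, hx]
  simp

theorem range_homogeneous {N M : GrMod 𝒜} (f : N ⟶ M) :
    SetLike.IsHomogeneous M.deg (LinearMap.range (lin f)) := by
  rintro i _ ⟨x, rfl⟩
  exact ⟨_, (lin_decompose f x i).symm⟩

/-- The inclusion of a homogeneous submodule. -/
def subι (N : GrMod 𝒜) (p : Submodule A N) (hp : SetLike.IsHomogeneous N.deg p) :
    N.sub p hp ⟶ N :=
  ofLin p.subtype fun _ _ hx => hx

/-- The projection onto a graded quotient module. -/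
def quotπ (N : GrMod 𝒜) (p : Submodule A N) (hp : SetLike.IsHomogeneous N.deg p) :
    N ⟶ N.quot p hp :=
  ofLin p.mkQ fun _ x hx => ⟨x, hx, rfl⟩

theorem lin_apply_of_comp_eq_zero {N M L : GrMod 𝒜} {f : N ⟶ M} {g : M ⟶ L} (w : f ≫ g = 0)
    (x : N) : lin g (lin f x) = 0 :=
  LinearMap.congr_fun (congrArg lin w) x

theorem subι_comp {N M : GrMod 𝒜} (f : N ⟶ M) : N.subι _ (ker_homogeneous f) ≫ f = 0 :=
  hom_ext fun x => LinearMap.mem_ker.1 (Subtype.prop (p := (· ∈ LinearMap.ker (lin f))) x)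

theorem comp_quotπ {N M : GrMod 𝒜} (f : N ⟶ M) : f ≫ M.quotπ _ (range_homogeneous f) = 0 :=
  hom_ext fun x => (Submodule.Quotient.mk_eq_zero _).2 ⟨x, rfl⟩

/-- An injective morphism whose image is the kernel of `g` is a kernel of `g`. -/
def isLimitOfExact {N M L : GrMod 𝒜} (f : N ⟶ M) (g : M ⟶ L) (w : f ≫ g = 0)
    (hinj : Function.Injective (lin f))
    (hex : ∀ y, lin g y = 0 → y ∈ LinearMap.range (lin f)) :
    IsLimit (KernelFork.ofι f w) :=
  letI e := LinearEquiv.ofInjective (lin f) hinj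
  haveI he : ∀ y, lin f (e.symm y) = y := fun y =>
    congrArg Subtype.val (LinearEquiv.apply_symm_apply e y)
  KernelFork.IsLimit.ofι f w
    (fun {W} h hw => ofLin (e.symm.toLinearMap ∘ₗ (lin h).codRestrict _ fun x =>
        hex _ (lin_apply_of_comp_eq_zero hw x)) fun i x hx => by
      set y : N := e.symm ⟨lin h x, hex _ (lin_apply_of_comp_eq_zero hw x)⟩ with hy
      have hfy : lin f y = lin h x := he _
      have h1 : lin f (DirectSum.decompose N.deg y i : N) = lin f y := by
        rw [← lin_decompose, hfy, DirectSum.decompose_of_mem_same _ (lin_mem h hx)]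
      change y ∈ N.deg i
      rw [← hinj h1]
      exact SetLike.coe_mem _)
    (fun h hw => hom_ext fun x => he _)
    (fun h hw m hm => hom_ext fun x => hinj ((LinearMap.congr_fun (congrArg lin hm) x).trans
      (he ⟨lin h x, hex _ (lin_apply_of_comp_eq_zero hw x)⟩).symm))

/-- A surjective morphism whose kernel is the image of `g` is a cokernel of `g`. -/
def isColimitOfExact {N M L : GrMod 𝒜} (g : L ⟶ N) (f : N ⟶ M) (w : g ≫ f = 0)
    (hsurj : Function.Surjective (lin f))
    (hex : ∀ y, lin f y = 0 → y ∈ LinearMap.range (lin g)) :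
    IsColimit (CokernelCofork.ofπ f w) :=
  letI e := (lin f).quotKerEquivOfSurjective hsurj
  haveI hker : ∀ {W : GrMod 𝒜} (h : N ⟶ W), g ≫ h = 0 → LinearMap.ker (lin f) ≤
      LinearMap.ker (lin h) := fun h hw y hy => by
    obtain ⟨z, rfl⟩ := hex y hy
    exact lin_apply_of_comp_eq_zero hw z
  haveI he : ∀ x, e.symm (lin f x) = Submodule.Quotient.mk x := fun x =>
    (LinearEquiv.symm_apply_eq e).2 rfl
  CokernelCofork.IsColimit.ofπ f w
    (fun {W} h hw => ofLin (Submodule.liftQ _ (lin h) (hker h hw) ∘ₗ e.symm.toLinearMap)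
      fun i y hy => by
        obtain ⟨x, rfl⟩ := hsurj y
        have h1 : lin f (DirectSum.decompose N.deg x i : N) = lin f x := by
          rw [← lin_decompose, DirectSum.decompose_of_mem_same _ hy]
        rw [← h1]
        change Submodule.liftQ _ (lin h) (hker h hw) (e.symm _) ∈ _
        rw [he]
        exact lin_mem h (SetLike.coe_mem _))
    (fun h hw => hom_ext fun x => by
      change Submodule.liftQ _ (lin h) (hker h hw) (e.symm (lin f x)) = _
      rw [he]
      rfl)
    (fun h hw m hm => hom_ext fun y => by
      obtain ⟨x, rfl⟩ := hsurj y
      refine (LinearMap.congr_fun (congrArg lin hm) x).trans ?_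
      change _ = Submodule.liftQ _ (lin h) (hker h hw) (e.symm _)
      rw [he]
      rfl)

instance : HasKernels (GrMod 𝒜) where
  has_limit f := ⟨⟨⟨_, isLimitOfExact (subι _ _ (ker_homogeneous f)) f (subι_comp f)
    Subtype.val_injective fun y hy => ⟨⟨y, hy⟩, rfl⟩⟩⟩⟩

instance : HasCokernels (GrMod 𝒜) where
  has_colimit f := ⟨⟨⟨_, isColimitOfExact f (quotπ _ _ (range_homogeneous f)) (comp_quotπ f)
    (Submodule.mkQ_surjective _) fun _ hy => (Submodule.Quotient.mk_eq_zero _).1 hy⟩⟩⟩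

instance : HasZeroObject (GrMod 𝒜) :=
  ⟨zero, ⟨fun _ => ⟨⟨⟨0⟩, fun _ => hom_ext fun x => by
    rw [show x = 0 from Subsingleton.elim (α := PUnit) _ _, map_zero, map_zero]⟩⟩,
    fun _ => ⟨⟨⟨0⟩, fun _ => hom_ext fun x => Subsingleton.elim (α := PUnit) _ _⟩⟩⟩⟩

instance : HasBinaryBiproducts (GrMod 𝒜) :=
  haveI : ∀ {N M : GrMod 𝒜}, HasLimit (pair N M) := fun {N M} => ⟨⟨⟨BinaryFan.mk
      (ofLin (N := N.prod M) (LinearMap.fst A N M) fun _ _ hx => hx.1)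
      (ofLin (N := N.prod M) (LinearMap.snd A N M) fun _ _ hx => hx.2),
      BinaryFan.isLimitMk
        (fun s => ofLin (M := N.prod M) ((lin s.fst).prod (lin s.snd)) fun _ _ hx =>
          ⟨lin_mem s.fst hx, lin_mem s.snd hx⟩)
        (fun _ => rfl) (fun _ => rfl)
        (fun _ _ h1 h2 => hom_ext fun x => Prod.ext (LinearMap.congr_fun (congrArg lin h1) x)
          (LinearMap.congr_fun (congrArg lin h2) x))⟩⟩⟩
  haveI := hasBinaryProducts_of_hasLimit_pair (GrMod 𝒜)
  HasBinaryBiproducts.of_hasBinaryProducts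

theorem injective_of_mono {N M : GrMod 𝒜} (f : N ⟶ M) [Mono f] :
    Function.Injective (lin f) := by
  have h : N.subι _ (ker_homogeneous f) = 0 := zero_of_comp_mono f (subι_comp f)
  rw [← LinearMap.ker_eq_bot, eq_bot_iff]
  exact fun x hx => LinearMap.congr_fun (congrArg lin h) ⟨x, hx⟩

theorem surjective_of_epi {N M : GrMod 𝒜} (f : N ⟶ M) [Epi f] :
    Function.Surjective (lin f) := by
  have h : M.quotπ _ (range_homogeneous f) = 0 := zero_of_epi_comp f (comp_quotπ f)
  rw [← LinearMap.range_eq_top, eq_top_iff]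
  exact fun x _ => (Submodule.Quotient.mk_eq_zero _).1 (LinearMap.congr_fun (congrArg lin h) x)

/-- Graded modules form an abelian category. -/
instance : Abelian (GrMod 𝒜) where
  normalMonoOfMono f _ := ⟨{
    Z := _
    g := quotπ _ _ (range_homogeneous f)
    w := comp_quotπ f
    isLimit := isLimitOfExact f _ _ (injective_of_mono f)
      fun _ hy => (Submodule.Quotient.mk_eq_zero _).1 hy }⟩
  normalEpiOfEpi f _ := ⟨{
    W := _
    g := subι _ _ (ker_homogeneous f)
    w := subι_comp f
    isColimit := isColimitOfExact _ f _ (surjective_of_epi f) fun y hy => ⟨⟨y, hy⟩, rfl⟩ }⟩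
  has_finite_products := hasFiniteProducts_of_has_binary_and_terminal

end GrMod

end GradedModules
/-! ### Filtrations and associated graded objects -/

section Filtrations

variable {k A : Type u} {G : Type} [Field k] [Ring A] [Algebra k A] [AddCommGroup G]
  [DecidableEq G]

/-- An ascending filtration of the graded algebra `A` by graded subspaces, with
`1 ∈ F 0` and `F m * F n ⊆ F (m + n)`. -/
structure AlgFiltration (𝒜 : G → Submodule k A) [GradedAlgebra 𝒜] where
  layer : ℤ → Submodule k A
  [isFiltration : IsRingFiltration layer fun n => layer (n - 1)]
  homogeneous (n : ℤ) : SetLike.IsHomogeneous 𝒜 (layer n)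

attribute [instance] AlgFiltration.isFiltration

/-- A connected filtration: an exhaustive filtration `k = F 0 ⊆ F 1 ⊆ ⋯` with finite dimensional
layers (and zero in negative degrees). -/
structure AlgFiltration.IsConnected {𝒜 : G → Submodule k A} [GradedAlgebra 𝒜]
    (FA : AlgFiltration 𝒜) : Prop where
  neg (n : ℤ) (hn : n < 0) : FA.layer n = ⊥
  zero : FA.layer 0 = LinearMap.range (Algebra.linearMap k A)
  finite (n : ℤ) : FiniteDimensional k (FA.layer n)
  exhaustive (a : A) : ∃ n, a ∈ FA.layer n

/-- An ascending filtration of the graded module `M` by graded subspaces, with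
`F m A • F n M ⊆ F (m + n) M`. -/
structure ModFiltration {𝒜 : G → Submodule k A} [GradedAlgebra 𝒜] (FA : AlgFiltration 𝒜)
    (M : GrMod 𝒜) where
  layer : ℤ → Submodule k M
  [isFiltration : IsModuleFiltration FA.layer (fun n => FA.layer (n - 1))
    layer fun n => layer (n - 1)]
  homogeneous (n : ℤ) : SetLike.IsHomogeneous M.deg (layer n)

attribute [instance] ModFiltration.isFiltration

namespace ModFiltration

variable {𝒜 : G → Submodule k A} [GradedAlgebra 𝒜] {FA : AlgFiltration 𝒜} {M : GrMod 𝒜}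

/-- The filtration is exhaustive: its layers cover `M`. -/
def IsExhaustive (F : ModFiltration FA M) : Prop := ∀ x : M, ∃ n, x ∈ F.layer n

/-- The filtration is discrete: its layers vanish in sufficiently negative degrees. -/
def IsDiscrete (F : ModFiltration FA M) : Prop := ∃ n₀ : ℤ, ∀ n < n₀, F.layer n = ⊥

/-- The filtration is the standard one `F n M = (F n A) V` given by a finite dimensional graded
subspace `V` that generates `M` over `A`; in particular `M` is finitely generated. -/
def IsStandard (F : ModFiltration FA M) : Prop :=
  ∃ V : Submodule k M, SetLike.IsHomogeneous M.deg V ∧ FiniteDimensional k V ∧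
    Submodule.span A (V : Set M) = ⊤ ∧
    ∀ n, F.layer n = Submodule.span k {x | ∃ a ∈ FA.layer n, ∃ v ∈ V, x = a • v}

end ModFiltration

end Filtrations

section Pieces

variable {k M : Type u} {G : Type} [Field k] [AddCommGroup M] [Module k M]

/-- The space `F_p M_ξ = F_p M ∩ M_ξ`, for `i = (ξ, p)`. -/
abbrev filtPiece (F : ℤ → Submodule k M) (D : G → Submodule k M) (i : G × ℤ) : Submodule k M :=
  F i.2 ⊓ D i.1

/-- The space `F_p M_ξ / F_{p-1} M_ξ`, for `i = (ξ, p)`. -/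
abbrev GrPiece (F : ℤ → Submodule k M) (D : G → Submodule k M) (i : G × ℤ) : Type u :=
  filtPiece F D i ⧸ (filtPiece F D (i.1, i.2 - 1)).submoduleOf (filtPiece F D i)

/-- The class of an element of `F_p M_ξ` in `F_p M_ξ / F_{p-1} M_ξ`, for `i = (ξ, p)`. -/
def GrPiece.mk (F : ℤ → Submodule k M) (D : G → Submodule k M) (i : G × ℤ) :
    filtPiece F D i →ₗ[k] GrPiece F D i :=
  Submodule.mkQ _

theorem GrPiece.mk_surjective (F : ℤ → Submodule k M) (D : G → Submodule k M) (i : G × ℤ) :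
    Function.Surjective (GrPiece.mk F D i) :=
  Submodule.mkQ_surjective _

theorem GrPiece.mk_eq (F : ℤ → Submodule k M) (D : G → Submodule k M) {i j : G × ℤ} (h : i = j)
    (x : filtPiece F D i) (y : filtPiece F D j) (hxy : (x : M) = y) :
    (⟨i, GrPiece.mk F D i x⟩ : GradedMonoid (GrPiece F D)) = ⟨j, GrPiece.mk F D j y⟩ := by
  subst h
  rw [Subtype.ext hxy]

end Pieces

section AssociatedGraded

variable {k A : Type u} {G : Type} [Field k] [Ring A] [Algebra k A] [AddCommGroup G]
  [DecidableEq G]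

variable {𝒜 : G → Submodule k A} [GradedAlgebra 𝒜] (FA : AlgFiltration 𝒜)

section Action

variable {M : Type u} [AddCommGroup M] [Module k M] [Module A M] [IsScalarTower k A M]
  (F : ℤ → Submodule k M) (D : G → Submodule k M)
  [hF : IsModuleFiltration FA.layer (fun n => FA.layer (n - 1)) F fun n => F (n - 1)]
  [hD : SetLike.GradedSMul 𝒜 D]

/-- Multiplication `F_p A_ξ × F_q M_ζ → F_{p+q} M_{ξ+ζ}`. -/
def filtPieceSMul (i j : G × ℤ) :
    filtPiece FA.layer 𝒜 i →ₗ[k] filtPiece F D j →ₗ[k] filtPiece F D (i + j) :=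
  LinearMap.mk₂ k (fun a x => ⟨(a : A) • (x : M),
      ⟨hF.toGradedSMul.smul_mem a.2.1 x.2.1, hD.smul_mem a.2.2 x.2.2⟩⟩)
    (fun _ _ _ => Subtype.ext (add_smul _ _ _)) (fun _ _ _ => Subtype.ext (smul_assoc _ _ _))
    (fun _ _ _ => Subtype.ext (smul_add _ _ _))
    (fun _ _ _ => Subtype.ext (smul_comm _ _ _))

/-- The induced multiplication on the pieces of the associated graded objects. -/
def grPieceSMul (i j : G × ℤ) :
    GrPiece FA.layer 𝒜 i →ₗ[k] GrPiece F D j →ₗ[k] GrPiece F D (i + j) :=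
  LinearMap.liftQ₂ _ _ ((filtPieceSMul FA F D i j).compr₂ (GrPiece.mk F D (i + j)))
    (by
      intro a ha
      ext x
      refine (Submodule.Quotient.mk_eq_zero _).2 ⟨?_, (filtPieceSMul FA F D i j a x).2.2⟩
      change (a : A) • (x : M) ∈ F (i.2 + j.2 - 1)
      rw [show i.2 + j.2 - 1 = (i.2 - 1) + j.2 by ring]
      exact hF.toGradedSMul.smul_mem ha.1 x.2.1)
    (by
      intro x hx
      ext a
      refine (Submodule.Quotient.mk_eq_zero _).2 ⟨?_, (filtPieceSMul FA F D i j a x).2.2⟩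
      change (a : A) • (x : M) ∈ F (i.2 + j.2 - 1)
      rw [add_sub_assoc]
      exact hF.toGradedSMul.smul_mem a.2.1 hx.1)

theorem grPieceSMul_mk (i j : G × ℤ) (a : filtPiece FA.layer 𝒜 i) (x : filtPiece F D j) :
    grPieceSMul FA F D i j (GrPiece.mk _ _ i a) (GrPiece.mk _ _ j x) =
      GrPiece.mk _ _ (i + j) (filtPieceSMul FA F D i j a x) := rfl

end Action

instance : IsModuleFiltration FA.layer (fun n => FA.layer (n - 1))
    FA.layer fun n => FA.layer (n - 1) where
  toIsFiltration := FA.isFiltration.toIsFiltration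
  smul_mem {_ _ _ _} ha hb := FA.isFiltration.toGradedMonoid.mul_mem ha hb

/-- The scalars, as elements of `F_0 A_0`. -/
def scalarPiece : k →ₗ[k] filtPiece FA.layer 𝒜 (0 : G × ℤ) :=
  LinearMap.codRestrict _ (Algebra.linearMap k A) fun c => by
    rw [Algebra.linearMap_apply, Algebra.algebraMap_eq_smul_one]
    exact Submodule.smul_mem _ c
      ⟨FA.isFiltration.toGradedMonoid.one_mem, SetLike.GradedOne.one_mem⟩

theorem coe_scalarPiece (c : k) : (scalarPiece FA c : A) = algebraMap k A c := rfl

/-- The class of a scalar in degree `(0, 0)`. -/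
def grScalar : k →ₗ[k] GrPiece FA.layer 𝒜 0 :=
  GrPiece.mk FA.layer 𝒜 0 ∘ₗ scalarPiece FA

instance : GradedMonoid.GMul (GrPiece FA.layer 𝒜) where
  mul a b := grPieceSMul FA FA.layer 𝒜 _ _ a b

instance : GradedMonoid.GOne (GrPiece FA.layer 𝒜) where
  one := grScalar FA 1

/-- Multiplication of classes makes the pieces of `gr A` a graded ring. -/
instance : DirectSum.GRing (GrPiece FA.layer 𝒜) where
  mul_zero a := map_zero (grPieceSMul FA FA.layer 𝒜 _ _ a)
  zero_mul b := LinearMap.map_zero₂ (grPieceSMul FA FA.layer 𝒜 _ _) b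
  mul_add a b c := map_add (grPieceSMul FA FA.layer 𝒜 _ _ a) b c
  add_mul a b c := LinearMap.map_add₂ (grPieceSMul FA FA.layer 𝒜 _ _) a b c
  one_mul := by
    rintro ⟨i, a⟩
    obtain ⟨a, rfl⟩ := GrPiece.mk_surjective _ _ _ a
    refine GrPiece.mk_eq _ _ (zero_add i) (filtPieceSMul FA FA.layer 𝒜 0 i (scalarPiece FA 1) a) a ?_
    change algebraMap k A 1 * (a : A) = a
    rw [map_one, one_mul]
  mul_one := by
    rintro ⟨i, a⟩
    obtain ⟨a, rfl⟩ := GrPiece.mk_surjective _ _ _ a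
    refine GrPiece.mk_eq _ _ (add_zero i) (filtPieceSMul FA FA.layer 𝒜 i 0 a (scalarPiece FA 1)) a ?_
    change (a : A) * algebraMap k A 1 = a
    rw [map_one, mul_one]
  mul_assoc := by
    rintro ⟨i, a⟩ ⟨j, b⟩ ⟨l, c⟩
    obtain ⟨a, rfl⟩ := GrPiece.mk_surjective _ _ _ a
    obtain ⟨b, rfl⟩ := GrPiece.mk_surjective _ _ _ b
    obtain ⟨c, rfl⟩ := GrPiece.mk_surjective _ _ _ c
    exact GrPiece.mk_eq _ _ (add_assoc i j l)
      (filtPieceSMul FA FA.layer 𝒜 (i + j) l (filtPieceSMul FA FA.layer 𝒜 i j a b) c)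
      (filtPieceSMul FA FA.layer 𝒜 i (j + l) a (filtPieceSMul FA FA.layer 𝒜 j l b c))
      (mul_assoc (a : A) b c)
  natCast n := grScalar FA n
  natCast_zero := by simp
  natCast_succ n := by rw [Nat.cast_succ, map_add]; rfl
  intCast n := grScalar FA n
  intCast_ofNat n := by simp
  intCast_negSucc_ofNat n := by rw [Int.cast_negSucc, map_neg]

instance : DirectSum.GAlgebra k (GrPiece FA.layer 𝒜) where
  toFun := (grScalar FA).toAddMonoidHom
  map_one := rfl
  map_mul c d := GrPiece.mk_eq _ _ (add_zero 0).symm (scalarPiece FA (c * d))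
    (filtPieceSMul FA FA.layer 𝒜 0 0 (scalarPiece FA c) (scalarPiece FA d)) (map_mul (algebraMap k A) c d)
  commutes := by
    rintro c ⟨i, a⟩
    obtain ⟨a, rfl⟩ := GrPiece.mk_surjective _ _ _ a
    exact GrPiece.mk_eq _ _ (add_comm 0 i) (filtPieceSMul FA FA.layer 𝒜 0 i (scalarPiece FA c) a)
      (filtPieceSMul FA FA.layer 𝒜 i 0 a (scalarPiece FA c)) (Algebra.commutes c (a : A))
  smul_def := by
    rintro c ⟨i, a⟩
    obtain ⟨a, rfl⟩ := GrPiece.mk_surjective _ _ _ a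
    exact GrPiece.mk_eq _ _ (zero_add i).symm (c • a)
      (filtPieceSMul FA FA.layer 𝒜 0 i (scalarPiece FA c) a) (Algebra.smul_def c (a : A))

/-- The associated graded algebra `gr A = ⨁_{(ξ, p)} F_p A_ξ / F_{p-1} A_ξ`. -/
def GrAlg : Type u := ⨁ i : G × ℤ, GrPiece FA.layer 𝒜 i

instance : Ring (GrAlg FA) := inferInstanceAs (Ring (⨁ i, GrPiece FA.layer 𝒜 i))

instance : Algebra k (GrAlg FA) := inferInstanceAs (Algebra k (⨁ i, GrPiece FA.layer 𝒜 i))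

/-- The canonical internal grading of an external direct sum. -/
def sumDeg (k : Type u) [Field k] {H : Type} [DecidableEq H] (X : H → Type u)
    [∀ i, AddCommGroup (X i)] [∀ i, Module k (X i)] (i : H) : Submodule k (⨁ i, X i) :=
  LinearMap.range (DirectSum.lof k H X i)

theorem sumDeg_isInternal (k : Type u) [Field k] {H : Type} [DecidableEq H] (X : H → Type u)
    [∀ i, AddCommGroup (X i)] [∀ i, Module k (X i)] : DirectSum.IsInternal (sumDeg k X) := by
  refine isInternal_of_proj _ (fun i => DirectSum.lof k H X i ∘ₗ DirectSum.component k H X i) ?_ ?_ ?_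
  · rintro i _ ⟨x, rfl⟩
    simp [DirectSum.component.lof_self]
  · rintro i j hij _ ⟨x, rfl⟩
    simp [DirectSum.component.of, hij.symm]
  · intro x
    induction x using DirectSum.induction_on with
    | zero => exact zero_mem _
    | of i x => exact le_iSup (sumDeg k X) i ⟨x, rfl⟩
    | add x y hx hy => exact add_mem hx hy

/-- The homogeneous components of `gr A`, indexed by the pairs `(ξ, p)`. -/
def grDeg (i : G × ℤ) : Submodule k (GrAlg FA) := sumDeg k (GrPiece FA.layer 𝒜) i

instance : GradedAlgebra (grDeg FA) where
  one_mem := ⟨grScalar FA 1, rfl⟩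
  mul_mem := by
    rintro i j _ _ ⟨a, rfl⟩ ⟨b, rfl⟩
    exact ⟨_, (DirectSum.of_mul_of (A := GrPiece FA.layer 𝒜) a b).symm⟩
  toDecomposition := (sumDeg_isInternal k (GrPiece FA.layer 𝒜)).chooseDecomposition

namespace ModFiltration

variable {FA} {M : GrMod 𝒜} (F : ModFiltration FA M)

/-- Multiplication of classes makes the pieces of `gr M` a graded module over those of `gr A`. -/
instance : DirectSum.Gmodule (GrPiece FA.layer 𝒜) (GrPiece F.layer M.deg) where
  smul a x := grPieceSMul FA F.layer M.deg _ _ a x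
  one_smul := by
    rintro ⟨j, x⟩
    obtain ⟨x, rfl⟩ := GrPiece.mk_surjective _ _ _ x
    refine GrPiece.mk_eq _ _ (zero_add j)
      (filtPieceSMul FA F.layer M.deg 0 j (scalarPiece FA 1) x) x ?_
    change algebraMap k A 1 • (x : M) = x
    rw [map_one, one_smul]
  mul_smul := by
    rintro ⟨i, a⟩ ⟨j, b⟩ ⟨l, x⟩
    obtain ⟨a, rfl⟩ := GrPiece.mk_surjective _ _ _ a
    obtain ⟨b, rfl⟩ := GrPiece.mk_surjective _ _ _ b
    obtain ⟨x, rfl⟩ := GrPiece.mk_surjective _ _ _ x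
    exact GrPiece.mk_eq _ _ (add_assoc i j l)
      (filtPieceSMul FA F.layer M.deg (i + j) l (filtPieceSMul FA FA.layer 𝒜 i j a b) x)
      (filtPieceSMul FA F.layer M.deg i (j + l) a (filtPieceSMul FA F.layer M.deg j l b x))
      (mul_smul (a : A) (b : A) (x : M))
  smul_add a x y := map_add _ _ _
  smul_zero a := map_zero _
  add_smul a b x := by simp
  zero_smul x := by simp

/-- The associated graded module `gr M = ⨁_{(ξ, p)} F_p M_ξ / F_{p-1} M_ξ` over `gr A`. -/
def gr : GrMod (grDeg FA) :=
  letI mod : Module (GrAlg FA) (⨁ i, GrPiece F.layer M.deg i) :=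
    inferInstanceAs (Module (⨁ i, GrPiece FA.layer 𝒜 i) (⨁ i, GrPiece F.layer M.deg i))
  { carrier := ⨁ i : G × ℤ, GrPiece F.layer M.deg i
    moduleAlg := mod
    tower := ⟨fun c a x => by
      have h1 : c • a = algebraMap k (GrAlg FA) c * a := Algebra.smul_def c a
      rw [h1, mul_smul]
      generalize a • x = y
      induction y using DirectSum.induction_on with
      | zero => rw [smul_zero, smul_zero]
      | add y z hy hz => rw [smul_add, smul_add, hy, hz]
      | of j y =>
        obtain ⟨y, rfl⟩ := GrPiece.mk_surjective _ _ _ y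
        refine (DirectSum.Gmodule.of_smul_of (GrPiece FA.layer 𝒜) (GrPiece F.layer M.deg)
          (grScalar FA c) (GrPiece.mk _ _ j y)).trans ?_
        refine (DirectSum.of_eq_of_gradedMonoid_eq (GrPiece.mk_eq _ _ (zero_add j)
          (filtPieceSMul FA F.layer M.deg 0 j (scalarPiece FA c) y) (c • y) ?_)).trans ?_
        · exact algebraMap_smul A c (y : M)
        · exact (DirectSum.lof k _ (GrPiece F.layer M.deg) j).map_smul c (GrPiece.mk _ _ j y)⟩
    deg := sumDeg k (GrPiece F.layer M.deg)
    dec := (sumDeg_isInternal k (GrPiece F.layer M.deg)).chooseDecomposition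
    gradedSMul := ⟨by
      rintro i j _ _ ⟨a, rfl⟩ ⟨x, rfl⟩
      exact ⟨_, (DirectSum.Gmodule.of_smul_of (GrPiece FA.layer 𝒜) (GrPiece F.layer M.deg)
        a x).symm⟩⟩ }

end ModFiltration

end AssociatedGraded

/-! ### Graded Ext spaces -/

section GradedExt

variable {k A : Type u} {G : Type} [Field k] [Ring A] [Algebra k A] [AddCommGroup G]
  [DecidableEq G]

/-- The component of degree `ξ` of the graded vector space `GrExt^i_A(N, M)`. As `GrExt^i_A` is the
`i`-th right derived functor of `GrHom_A(N, M) = ⨁_ξ Hom(N, M[ξ])`, with `Hom` the homogeneous maps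
of degree `0`, this is the `Ext` space from `N` to `M[ξ]` in the category of graded modules. -/
def GrExt {𝒜 : G → Submodule k A} [GradedAlgebra 𝒜] (i : ℕ) (N M : GrMod 𝒜) (ξ : G) :
    ModuleCat.{u + 1} k :=
  haveI := HasExt.standard (GrMod 𝒜)
  ModuleCat.of k (Abelian.Ext.{u + 1} N (M.shift ξ) i)

/-- `GrExt^n_A(N, M)_ξ` for an integer `n`; it is zero for `n < 0`. -/
def GrExtInt {𝒜 : G → Submodule k A} [GradedAlgebra 𝒜] : ℤ → GrMod 𝒜 → GrMod 𝒜 → G →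
    ModuleCat.{u + 1} k
  | Int.ofNat i, N, M, ξ => GrExt i N M ξ
  | Int.negSucc _, _, _, _ => ModuleCat.of k PUnit.{u + 2}

variable (𝒜 : G → Submodule k A) [GradedAlgebra 𝒜]

/-- `A` as a graded left module over itself. -/
def GrMod.regular : GrMod 𝒜 where
  carrier := A
  deg := 𝒜

/-- The left ideal `𝔪` generated by the homogeneous elements of nonzero degree. -/
def gradedMaximalIdeal : Submodule A A := Submodule.span A {a | ∃ ξ ≠ 0, a ∈ 𝒜 ξ}

theorem gradedMaximalIdeal_homogeneous :
    SetLike.IsHomogeneous (GrMod.regular 𝒜).deg (gradedMaximalIdeal 𝒜) :=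
  Ideal.homogeneous_span 𝒜 _ fun _ ⟨ξ, _, ha⟩ => ⟨ξ, ha⟩

/-- The graded left module `A / 𝔪`. If `A` is connected, this is the trivial module `k`. -/
def GrMod.residue : GrMod 𝒜 :=
  (GrMod.regular 𝒜).quot (gradedMaximalIdeal 𝒜) (gradedMaximalIdeal_homogeneous 𝒜)

variable {𝒜}

/-- The condition `χ(M)`: for each `i`, the graded vector space `GrExt^i_A(k, M)` is finite
dimensional. -/
def GrMod.Chi (M : GrMod 𝒜) : Prop :=
  ∀ i : ℕ, FiniteDimensional k (⨁ ξ : G, GrExt i (GrMod.residue 𝒜) M ξ)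

end GradedExt

/-- A `ℤ^r`-grading `𝒜` of the `k`-algebra `A` makes it a connected `ℕ^r`-graded algebra: it is
concentrated in degrees in `ℕ^r`, and `A_0 = k`. -/
structure IsConnectedGrading {k A : Type u} [Field k] [Ring A] [Algebra k A] {r : ℕ}
    (𝒜 : (Fin r → ℤ) → Submodule k A) : Prop where
  nontrivial : Nontrivial A
  nonneg (ξ : Fin r → ℤ) (hξ : ¬ 0 ≤ ξ) : 𝒜 ξ = ⊥
  zero : 𝒜 0 = LinearMap.range (Algebra.linearMap k A)

/-! ### Convergence of spectral sequences -/

section SpectralSequences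

variable (k : Type u) [Field k]

/-- A homological spectral sequence of `k`-vector spaces starting at page `1`: the differentials of
page `r` are maps `E^r_{p,q} → E^r_{p-r,q+r-1}`. -/
abbrev HomologicalSS :=
  SpectralSequence (ModuleCat.{u + 1} k) (fun r => ComplexShape.up' ((-r, r - 1) : ℤ × ℤ)) 1

namespace HomologicalSS

variable {k} (E : HomologicalSS k) (pq : ℤ × ℤ)

/-- The term `E^{n+1}_{p,q}`. -/
abbrev term (n : ℕ) : ModuleCat.{u + 1} k := (E.page (n + 1)).X pq

/-- The pairs `(x, y)` such that `x ∈ E^{n+1}_{p,q}` is a cycle with class `y ∈ E^{n+2}_{p,q}`. -/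
def step (n : ℕ) : Submodule k (E.term pq n × E.term pq (n + 1)) :=
  LinearMap.range (((E.page (n + 1)).iCycles pq).hom.prod
    ((E.page (n + 1)).homologyπ pq ≫
      (E.iso (n + 1) ((n + 1 : ℕ) + 1) pq (by push_cast; rfl)).hom).hom)

/-- The pairs `(x, y)` such that `x ∈ E^1_{p,q}` survives to page `n + 1` and represents
`y ∈ E^{n+1}_{p,q}` there. -/
def survive : (n : ℕ) → Submodule k (E.term pq 0 × E.term pq n)
  | 0 => LinearMap.graph LinearMap.id
  | n + 1 =>
    { carrier := {v | ∃ y, (v.1, y) ∈ survive n ∧ (y, v.2) ∈ E.step pq n}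
      add_mem' := by
        rintro v w ⟨y, h1, h2⟩ ⟨z, h3, h4⟩
        exact ⟨y + z, add_mem h1 h3, add_mem h2 h4⟩
      zero_mem' := ⟨0, zero_mem _, zero_mem _⟩
      smul_mem' := by
        rintro c v ⟨y, h1, h2⟩
        exact ⟨c • y, Submodule.smul_mem _ c h1, Submodule.smul_mem _ c h2⟩ }

/-- `Z^∞_{p,q} ⊆ E^1_{p,q}`: the elements that survive to every page. -/
def permanentCycles : Submodule k (E.term pq 0) :=
  ⨅ n, (E.survive pq n).map (LinearMap.fst k _ _)

/-- `B^∞_{p,q} ⊆ E^1_{p,q}`: the elements that become zero on some page (an ascending union). -/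
def eventualBoundaries : Submodule k (E.term pq 0) :=
  ⨆ n, (E.survive pq n).comap (LinearMap.inl k _ _)

/-- `E^∞_{p,q} = Z^∞_{p,q} / B^∞_{p,q}`. -/
abbrev EInfinity : Type (u + 1) :=
  E.permanentCycles pq ⧸ (E.eventualBoundaries pq).submoduleOf (E.permanentCycles pq)

/-- Convergence `E^1_{p,q} ⇒ H_{p+q}`: an ascending filtration of each `H_n` that is exhaustive and
vanishes in sufficiently negative degrees, with `E^∞_{p,q} ≅ F_p H_{p+q} / F_{p-1} H_{p+q}`. -/
structure Convergence (H : ℤ → ModuleCat.{u + 1} k) where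
  filt (n p : ℤ) : Submodule k (H n)
  mono (n : ℤ) : Monotone (filt n)
  exhaustive (n : ℤ) (x : H n) : ∃ p, x ∈ filt n p
  bounded_below (n : ℤ) : ∃ s, filt n s = ⊥
  iso (p q : ℤ) : Nonempty (E.EInfinity (p, q) ≃ₗ[k]
    (filt (p + q) p ⧸ (filt (p + q) (p - 1)).submoduleOf (filt (p + q) p)))

/-- The filtrations of the abutment are finite. -/
def Convergence.IsFinite {E : HomologicalSS k} {H : ℤ → ModuleCat.{u + 1} k}
    (c : E.Convergence H) : Prop :=
  ∀ n, ∃ s t, c.filt n s = ⊥ ∧ c.filt n t = ⊤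

end HomologicalSS

end SpectralSequences

end

/-! The spectral sequence is that of a filtered Hom complex. Let `X` be a module with a discrete
exhaustive filtration and finitely generated `gr X`. Homogeneous generators of `gr X` lift to `X`
and define a filtered map from a free module whose generators sit in the corresponding bidegrees. As
the filtration of `X` is discrete, surjectivity on `gr` lifts layer by layer
(`exists_lift_of_gr_surjective`), so this cover is strict, and `gr` of its kernel, with the induced
filtration, is the kernel of its `gr`. Since `gr A` is left noetherian, that kernel is again
finitely generated and the construction iterates. The result is a free resolution `P` of `N` for
which `gr P` is a projective resolution of `gr N` (`syzygySequence`, `grSyzygySequence`).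

Filter `Hom(P i, M[ξ])` by the amount `p` by which a map raises filtration degree. A map out of `P
i` is determined by the images of finitely many generators, so this filtration is exhaustive and
bounded below, and its `p`-th graded piece is all of `Hom(gr P i, gr M[(ξ, p)])`
(`grHom_eq_zero_iff`, `grHom_free_surjective`). Hence `E^1` is Ext over `gr A`, the abutment is Ext
over `A`, and the spectral sequence converges (`FilteredComplex.convergence`).

The rest follows from convergence. As `E^∞` is a subquotient of `E^1`, dimensions of Ext over `A`
are bounded by those over `gr A`. For projective dimension, an arbitrary target module is given the
filtration that jumps only at `0`. For injective dimension, a graded Baer criterion reduces to Ext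
from finitely generated modules, and these have filtrations of the required kind; it rests on
coinduced modules as a supply of injectives and on essential extensions. For `χ`, the trivial module
with the filtration jumping at `0` has as associated graded module the trivial module over `gr A`.
-/

noncomputable section

/-! ### The spectral sequence of a filtered complex of vector spaces -/

section Subquotients

variable {k : Type*} {V W : Type*} [Field k] [AddCommGroup V] [Module k V] [AddCommGroup W]
  [Module k W]

/-- The subquotient `Z / (D ∩ Z)`. -/
abbrev Subquot (Z D : Submodule k V) : Type _ := Z ⧸ D.submoduleOf Z

/-- The class of an element of `Z` in `Z / (D ∩ Z)`. -/
def Subquot.cls (Z D : Submodule k V) : Z →ₗ[k] Subquot Z D := Submodule.mkQ _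

theorem Subquot.cls_surjective (Z D : Submodule k V) : Function.Surjective (Subquot.cls Z D) :=
  Submodule.mkQ_surjective _

theorem Subquot.cls_eq_zero {Z D : Submodule k V} {x : Z} : Subquot.cls Z D x = 0 ↔ (x : V) ∈ D :=
  Submodule.Quotient.mk_eq_zero _

theorem Subquot.cls_eq_cls {Z D : Submodule k V} {x y : Z} :
    Subquot.cls Z D x = Subquot.cls Z D y ↔ (x : V) - y ∈ D := by
  rw [← sub_eq_zero, ← map_sub, Subquot.cls_eq_zero, Submodule.coe_sub]

/-- The map induced on subquotients. -/
def Subquot.map {Z D : Submodule k V} {Z' D' : Submodule k W} (f : V →ₗ[k] W)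
    (hZ : ∀ x ∈ Z, f x ∈ Z') (hD : ∀ x ∈ D, f x ∈ D') : Subquot Z D →ₗ[k] Subquot Z' D' :=
  Submodule.mapQ _ _ (f.restrict hZ) fun x hx => hD x hx

/-- Two surjections with the same kernel have isomorphic targets. -/
def LinearMap.equivOfKerEq {U : Type*} [AddCommGroup U] [Module k U] (f : U →ₗ[k] V)
    (g : U →ₗ[k] W) (hf : Function.Surjective f) (hg : Function.Surjective g)
    (h : LinearMap.ker f = LinearMap.ker g) : V ≃ₗ[k] W :=
  (f.quotKerEquivOfSurjective hf).symm ≪≫ₗ Submodule.quotEquivOfEq _ _ h ≪≫ₗ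
    g.quotKerEquivOfSurjective hg

theorem LinearMap.equivOfKerEq_apply {U : Type*} [AddCommGroup U] [Module k U] (f : U →ₗ[k] V)
    (g : U →ₗ[k] W) (hf : Function.Surjective f) (hg : Function.Surjective g)
    (h : LinearMap.ker f = LinearMap.ker g) (x : U) :
    LinearMap.equivOfKerEq f g hf hg h (f x) = g x := by
  have : (f.quotKerEquivOfSurjective hf).symm (f x) = Submodule.Quotient.mk x :=
    (LinearEquiv.symm_apply_eq _).2 rfl
  simp only [LinearMap.equivOfKerEq, LinearEquiv.trans_apply, this]
  rfl

end Subquotients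

/-! ### Cycles and homology of complexes of vector spaces, in terms of elements -/

section Homology

variable {k : Type*} [Field k] {ι : Type*} {c : ComplexShape ι}
  (K : HomologicalComplex (ModuleCat.{u} k) c) (j : ι) {W : Type u} [AddCommGroup W] [Module k W]

/-- A linear map into the cycles of a complex of vector spaces. -/
def cyclesLift (f : W →ₗ[k] K.X j) (hf : ∀ w, K.d j (c.next j) (f w) = 0) : W →ₗ[k] K.cycles j :=
  (K.liftCycles (ModuleCat.ofHom f) _ rfl (by ext w; exact hf w)).hom

theorem iCycles_cyclesLift (f : W →ₗ[k] K.X j) (hf : ∀ w, K.d j (c.next j) (f w) = 0) (w : W) :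
    K.iCycles j (cyclesLift K j f hf w) = f w :=
  ConcreteCategory.congr_hom
    (K.liftCycles_i (ModuleCat.ofHom f) (c.next j) rfl (by ext w; exact hf w)) w

theorem iCycles_injective : Function.Injective (K.iCycles j) :=
  (ModuleCat.mono_iff_injective _).1 inferInstance

theorem homologyπ_surjective : Function.Surjective (K.homologyπ j) :=
  (ModuleCat.epi_iff_surjective _).1 inferInstance

theorem homologyπ_eq_zero_iff (x : K.cycles j) :
    K.homologyπ j x = 0 ↔ ∃ y, K.iCycles j x = K.d (c.prev j) j y := by
  have hex : (ShortComplex.mk _ _ (K.toCycles_comp_homologyπ (c.prev j) j)).Exact :=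
    ShortComplex.exact_of_g_is_cokernel _ (K.homologyIsCokernel (c.prev j) j rfl)
  rw [ShortComplex.moduleCat_exact_iff] at hex
  have hto : ∀ y, K.iCycles j (K.toCycles (c.prev j) j y) = K.d (c.prev j) j y := fun y =>
    ConcreteCategory.congr_hom (K.toCycles_i (c.prev j) j) y
  constructor
  · intro h
    obtain ⟨y, rfl⟩ := hex x h
    exact ⟨y, hto y⟩
  · rintro ⟨y, hy⟩
    rw [← hto] at hy
    rw [iCycles_injective K j hy]
    exact ConcreteCategory.congr_hom (K.toCycles_comp_homologyπ (c.prev j) j) y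

theorem d_iCycles (x : K.cycles j) (l : ι) : K.d j l (K.iCycles j x) = 0 :=
  ConcreteCategory.congr_hom (K.iCycles_d j l) x

end Homology

/-- A cochain complex `⋯ → C n → C (n + 1) → ⋯` of subspaces of `V`, together with an ascending
filtration that is exhaustive and bounded below on every `C n`. -/
structure FilteredComplex (k V : Type*) [Field k] [AddCommGroup V] [Module k V] where
  d : V →ₗ[k] V
  dd (x : V) : d (d x) = 0
  deg : ℤ → Submodule k V
  d_deg (n : ℤ) (x : V) (hx : x ∈ deg n) : d x ∈ deg (n + 1)
  filt : ℤ → Submodule k V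
  mono : Monotone filt
  d_filt (p : ℤ) (x : V) (hx : x ∈ filt p) : d x ∈ filt p
  exhaustive (n : ℤ) (x : V) (hx : x ∈ deg n) : ∃ p, x ∈ filt p
  bounded (n : ℤ) : ∃ p, filt p ⊓ deg n = ⊥

namespace FilteredComplex

/-! ### Approximate cycles, approximate boundaries and the pages -/

section Pages

variable {k V : Type*} [Field k] [AddCommGroup V] [Module k V] (K : FilteredComplex k V)

/-- `Z^r_p`, in cohomological degree `n`. -/
def Z (r p n : ℤ) : Submodule k V := (K.filt p ⊓ K.deg n) ⊓ (K.filt (p - r)).comap K.d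

/-- `Z^{r-1}_{p-1} + d Z^{r-1}_{p+r-1}`, in cohomological degree `n`. -/
def D (r p n : ℤ) : Submodule k V :=
  K.Z (r - 1) (p - 1) n ⊔ (K.Z (r - 1) (p + r - 1) (n - 1)).map K.d

variable {K}

theorem mem_Z {r p n : ℤ} {x : V} :
    x ∈ K.Z r p n ↔ x ∈ K.filt p ∧ x ∈ K.deg n ∧ K.d x ∈ K.filt (p - r) := by
  simp only [Z, Submodule.mem_inf, Submodule.mem_comap, and_assoc]

theorem mem_D {r p n : ℤ} {x : V} :
    x ∈ K.D r p n ↔ ∃ a ∈ K.Z (r - 1) (p - 1) n, ∃ b ∈ K.Z (r - 1) (p + r - 1) (n - 1),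
      a + K.d b = x := by
  simp only [D, Submodule.mem_sup, Submodule.mem_map]
  constructor
  · rintro ⟨a, ha, _, ⟨b, hb, rfl⟩, h⟩
    exact ⟨a, ha, b, hb, h⟩
  · rintro ⟨a, ha, b, hb, h⟩
    exact ⟨a, ha, _, ⟨b, hb, rfl⟩, h⟩

theorem Z_mono {r p r' p' n : ℤ} (hp : p ≤ p') (hr : p - r ≤ p' - r') : K.Z r p n ≤ K.Z r' p' n :=
  fun _ hx => by
    rw [mem_Z] at hx ⊢
    exact ⟨K.mono hp hx.1, hx.2.1, K.mono hr hx.2.2⟩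

theorem d_mem_Z {r p r' p' n n' : ℤ} (hp : p - r ≤ p') (hn : n + 1 = n') {x : V}
    (hx : x ∈ K.Z r p n) : K.d x ∈ K.Z r' p' n' := by
  subst hn
  rw [mem_Z] at hx ⊢
  refine ⟨K.mono hp hx.2.2, K.d_deg _ _ hx.2.1, ?_⟩
  rw [K.dd]
  exact zero_mem _

theorem d_mem_D {r p p' n n' : ℤ} (hp : p' - r ≤ p) (hn : n + 1 = n')
    {x : V} (hx : x ∈ K.Z (r - 1) (p' - 1) n) : K.d x ∈ K.D r p n' := by
  subst hn
  refine mem_D.2 ⟨0, zero_mem _, x, ?_, zero_add _⟩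
  rw [add_sub_cancel_right]
  exact Z_mono (by lia) (by lia) hx

theorem Z_le_D {r p n : ℤ} : K.Z (r - 1) (p - 1) n ≤ K.D r p n := le_sup_left

theorem d_D_mem_D {r p p' n n' : ℤ} (hp : p - r = p') (hn : n + 1 = n') {x : V}
    (hx : x ∈ K.D r p n) : K.d x ∈ K.D r p' n' := by
  obtain ⟨a, ha, b, hb, rfl⟩ := mem_D.1 hx
  rw [map_add, K.dd, add_zero]
  exact d_mem_D hp.le hn ha

variable (K)

/-- The page `E^r` of the spectral sequence of a filtered complex. -/
def page (r : ℤ) :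
    HomologicalComplex (ModuleCat k) (ComplexShape.up' ((-r, r - 1) : ℤ × ℤ)) where
  X pq := ModuleCat.of k (Subquot (K.Z r pq.1 (-(pq.1 + pq.2))) (K.D r pq.1 (-(pq.1 + pq.2))))
  d i j := by
    classical exact
      if h : i + (-r, r - 1) = j then
        ModuleCat.ofHom (Subquot.map K.d
          (fun x hx => d_mem_Z (by subst h; exact le_of_eq (by simp [sub_eq_add_neg]))
            (by subst h; simp; ring) hx)
          (fun x hx => d_D_mem_D (by subst h; simp [sub_eq_add_neg]) (by subst h; simp; ring) hx))
      else 0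
  shape i j h := dif_neg h
  d_comp_d' i j l hij hjl := by
    refine (congrArg₂ (· ≫ ·) (dif_pos hij) (dif_pos hjl)).trans ?_
    ext x
    refine Subquot.cls_eq_zero.2 ?_
    change K.d (K.d x) ∈ _
    rw [K.dd]
    exact zero_mem _

/-- The class in `E^r_{p,q}` of an element of `Z^r_p`. -/
def cl (r : ℤ) (pq : ℤ × ℤ) : K.Z r pq.1 (-(pq.1 + pq.2)) →ₗ[k] (K.page r).X pq :=
  Subquot.cls _ _

theorem cl_surjective (r : ℤ) (pq : ℤ × ℤ) : Function.Surjective (K.cl r pq) :=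
  Subquot.cls_surjective _ _

variable {K}

theorem cl_eq_zero {r : ℤ} {pq : ℤ × ℤ} {x : K.Z r pq.1 (-(pq.1 + pq.2))} :
    K.cl r pq x = 0 ↔ (x : V) ∈ K.D r pq.1 (-(pq.1 + pq.2)) := Subquot.cls_eq_zero

theorem cl_eq_cl {r : ℤ} {pq : ℤ × ℤ} {x y : K.Z r pq.1 (-(pq.1 + pq.2))} :
    K.cl r pq x = K.cl r pq y ↔ (x : V) - y ∈ K.D r pq.1 (-(pq.1 + pq.2)) := Subquot.cls_eq_cls

theorem page_d {r : ℤ} {i j : ℤ × ℤ} (h : i + (-r, r - 1) = j)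
    (x : K.Z r i.1 (-(i.1 + i.2))) : ∃ hx : K.d x ∈ K.Z r j.1 (-(j.1 + j.2)),
      (K.page r).d i j (K.cl r i x) = K.cl r j ⟨K.d x, hx⟩ := by
  refine ⟨d_mem_Z (r := r) (p := i.1) (n := -(i.1 + i.2))
    (by subst h; exact le_of_eq (by simp [sub_eq_add_neg]))
    (by subst h; simp; ring) x.2, ?_⟩
  have : (K.page r).d i j = ModuleCat.ofHom (Subquot.map K.d _ _) := dif_pos h
  rw [this]
  rfl

theorem next_eq (r : ℤ) (i : ℤ × ℤ) :
    (ComplexShape.up' ((-r, r - 1) : ℤ × ℤ)).next i = i + (-r, r - 1) :=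
  ComplexShape.next_eq' _ rfl

theorem prev_eq (r : ℤ) (i : ℤ × ℤ) :
    (ComplexShape.up' ((-r, r - 1) : ℤ × ℤ)).prev i = i - (-r, r - 1) :=
  ComplexShape.prev_eq' _ (sub_add_cancel i _)

end Pages

/-! ### Homology of a page is the next page -/

section SpectralSequence

variable {k : Type*} {V : Type u} [Field k] [AddCommGroup V] [Module k V]
  {K : FilteredComplex k V}

theorem Z_succ_le {r p n : ℤ} : K.Z (r + 1) p n ≤ K.Z r p n := Z_mono le_rfl (by lia)

/-- For `x ∈ Z^{r+1}_p` the differential drops the filtration by one more step than `E^r` sees: `d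
x` lies in `Z^{r-1}_{p-r-1}`, which is part of `D^r_{p-r}`. -/
theorem d_cl_of_mem_succ {r : ℤ} {i : ℤ × ℤ} {x : K.Z r i.1 (-(i.1 + i.2))}
    (hx : (x : V) ∈ K.Z (r + 1) i.1 (-(i.1 + i.2))) :
    (K.page r).d i ((ComplexShape.up' ((-r, r - 1) : ℤ × ℤ)).next i) (K.cl r i x) = 0 := by
  obtain ⟨h, e⟩ := page_d (next_eq r i).symm x
  rw [e, cl_eq_zero]
  clear e
  revert h
  rw [next_eq]
  intro h
  refine Z_le_D (d_mem_Z (p := i.1) (n := -(i.1 + i.2)) (r := r + 1) ?_ ?_ hx)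
  · simp; lia
  · simp; ring

variable (K) in
/-- The cycle of the page `E^r` given by an element of `Z^{r+1}`. -/
def toPageCycles (r : ℤ) (i : ℤ × ℤ) :
    K.Z (r + 1) i.1 (-(i.1 + i.2)) →ₗ[k] (K.page r).cycles i :=
  cyclesLift (K.page r) i (K.cl r i ∘ₗ Submodule.inclusion Z_succ_le)
    fun w => d_cl_of_mem_succ w.2

theorem iCycles_toPageCycles (r : ℤ) (i : ℤ × ℤ) (w : K.Z (r + 1) i.1 (-(i.1 + i.2))) :
    (K.page r).iCycles i (K.toPageCycles r i w) = K.cl r i ⟨w, Z_succ_le w.2⟩ :=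
  iCycles_cyclesLift _ _ _ _ w

/-- The source of the incoming differential has index `(p + r, q - r + 1)`, hence cohomological
degree one lower; written with these explicit values, boundaries can be compared with `D^{r+1}_p`.
-/
theorem mem_range_d_iff {r : ℤ} {i : ℤ × ℤ} {x : (K.page r).X i} :
    (∃ y, x = (K.page r).d ((ComplexShape.up' ((-r, r - 1) : ℤ × ℤ)).prev i) i y) ↔
      ∃ b ∈ K.Z r (i.1 + r) (-(i.1 + i.2) - 1), ∃ hb : K.d b ∈ K.Z r i.1 (-(i.1 + i.2)),
        x = K.cl r i ⟨K.d b, hb⟩ := by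
  have key : K.Z r ((ComplexShape.up' ((-r, r - 1) : ℤ × ℤ)).prev i).1
      (-(((ComplexShape.up' ((-r, r - 1) : ℤ × ℤ)).prev i).1 +
        ((ComplexShape.up' ((-r, r - 1) : ℤ × ℤ)).prev i).2)) =
      K.Z r (i.1 + r) (-(i.1 + i.2) - 1) := by
    rw [prev_eq]
    congr 1
    · simp
    · simp; ring
  have hrel : (ComplexShape.up' ((-r, r - 1) : ℤ × ℤ)).prev i + (-r, r - 1) = i := by
    rw [prev_eq]; exact sub_add_cancel _ _
  constructor
  · rintro ⟨y, rfl⟩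
    obtain ⟨y, rfl⟩ := K.cl_surjective _ _ y
    obtain ⟨h, e⟩ := page_d hrel y
    exact ⟨y, key ▸ y.2, h, e⟩
  · rintro ⟨b, hb, h, rfl⟩
    obtain ⟨h, e⟩ := page_d hrel ⟨b, key ▸ hb⟩
    exact ⟨_, e.symm⟩

/-- A cycle of the page is the class of some `z` with `d z = a + d b`, where `a ∈ F_{p-r-1}` and `b
∈ Z^{r-1}_{p-1}`. Then `z - b` has the same class, since `b` belongs to `D^r_p`, and `d (z - b) = a`
shows that `z - b` lies in `Z^{r+1}_p`. -/
theorem exists_toPageCycles (r : ℤ) (i : ℤ × ℤ) (x : (K.page r).cycles i) :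
    ∃ w, K.toPageCycles r i w = x := by
  obtain ⟨z, hz⟩ := K.cl_surjective r i ((K.page r).iCycles i x)
  have h0 := d_iCycles (K.page r) i x (i + (-r, r - 1))
  obtain ⟨h, e⟩ := page_d rfl z
  rw [← hz, e, cl_eq_zero] at h0
  obtain ⟨a, ha, b, hb, hab⟩ := mem_D.1 h0
  rw [mem_Z] at ha hb
  have hz' := mem_Z.1 z.2
  simp only [Prod.fst_add, Prod.snd_add] at ha hb
  have hbF : b ∈ K.filt (i.1 - 1) := K.mono (by lia) hb.1
  have hbd : b ∈ K.deg (-(i.1 + i.2)) := by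
    have := hb.2.1
    rwa [show -(i.1 + -r + (i.2 + (r - 1))) - 1 = -(i.1 + i.2) by ring] at this
  change a + K.d b = K.d z at hab
  have hda : K.d (z - b) = a := by rw [map_sub, ← hab]; abel
  have hw : (z - b : V) ∈ K.Z (r + 1) i.1 (-(i.1 + i.2)) := mem_Z.2
    ⟨sub_mem hz'.1 (K.mono (by lia) hbF), sub_mem hz'.2.1 hbd, by
      rw [hda]; exact K.mono (by lia) ha.1⟩
  refine ⟨⟨_, hw⟩, iCycles_injective _ _ ?_⟩
  rw [iCycles_toPageCycles, ← hz, cl_eq_cl]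
  refine Z_le_D (mem_Z.2 ?_)
  have hdb : K.d b = K.d z - a := by rw [← hab]; abel
  refine ⟨?_, ?_, ?_⟩
  · simpa using neg_mem hbF
  · simpa using neg_mem hbd
  · have : K.d b ∈ K.filt (i.1 - 1 - (r - 1)) := by
      rw [hdb]
      exact sub_mem (K.mono (by lia) hz'.2.2) (K.mono (by lia) ha.1)
    simpa using neg_mem this

theorem d_mem_D_succ {r p n : ℤ} {b : V} (hb : b ∈ K.Z r (p + r) (n - 1)) :
    K.d b ∈ K.D (r + 1) p n := by
  refine mem_D.2 ⟨0, zero_mem _, b, ?_, zero_add _⟩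
  rwa [add_sub_cancel_right, show p + (r + 1) - 1 = p + r by ring]

/-- With `exists_toPageCycles` this presents the homology of `E^r` and the term of `E^{r+1}` as
quotients of the same space `Z^{r+1}` by the same subspace. -/
theorem homologyπ_toPageCycles_eq_zero (r : ℤ) (i : ℤ × ℤ)
    (w : K.Z (r + 1) i.1 (-(i.1 + i.2))) :
    (K.page r).homologyπ i (K.toPageCycles r i w) = 0 ↔
      (w : V) ∈ K.D (r + 1) i.1 (-(i.1 + i.2)) := by
  rw [homologyπ_eq_zero_iff, mem_range_d_iff]
  constructor
  · rintro ⟨b, hb, hdb, e⟩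
    rw [iCycles_toPageCycles, cl_eq_cl] at e
    obtain ⟨a, ha, b', hb', e⟩ := mem_D.1 e
    have hw : (w : V) = a + K.d (b + b') := by
      have e' : a + K.d b' + K.d b = w := eq_sub_iff_add_eq.1 e
      rw [← e', map_add]
      abel
    have hbb : b + b' ∈ K.Z r (i.1 + r) (-(i.1 + i.2) - 1) :=
      add_mem hb (Z_mono (by lia) (by lia) hb')
    have haw : a = w - K.d (b + b') := by rw [hw]; abel
    refine hw ▸ add_mem (Z_le_D ?_) (d_mem_D_succ hbb)
    rw [add_sub_cancel_right]
    have ha' := mem_Z.1 ha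
    refine mem_Z.2 ⟨ha'.1, ha'.2.1, ?_⟩
    -- As `d w = d a`, the element `a` inherits from `w` the drop that places it in `Z^r_{p-1}`, the
    -- first summand of `D^{r+1}_p`.
    have hwd := (mem_Z.1 w.2).2.2
    rw [hw, map_add, K.dd, add_zero] at hwd
    exact K.mono (by lia) hwd
  · intro hw
    obtain ⟨a, ha, b, hb, e⟩ := mem_D.1 hw
    rw [add_sub_cancel_right, show i.1 + (r + 1) - 1 = i.1 + r by ring] at hb
    have hdb : K.d b ∈ K.Z r i.1 (-(i.1 + i.2)) := d_mem_Z (by lia) (by lia) hb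
    refine ⟨b, hb, hdb, ?_⟩
    rw [iCycles_toPageCycles, cl_eq_cl]
    refine Z_le_D ?_
    have : (w : V) - K.d b = a := by rw [← e]; abel
    change (w : V) - K.d b ∈ _
    rw [this]
    exact Z_mono (by lia) (by lia) ha

variable (K) in
/-- The homology of the page `E^r` is the page `E^{r+1}`. -/
def pageIso (r : ℤ) (i : ℤ × ℤ) : (K.page r).homology i ≅ (K.page (r + 1)).X i :=
  (LinearMap.equivOfKerEq ((((K.page r).homologyπ i).hom) ∘ₗ K.toPageCycles r i)
    (K.cl (r + 1) i)
    (fun x => by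
      obtain ⟨x, rfl⟩ := homologyπ_surjective _ _ x
      obtain ⟨w, rfl⟩ := exists_toPageCycles _ _ x
      exact ⟨w, rfl⟩)
    (K.cl_surjective _ _)
    (by
      ext w
      rw [LinearMap.mem_ker, LinearMap.mem_ker, cl_eq_zero]
      exact homologyπ_toPageCycles_eq_zero r i w)).toModuleIso

theorem pageIso_apply (r : ℤ) (i : ℤ × ℤ) (w : K.Z (r + 1) i.1 (-(i.1 + i.2))) :
    (K.pageIso r i).hom ((K.page r).homologyπ i (K.toPageCycles r i w)) = K.cl (r + 1) i w :=
  LinearMap.equivOfKerEq_apply ((((K.page r).homologyπ i).hom) ∘ₗ K.toPageCycles r i)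
    (K.cl (r + 1) i) _ _ _ w

end SpectralSequence

end FilteredComplex

namespace FilteredComplex

/-! ### Convergence to the cohomology of the filtered complex -/

section Convergence

variable {k : Type u} {V : Type (u + 1)} [Field k] [AddCommGroup V] [Module k V]
  (K : FilteredComplex k V)

/-- The spectral sequence of a filtered complex. -/
def spectralSequence : HomologicalSS k where
  page r _ := K.page r
  iso r r' i h _ := by subst h; exact K.pageIso r i

variable {K}

theorem spectralSequence_iso {r r' : ℤ} (h : r + 1 = r') (hr : 1 ≤ r) (i : ℤ × ℤ) (w : V)
    (hw : w ∈ K.Z (r + 1) i.1 (-(i.1 + i.2))) (hw' : w ∈ K.Z r' i.1 (-(i.1 + i.2))) :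
    (K.spectralSequence.iso r r' i h hr).hom
      ((K.page r).homologyπ i (K.toPageCycles r i ⟨w, hw⟩)) = K.cl r' i ⟨w, hw'⟩ := by
  subst h
  exact pageIso_apply r i ⟨w, hw⟩

/-- `term pq n` belongs to page `n + 1`. Cycles of this page are represented in `Z^{n+2}`, and the
isomorphism with the next page sends the class of such a representative to its own class there, so
one element of the complex represents both entries. -/
theorem mem_step {pq : ℤ × ℤ} {n : ℕ}
    {v : K.spectralSequence.term pq n × K.spectralSequence.term pq (n + 1)} :
    v ∈ K.spectralSequence.step pq n ↔
      ∃ w, ∃ (h : w ∈ K.Z ((n : ℤ) + 1) pq.1 (-(pq.1 + pq.2)))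
        (h' : w ∈ K.Z (((n + 1 : ℕ) : ℤ) + 1) pq.1 (-(pq.1 + pq.2))),
        v = (K.cl _ pq ⟨w, h⟩, K.cl _ pq ⟨w, h'⟩) := by
  have cast : ((n : ℤ) + 1) + 1 = ((n + 1 : ℕ) : ℤ) + 1 := by push_cast; rfl
  constructor
  · rintro ⟨c, rfl⟩
    obtain ⟨⟨w, hw⟩, hπ⟩ : ∃ w, K.toPageCycles _ pq w = c := exists_toPageCycles _ _ c
    subst hπ
    refine ⟨w, Z_succ_le hw, cast ▸ hw, Prod.ext ?_ ?_⟩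
    · exact iCycles_toPageCycles _ _ _
    · exact spectralSequence_iso cast (by lia) pq w hw _
  · rintro ⟨w, h, h', rfl⟩
    have hw : w ∈ K.Z ((n : ℤ) + 1 + 1) pq.1 (-(pq.1 + pq.2)) := cast ▸ h'
    refine ⟨K.toPageCycles _ pq ⟨w, hw⟩, Prod.ext ?_ ?_⟩
    · exact iCycles_toPageCycles _ _ _
    · exact spectralSequence_iso cast (by lia) pq w hw _

/-- A chain of successive representatives, one for each page, can be replaced by a single element of
`Z^{n+1}_p`. This expresses survival in terms of the filtered complex alone. -/
theorem mem_survive {pq : ℤ × ℤ} {n : ℕ}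
    {v : K.spectralSequence.term pq 0 × K.spectralSequence.term pq n} :
    v ∈ K.spectralSequence.survive pq n ↔
      ∃ w, ∃ (h : w ∈ K.Z (((0 : ℕ) : ℤ) + 1) pq.1 (-(pq.1 + pq.2)))
        (h' : w ∈ K.Z ((n : ℤ) + 1) pq.1 (-(pq.1 + pq.2))),
        v = (K.cl _ pq ⟨w, h⟩, K.cl _ pq ⟨w, h'⟩) := by
  induction n with
  | zero =>
    constructor
    · obtain ⟨x, y⟩ := v
      intro h
      obtain rfl : y = x := h
      obtain ⟨z, rfl⟩ := K.cl_surjective _ _ y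
      exact ⟨z, z.2, z.2, rfl⟩
    · rintro ⟨w, h, h', rfl⟩
      exact rfl
  | succ n ih =>
    constructor
    · rintro ⟨y, h1, h2⟩
      obtain ⟨w, h, h', e⟩ := ih.1 h1
      obtain ⟨z, hz, hz', e'⟩ := mem_step.1 h2
      have e1 := congrArg Prod.snd e
      have e2 := congrArg Prod.fst e'
      replace e2 := cl_eq_cl.1 (e1.symm.trans e2)
      obtain ⟨a, ha, b, hb, hab⟩ := mem_D.1 e2
      rw [add_sub_cancel_right] at ha hb
      rw [show pq.1 + ((n : ℤ) + 1) - 1 = pq.1 + n by ring] at hb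
      have hdb : K.d b ∈ K.Z (((n + 1 : ℕ) : ℤ) + 1) pq.1 (-(pq.1 + pq.2)) :=
        d_mem_Z (by lia) (by lia) hb
      have hwz : w = z + K.d b + a := by
        have : a + K.d b + z = w := eq_sub_iff_add_eq.1 hab
        rw [← this]; abel
      -- Here `w` represents the old pair, `z` the new step, and `w = z + d b + a`. The element `z +
      -- d b` serves for both: it differs from `w` by `a ∈ F_{p-1}`, which is zero on page `1`, and
      -- from `z` by `d b`, which is zero on page `n + 2`.
      refine ⟨z + K.d b, ?_, add_mem hz' hdb, Prod.ext ?_ ?_⟩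
      · exact Z_mono le_rfl (by lia) (add_mem hz' hdb)
      · refine ((Prod.ext_iff.1 e).1 : v.1 = _).trans (cl_eq_cl.2 (Z_le_D ?_))
        simp only [hwz, add_sub_cancel_left]
        exact Z_mono le_rfl (by lia) ha
      · refine ((Prod.ext_iff.1 e').2 : v.2 = _).trans (cl_eq_cl.2 ?_)
        simp only [sub_add_cancel_left]
        refine neg_mem (d_mem_D_succ (Z_mono ?_ ?_ hb))
        · push_cast; lia
        · push_cast; lia
    · rintro ⟨w, h, h', rfl⟩
      have hw : w ∈ K.Z ((n : ℤ) + 1) pq.1 (-(pq.1 + pq.2)) :=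
        Z_mono le_rfl (by push_cast; lia) h'
      exact ⟨K.cl _ pq ⟨w, hw⟩, ih.2 ⟨w, h, hw, rfl⟩, mem_step.2 ⟨w, hw, h', rfl⟩⟩

/-- The cycles of degree `n` and filtration degree at most `p`. -/
def filtCycles (K : FilteredComplex k V) (p n : ℤ) : Submodule k V :=
  K.filt p ⊓ (K.deg n ⊓ LinearMap.ker K.d)

theorem mem_filtCycles {p n : ℤ} {x : V} :
    x ∈ K.filtCycles p n ↔ x ∈ K.filt p ∧ x ∈ K.deg n ∧ K.d x = 0 := Iff.rfl

theorem filtCycles_le_Z {r p n : ℤ} : K.filtCycles p n ≤ K.Z r p n := fun x hx => by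
  rw [mem_filtCycles] at hx
  rw [mem_Z, hx.2.2]
  exact ⟨hx.1, hx.2.1, zero_mem _⟩

/-- The filtration vanishes below some `s` in degree `n + 1`. Once `p - r ≤ s`, the condition `d x ∈
F_{p-r}` forces `d x = 0`, so approximate cycles are cycles. -/
theorem exists_Z_le_filtCycles (p n : ℤ) : ∃ m : ℕ, K.Z ((m : ℤ) + 1) p n ≤ K.filtCycles p n := by
  obtain ⟨s, hs⟩ := K.bounded (n + 1)
  refine ⟨(p - s).toNat, fun x hx => ?_⟩
  rw [mem_Z] at hx
  refine mem_filtCycles.2 ⟨hx.1, hx.2.1, ?_⟩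
  rw [← Submodule.mem_bot k, ← hs]
  exact ⟨K.mono (by lia) hx.2.2, K.d_deg _ _ hx.2.1⟩

theorem mem_permanentCycles {pq : ℤ × ℤ} {x : K.spectralSequence.term pq 0} :
    x ∈ K.spectralSequence.permanentCycles pq ↔
      ∃ w, ∃ h : w ∈ K.filtCycles pq.1 (-(pq.1 + pq.2)),
        x = K.cl _ pq ⟨w, filtCycles_le_Z h⟩ := by
  simp only [HomologicalSS.permanentCycles, Submodule.mem_iInf, Submodule.mem_map]
  constructor
  · intro h
    obtain ⟨m, hm⟩ := exists_Z_le_filtCycles (K := K) pq.1 (-(pq.1 + pq.2))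
    obtain ⟨v, hv, rfl⟩ := h m
    obtain ⟨w, h, h', rfl⟩ := mem_survive.1 hv
    exact ⟨w, hm h', rfl⟩
  · rintro ⟨w, h, rfl⟩ n
    exact ⟨_, mem_survive.2 ⟨w, filtCycles_le_Z h, filtCycles_le_Z h, rfl⟩, rfl⟩

theorem survive_comap_mono (pq : ℤ × ℤ) : Monotone fun n =>
    (K.spectralSequence.survive pq n).comap (LinearMap.inl k _ _) := by
  refine monotone_nat_of_le_succ fun n x hx => ?_
  exact ⟨0, hx, zero_mem _⟩

/-- An element that dies on some page has the form `a + d b` with `a ∈ F_{p-1}`, and `a` is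
invisible on page `1`. For the converse, exhaustiveness puts `b` in some `F_s`. -/
theorem mem_eventualBoundaries {pq : ℤ × ℤ} {x : K.spectralSequence.term pq 0} :
    x ∈ K.spectralSequence.eventualBoundaries pq ↔
      ∃ b ∈ K.deg (-(pq.1 + pq.2) - 1), ∃ h : K.d b ∈ K.filtCycles pq.1 (-(pq.1 + pq.2)),
        x = K.cl _ pq ⟨K.d b, filtCycles_le_Z h⟩ := by
  rw [HomologicalSS.eventualBoundaries,
    Submodule.mem_iSup_of_directed _ (survive_comap_mono pq).directed_le]
  constructor
  · rintro ⟨n, hn⟩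
    obtain ⟨w, h, h', e⟩ := mem_survive.1 hn
    have e1 : x = _ := congrArg Prod.fst e
    have e2 := (congrArg Prod.snd e).symm
    obtain ⟨a, ha, b, hb, hab⟩ := mem_D.1 (cl_eq_zero.1 e2)
    have hb' := mem_Z.1 hb
    have hdb : K.d b ∈ K.filtCycles pq.1 (-(pq.1 + pq.2)) := by
      refine ⟨K.mono (by lia) hb'.2.2, ?_, K.dd b⟩
      have := K.d_deg _ _ hb'.2.1
      rwa [sub_add_cancel] at this
    refine ⟨b, hb'.2.1, hdb, ?_⟩
    rw [e1]
    refine cl_eq_cl.2 (Z_le_D ?_)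
    simp only at hab
    simp only [← hab, add_sub_cancel_right]
    exact Z_mono le_rfl (by lia) ha
  · rintro ⟨b, hb, h, rfl⟩
    obtain ⟨s, hs⟩ := K.exhaustive _ b hb
    -- With `n ≥ s - p` one has `b ∈ Z^n_{p+n}`, so `d b` vanishes on page `n + 1`.
    refine ⟨(s - pq.1).toNat, mem_survive.2 ⟨_, filtCycles_le_Z h, filtCycles_le_Z h, ?_⟩⟩
    refine Prod.ext rfl (Eq.symm (cl_eq_zero.2 ?_))
    refine d_mem_D_succ (mem_Z.2 ⟨K.mono (by lia) hs, hb, K.mono (by lia) h.1⟩)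

/-- The data exhibiting `H` as the cohomology in degree `n`. -/
structure IsCohomology (K : FilteredComplex k V) (n : ℤ) {H : Type*} [AddCommGroup H] [Module k H]
    (ψ : (K.deg n ⊓ LinearMap.ker K.d : Submodule k V) →ₗ[k] H) : Prop where
  surjective : Function.Surjective ψ
  eq_zero_iff (x) : ψ x = 0 ↔ ∃ b ∈ K.deg (n - 1), K.d b = x

variable {H : ℤ → ModuleCat.{u + 1} k}
  (ψ : ∀ n, (K.deg (-n) ⊓ LinearMap.ker K.d : Submodule k V) →ₗ[k] H n)

/-- The filtration of the abutment. -/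
def abutmentFilt (n p : ℤ) : Submodule k (H n) :=
  ((K.filt p).comap (K.deg (-n) ⊓ LinearMap.ker K.d : Submodule k V).subtype).map (ψ n)

variable (K) in
/-- A cycle as a permanent cycle of the spectral sequence. -/
def toPermanentCycles (pq : ℤ × ℤ) :
    K.filtCycles pq.1 (-(pq.1 + pq.2)) →ₗ[k] K.spectralSequence.permanentCycles pq :=
  LinearMap.codRestrict _ (K.cl _ pq ∘ₗ Submodule.inclusion filtCycles_le_Z) fun x =>
    mem_permanentCycles.2 ⟨x, x.2, rfl⟩

/-- The kernel of the map from cycles in `F_p` to `E^∞` consists of cycles in `F_{p-1}` plus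
boundaries, the latter coming from any filtration degree. This is the same kernel as in
`toAbutment_eq_zero`, which yields the isomorphism required for convergence. -/
theorem toPermanentCycles_mem_iff (pq : ℤ × ℤ) (x : K.filtCycles pq.1 (-(pq.1 + pq.2))) :
    (K.toPermanentCycles pq x : K.spectralSequence.term pq 0) ∈
        K.spectralSequence.eventualBoundaries pq ↔
      ∃ a ∈ K.filtCycles (pq.1 - 1) (-(pq.1 + pq.2)), ∃ b ∈ K.deg (-(pq.1 + pq.2) - 1),
        a + K.d b = x := by
  rw [mem_eventualBoundaries]
  have hx := mem_filtCycles.1 x.2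
  constructor
  · rintro ⟨b, hb, h, e⟩
    replace e := cl_eq_cl.1 e
    obtain ⟨a, ha, b', hb', hab⟩ := mem_D.1 e
    simp only at hab
    have hxe : a + K.d (b' + b) = x := by
      have : a + K.d b' + K.d b = x := eq_sub_iff_add_eq.1 hab
      rw [← this, map_add, add_assoc]
    -- The correction `a` is a true cycle because `x` is one and `d (d (b' + b)) = 0`.
    have hda : K.d a = 0 := by
      have := hx.2.2
      rwa [← hxe, map_add, K.dd, add_zero] at this
    rw [mem_Z] at ha hb'
    exact ⟨a, ⟨ha.1, ha.2.1, hda⟩, _, add_mem hb'.2.1 hb, hxe⟩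
  · rintro ⟨a, ha, b, hb, e⟩
    have hdb : K.d b = x - a := by rw [← e]; abel
    have ha' := mem_filtCycles.1 ha
    refine ⟨b, hb, ?_, cl_eq_cl.2 (Z_le_D ?_)⟩
    · rw [hdb]
      exact sub_mem x.2 ⟨K.mono (by lia) ha'.1, ha'.2⟩
    · change (x : V) - K.d b ∈ _
      rw [hdb, sub_sub_cancel]
      exact filtCycles_le_Z ha

variable (K) in
/-- The class of a cycle in the graded piece of the abutment. -/
def toAbutment (n p : ℤ) : K.filtCycles p (-n) →ₗ[k]
    (abutmentFilt ψ n p ⧸ (abutmentFilt ψ n (p - 1)).submoduleOf (abutmentFilt ψ n p)) :=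
  Submodule.mkQ _ ∘ₗ LinearMap.codRestrict _ (ψ n ∘ₗ Submodule.inclusion inf_le_right)
    fun x => ⟨⟨x, x.2.2⟩, x.2.1, rfl⟩

variable {ψ}

/-- The class of `x` lies in `F_{p-1} H_n` when some cycle `a ∈ F_{p-1}` has the same class, that
is, when `x - a` is a boundary. -/
theorem toAbutment_eq_zero (hψ : ∀ n, K.IsCohomology (-n) (ψ n)) (n p : ℤ)
    (x : K.filtCycles p (-n)) :
    K.toAbutment ψ n p x = 0 ↔ ∃ a ∈ K.filtCycles (p - 1) (-n), ∃ b ∈ K.deg (-n - 1),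
        a + K.d b = x := by
  refine (Submodule.Quotient.mk_eq_zero _).trans ?_
  change ψ n ⟨x, x.2.2⟩ ∈ abutmentFilt ψ n (p - 1) ↔ _
  constructor
  · rintro ⟨a, ha, e⟩
    have h0 : ψ n (⟨x, x.2.2⟩ - a) = 0 := by rw [map_sub, e, sub_self]
    obtain ⟨b, hb, e'⟩ := ((hψ n).eq_zero_iff _).1 h0
    refine ⟨a, ⟨ha, a.2⟩, b, hb, ?_⟩
    rw [e']
    simp
  · rintro ⟨a, ha, b, hb, e⟩
    refine ⟨⟨a, ha.2⟩, ha.1, ?_⟩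
    rw [← sub_eq_zero, ← map_sub]
    refine ((hψ n).eq_zero_iff _).2 ⟨-b, neg_mem hb, ?_⟩
    simp [← e]

/-- The spectral sequence of a filtered complex converges to its cohomology. -/
def convergence (hψ : ∀ n, K.IsCohomology (-n) (ψ n)) : K.spectralSequence.Convergence H where
  filt := abutmentFilt ψ
  mono n p q hpq := Submodule.map_mono (Submodule.comap_mono (K.mono hpq))
  exhaustive n x := by
    obtain ⟨x, rfl⟩ := (hψ n).surjective x
    obtain ⟨p, hp⟩ := K.exhaustive _ (x : V) x.2.1
    exact ⟨p, x, hp, rfl⟩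
  bounded_below n := by
    obtain ⟨s, hs⟩ := K.bounded (-n)
    refine ⟨s, (Submodule.eq_bot_iff _).2 ?_⟩
    rintro _ ⟨x, hx, rfl⟩
    have : (x : V) ∈ (⊥ : Submodule k V) := hs ▸ ⟨hx, x.2.1⟩
    rw [show x = 0 from Subtype.ext ((Submodule.mem_bot k).1 this), map_zero]
  iso p q := ⟨LinearMap.equivOfKerEq
    (Submodule.mkQ _ ∘ₗ K.toPermanentCycles (p, q)) (K.toAbutment ψ (p + q) p)
    (by
      refine (Submodule.mkQ_surjective _).comp ?_
      rintro ⟨x, hx⟩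
      obtain ⟨w, h, rfl⟩ := mem_permanentCycles.1 hx
      exact ⟨⟨w, h⟩, rfl⟩)
    (by
      refine (Submodule.mkQ_surjective _).comp ?_
      rintro ⟨_, x, hx, rfl⟩
      exact ⟨⟨x, hx, x.2⟩, rfl⟩)
    (by
      ext x
      rw [LinearMap.mem_ker, LinearMap.mem_ker, toAbutment_eq_zero hψ]
      exact (Submodule.Quotient.mk_eq_zero _).trans (toPermanentCycles_mem_iff (p, q) x))⟩

/-- A surjection from the cycles modulo `F_{p-1}` identifies the first page. -/
theorem nonempty_term_iso {pq : ℤ × ℤ} {T : ModuleCat.{u + 1} k}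
    (φ : K.Z 1 pq.1 (-(pq.1 + pq.2)) →ₗ[k] T) (hφ : Function.Surjective φ)
    (hker : ∀ x, φ x = 0 ↔ (x : V) ∈ K.D 1 pq.1 (-(pq.1 + pq.2))) :
    Nonempty (K.spectralSequence.term pq 0 ≅ T) := by
  have h : K.spectralSequence.term pq 0 = (K.page 1).X pq := by
    change (K.page (((0 : ℕ) : ℤ) + 1)).X pq = _
    rw [Nat.cast_zero, zero_add]
  rw [h]
  refine ⟨(LinearMap.equivOfKerEq (K.cl 1 pq) φ (K.cl_surjective _ _) hφ ?_).toModuleIso⟩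
  ext x
  rw [LinearMap.mem_ker, LinearMap.mem_ker, hker, cl_eq_zero]

end Convergence

end FilteredComplex

/-! ### Dimension of a filtered vector space -/

section Rank

/-- The rank of a vector space with an exhaustive filtration that is bounded below is at most the
sum of the ranks of its graded pieces. -/
theorem rank_le_sum_of_filtration {k H : Type*} [Field k] [AddCommGroup H] [Module k H]
    (F : ℤ → Submodule k H) (hmono : Monotone F) (hex : ∀ x, ∃ p, x ∈ F p) {s : ℤ}
    (hs : F s = ⊥) :
    Module.rank k H ≤ Cardinal.sum fun p =>
      Module.rank k (F p ⧸ (F (p - 1)).submoduleOf (F p)) := by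
  have hσ := fun p => ((F (p - 1)).submoduleOf (F p)).mkQ.exists_rightInverse_of_surjective
    (LinearMap.range_eq_top.2 (Submodule.mkQ_surjective _))
  choose σ hσ using hσ
  -- Linear sections of the projections onto the graded pieces add up to a map from their direct sum
  -- to `H`; only its surjectivity is needed.
  let Φ : (⨁ p, (F p ⧸ (F (p - 1)).submoduleOf (F p))) →ₗ[k] H :=
    DirectSum.toModule k ℤ H fun p => (F p).subtype ∘ₗ σ p
  have hΦ : ∀ p (y : F p ⧸ (F (p - 1)).submoduleOf (F p)),
      Φ (DirectSum.lof k ℤ (fun p => F p ⧸ (F (p - 1)).submoduleOf (F p)) p y) = σ p y :=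
    fun p y => by simp [Φ]
  -- Induction upwards from `F s = ⊥`: subtracting from `x` the chosen lift of its class leaves an
  -- element of the layer below.
  have key : ∀ n : ℕ, F (s + n) ≤ LinearMap.range Φ := by
    intro n
    induction n with
    | zero => simp [hs]
    | succ n ih =>
      intro x hx
      have h1 : x - σ _ (Submodule.mkQ _ ⟨x, hx⟩) ∈ F (s + (n + 1 : ℕ) - 1) := by
        have h2 := LinearMap.congr_fun (hσ _) (Submodule.mkQ _ ⟨x, hx⟩)
        exact (Submodule.Quotient.eq ((F (s + (n + 1 : ℕ) - 1)).submoduleOf _)).1 h2.symm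
      have h3 := add_mem (ih (hmono (by lia) h1)) ⟨_, hΦ _ (Submodule.mkQ _ ⟨x, hx⟩)⟩
      simpa using h3
  refine (LinearMap.rank_le_of_surjective Φ fun x => ?_).trans (rank_directSum _ _).le
  obtain ⟨p, hp⟩ := hex x
  exact key (p - s).toNat (hmono (by lia) hp)

end Rank

/-! ### Ext groups from projective resolutions -/

namespace CategoryTheory

open Abelian

/-- A projective resolution of `K 0`, cut into short exact sequences
`0 ⟶ K (i + 1) ⟶ P i ⟶ K i ⟶ 0`. -/
structure SyzygySequence (C : Type*) [Category C] [Abelian C] where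
  K : ℕ → C
  P : ℕ → C
  ι (i : ℕ) : K (i + 1) ⟶ P i
  π (i : ℕ) : P i ⟶ K i
  w (i : ℕ) : ι i ≫ π i = 0
  shortExact (i : ℕ) : (ShortComplex.mk (ι i) (π i) (w i)).ShortExact
  projective (i : ℕ) : Projective (P i)

namespace SyzygySequence

variable {C : Type*} [Category C] [Abelian C] {k : Type*} [Field k] [Linear k C]

/-- The sequence that starts at the first syzygy. -/
def tail (S : SyzygySequence C) : SyzygySequence C where
  K i := S.K (i + 1)
  P i := S.P (i + 1)
  ι i := S.ι (i + 1)
  π i := S.π (i + 1)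
  w i := S.w (i + 1)
  shortExact i := S.shortExact (i + 1)
  projective i := S.projective (i + 1)

/-- The differential of `Hom(P, Y)`. -/
def homD (S : SyzygySequence C) (Y : C) (k : Type*) [Field k] [Linear k C] (i : ℕ) :
    (S.P i ⟶ Y) →ₗ[k] (S.P (i + 1) ⟶ Y) :=
  Linear.leftComp k Y (S.π (i + 1) ≫ S.ι i)

theorem homD_apply (S : SyzygySequence C) (Y : C) (i : ℕ) (f : S.P i ⟶ Y) :
    S.homD Y k i f = S.π (i + 1) ≫ S.ι i ≫ f := by
  simp [homD]

/-- Dimension shifting. For `Ext^1` this is the long exact sequence of `0 → K 1 → P 0 → K 0 → 0`,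
where `Ext^1(P 0, Y) = 0`. In higher degrees the connecting map `Ext^{i+1}(K 1, Y) → Ext^{i+2}(K 0,
Y)` is bijective, and the induction is applied to the resolution `S.tail` of `K 1`. -/
theorem exists_ext_presentation_succ [HasExt C] (S : SyzygySequence C) (Y : C) (i : ℕ) :
    ∃ φ : (S.K (i + 1) ⟶ Y) →ₗ[k] Ext (S.K 0) Y (i + 1), Function.Surjective φ ∧
      ∀ f, φ f = 0 ↔ ∃ g, S.ι i ≫ g = f := by
  induction i generalizing S with
  | zero =>
    have hS := S.shortExact 0
    have := S.projective 0
    refine ⟨Ext.precompOfLinear hS.extClass k Y (add_zero 1) ∘ₗ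
      (Ext.linearEquiv₀ (R := k)).symm.toLinearMap, ?_, fun f => ⟨fun hf => ?_, ?_⟩⟩
    · intro x
      obtain ⟨y, rfl⟩ := Ext.contravariant_sequence_exact₃ hS Y x (Ext.eq_zero_of_projective _)
        (add_zero 1)
      obtain ⟨f, rfl⟩ := (Ext.linearEquiv₀ (R := k)).symm.surjective y
      exact ⟨f, rfl⟩
    · obtain ⟨x, hx⟩ := Ext.contravariant_sequence_exact₁ hS Y _ (add_zero 1) hf
      obtain ⟨g, rfl⟩ := (Ext.linearEquiv₀ (R := k)).symm.surjective x
      refine ⟨g, Ext.homEquiv₀.symm.injective ?_⟩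
      simpa using hx
    · rintro ⟨g, rfl⟩
      have h := hS.extClass_comp_assoc (Ext.mk₀ g) (h := add_zero 1)
      simpa using h
  | succ i ih =>
    obtain ⟨φ, hφ, hker⟩ := ih S.tail
    have hS := S.shortExact 0
    have := S.projective 0
    refine ⟨Ext.precompOfLinear hS.extClass k Y (add_comm 1 (i + 1)) ∘ₗ φ, ?_,
      fun f => Iff.trans ⟨fun hf => ?_, fun hf => ?_⟩ (hker f)⟩
    · intro x
      obtain ⟨y, rfl⟩ := Ext.contravariant_sequence_exact₃ hS Y x (Ext.eq_zero_of_projective _)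
        (add_comm 1 (i + 1))
      obtain ⟨f, rfl⟩ := hφ y
      exact ⟨f, rfl⟩
    · obtain ⟨x, hx⟩ := Ext.contravariant_sequence_exact₁ hS Y _ (add_comm 1 (i + 1)) hf
      refine hx.symm.trans ?_
      rw [Ext.eq_zero_of_projective x, Ext.comp_zero]
      rfl
    · exact (congrArg (fun y => hS.extClass.comp y (add_comm 1 (i + 1))) hf).trans (Ext.comp_zero _ _ _ _ _)

/-- Since `π (i + 1)` is an epimorphism, a cocycle is a map that vanishes on `K (i + 1)`, hence one
that factors through `P i → K i`. -/
theorem homD_eq_zero_iff (S : SyzygySequence C) (Y : C) (i : ℕ) (f : S.P i ⟶ Y) :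
    S.homD Y k i f = 0 ↔ ∃ g, S.π i ≫ g = f := by
  have hepi : Epi (S.π (i + 1)) := (S.shortExact (i + 1)).epi_g
  have hepi' : Epi (S.π i) := (S.shortExact i).epi_g
  rw [homD_apply]
  constructor
  · intro h
    rw [← comp_zero (f := S.π (i + 1)), cancel_epi] at h
    exact ⟨(S.shortExact i).exact.desc f h, (S.shortExact i).exact.g_desc f h⟩
  · rintro ⟨g, rfl⟩
    rw [reassoc_of% (S.w i), zero_comp, comp_zero]

/-- The image of the incoming differential of `Hom(P, Y)`. -/
def homBoundaries (S : SyzygySequence C) (Y : C) (k : Type*) [Field k] [Linear k C] :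
    (i : ℕ) → Submodule k (S.P i ⟶ Y)
  | 0 => ⊥
  | j + 1 => LinearMap.range (S.homD Y k j)

/-- `Ext^i` is the cohomology of `Hom(P, Y)`. -/
theorem exists_ext_of_cocycles [HasExt C] (S : SyzygySequence C) (Y : C) (i : ℕ) :
    ∃ φ : LinearMap.ker (S.homD Y k i) →ₗ[k] Ext (S.K 0) Y i, Function.Surjective φ ∧
      ∀ f, φ f = 0 ↔ (f : S.P i ⟶ Y) ∈ S.homBoundaries Y k i := by
  have hepi : Epi (S.π i) := (S.shortExact i).epi_g
  -- Cocycles are identified with `Hom(K i, Y)`. In positive degree, cancelling the epimorphism `π`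
  -- turns coboundaries into the maps that extend along `ι`.
  let e : (S.K i ⟶ Y) ≃ₗ[k] LinearMap.ker (S.homD Y k i) := LinearEquiv.ofBijective
    (LinearMap.codRestrict _ (Linear.leftComp k Y (S.π i))
      fun g => (S.homD_eq_zero_iff Y i _).2 ⟨g, rfl⟩)
    ⟨fun g g' h => (cancel_epi (S.π i)).1 (congrArg Subtype.val h), fun f => by
      obtain ⟨g, hg⟩ := (S.homD_eq_zero_iff Y i _).1 f.2
      exact ⟨g, Subtype.ext hg⟩⟩
  have he : ∀ g, (e g : S.P i ⟶ Y) = S.π i ≫ g := fun g => rfl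
  cases i with
  | zero =>
    let e' := e.symm ≪≫ₗ (Ext.linearEquiv₀ (R := k)).symm
    refine ⟨e'.toLinearMap, e'.surjective, fun f => (LinearEquiv.map_eq_zero_iff e').trans ?_⟩
    exact ⟨fun h => congrArg Subtype.val h, fun h => Subtype.ext h⟩
  | succ i =>
    obtain ⟨φ, hφ, hker⟩ := S.exists_ext_presentation_succ (k := k) Y i
    refine ⟨φ ∘ₗ e.symm.toLinearMap, hφ.comp (LinearEquiv.surjective _), fun f => ?_⟩
    obtain ⟨f, rfl⟩ := e.surjective f
    rw [LinearMap.comp_apply, LinearEquiv.coe_coe, e.symm_apply_apply, hker, he]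
    refine exists_congr fun g => ?_
    rw [homD_apply, cancel_epi]

end SyzygySequence

end CategoryTheory

/-! ### Filtered complexes in nonnegative degrees -/

/-- A filtered cochain complex `X 0 → X 1 → ⋯` of vector spaces. -/
structure FilteredSequence (k : Type*) [Field k] (X : ℕ → Type*) [∀ i, AddCommGroup (X i)]
    [∀ i, Module k (X i)] where
  d (i : ℕ) : X i →ₗ[k] X (i + 1)
  dd (i : ℕ) (x : X i) : d (i + 1) (d i x) = 0
  filt (i : ℕ) (p : ℤ) : Submodule k (X i)
  mono (i : ℕ) : Monotone (filt i)
  d_filt (i : ℕ) (p : ℤ) (x : X i) (hx : x ∈ filt i p) : d i x ∈ filt (i + 1) p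
  exhaustive (i : ℕ) (x : X i) : ∃ p, x ∈ filt i p
  bounded (i : ℕ) : ∃ p, filt i p = ⊥

namespace FilteredSequence

variable {k : Type*} [Field k] {X : ℕ → Type*} [∀ i, AddCommGroup (X i)] [∀ i, Module k (X i)]
  (S : FilteredSequence k X)

/-- The differential on the product of all terms. -/
def totalD : (∀ i, X i) →ₗ[k] ∀ i, X i where
  toFun x
    | 0 => 0
    | i + 1 => S.d i (x i)
  map_add' x y := by
    funext i
    cases i <;> simp
  map_smul' c x := by
    funext i
    cases i <;> simp

@[simp] theorem totalD_zero (x : ∀ i, X i) : S.totalD x 0 = 0 := rfl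

@[simp] theorem totalD_succ (x : ∀ i, X i) (i : ℕ) : S.totalD x (i + 1) = S.d i (x i) := rfl

/-- The families concentrated in degree `n`. -/
def totalDeg (k : Type*) [Field k] (X : ℕ → Type*) [∀ i, AddCommGroup (X i)]
    [∀ i, Module k (X i)] (n : ℤ) : Submodule k (∀ i, X i) where
  carrier := {x | ∀ i : ℕ, (i : ℤ) ≠ n → x i = 0}
  add_mem' hx hy i hi := by simp [hx i hi, hy i hi]
  zero_mem' _ _ := rfl
  smul_mem' c x hx i hi := by simp [hx i hi]

theorem totalDeg_of_neg {n : ℤ} (hn : n < 0) : totalDeg k X n = ⊥ :=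
  (Submodule.eq_bot_iff _).2 fun _ hx => funext fun i => hx i (by lia)

theorem single_mem_totalDeg (i : ℕ) (x : X i) : Pi.single i x ∈ totalDeg k X i :=
  fun j hj => Pi.single_eq_of_ne (by exact_mod_cast hj) x

theorem eq_single_of_mem_totalDeg {i : ℕ} {x : ∀ i, X i} (hx : x ∈ totalDeg k X i) :
    x = Pi.single i (x i) := by
  funext j
  by_cases h : j = i
  · subst h
    rw [Pi.single_eq_same]
  · rw [Pi.single_eq_of_ne h, hx j (by exact_mod_cast h)]

/-- The filtered complex given by a filtered sequence. -/
def total : FilteredComplex k (∀ i, X i) where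
  d := S.totalD
  dd x := by
    funext i
    rcases i with _ | _ | i
    · rfl
    · simp
    · simp [S.dd]
  deg := totalDeg k X
  d_deg n x hx i hi := by
    cases i with
    | zero => rfl
    | succ i => rw [totalD_succ, hx i (fun h => hi (by push_cast; rw [h])), map_zero]
  filt p := Submodule.pi Set.univ fun i => S.filt i p
  mono p q hpq x hx i hi := S.mono i hpq (hx i hi)
  d_filt p x hx i _ := by
    cases i with
    | zero => exact zero_mem _
    | succ i => exact S.d_filt i p _ (hx i trivial)
  -- The condition is imposed degree by degree: a family with infinitely many nonzero entries need
  -- not lie in any layer of the product.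
  exhaustive n x hx := by
    rcases lt_or_ge n 0 with hn | hn
    · rw [totalDeg_of_neg hn, Submodule.mem_bot] at hx
      exact ⟨0, hx ▸ zero_mem _⟩
    · lift n to ℕ using hn
      obtain ⟨p, hp⟩ := S.exhaustive n (x n)
      refine ⟨p, fun i _ => ?_⟩
      by_cases h : i = n
      · exact h ▸ hp
      · rw [hx i (by exact_mod_cast h)]
        exact zero_mem _
  bounded n := by
    rcases lt_or_ge n 0 with hn | hn
    · exact ⟨0, by rw [totalDeg_of_neg hn, inf_bot_eq]⟩
    · lift n to ℕ using hn
      obtain ⟨p, hp⟩ := S.bounded n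
      refine ⟨p, (Submodule.eq_bot_iff _).2 fun x hx => ?_⟩
      have h : x n ∈ S.filt n p := hx.1 n trivial
      rw [hp, Submodule.mem_bot] at h
      rw [eq_single_of_mem_totalDeg hx.2, h, Pi.single_zero]

theorem mem_total_filt {p : ℤ} {x : ∀ i, X i} : x ∈ S.total.filt p ↔ ∀ i, x i ∈ S.filt i p :=
  ⟨fun h i => h i trivial, fun h i _ => h i⟩

theorem mem_total_filt_of_deg {p : ℤ} {n : ℕ} {x : ∀ i, X i} (hx : x ∈ totalDeg k X n) :
    x ∈ S.total.filt p ↔ x n ∈ S.filt n p := by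
  rw [mem_total_filt]
  refine ⟨fun h => h n, fun h i => ?_⟩
  by_cases hi : i = n
  · exact hi ▸ h
  · rw [hx i (by exact_mod_cast hi)]
    exact zero_mem _

theorem total_d_eq_zero_iff {n : ℕ} {x : ∀ i, X i} (hx : x ∈ totalDeg k X n) :
    S.total.d x = 0 ↔ S.d n (x n) = 0 := by
  refine ⟨fun h => congrFun h (n + 1), fun h => funext fun i => ?_⟩
  cases i with
  | zero => rfl
  | succ i =>
    change S.d i (x i) = 0
    by_cases hi : i = n
    · exact hi ▸ h
    · rw [hx i (by exact_mod_cast hi), map_zero]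

theorem total_d_mem_filt_iff {p : ℤ} {n : ℕ} {x : ∀ i, X i} (hx : x ∈ totalDeg k X n) :
    S.total.d x ∈ S.total.filt p ↔ S.d n (x n) ∈ S.filt (n + 1) p :=
  mem_total_filt_of_deg S (n := n + 1) (by
    have := S.total.d_deg n x hx
    rwa [← Nat.cast_succ] at this)

/-- The boundaries of degree `i` that come from filtration degree `p`. -/
def boundaries (F : ∀ i, Submodule k (X i)) : (i : ℕ) → Submodule k (X i)
  | 0 => ⊥
  | j + 1 => (F j).map (S.d j)

/-- The family `F` is arbitrary so as to cover two cases: `⊤`, for cohomology, and the layers of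
index `p`, for the first page. In degree `0` both sides say that `x` is zero. -/
theorem exists_total_d_eq_iff {n : ℕ} {x : ∀ i, X i} (hx : x ∈ totalDeg k X n)
    (F : ∀ i, Submodule k (X i)) :
    (∃ b ∈ totalDeg k X (n - 1), (∀ i, b i ∈ F i) ∧ S.total.d b = x) ↔
      x n ∈ S.boundaries F n := by
  cases n with
  | zero =>
    constructor
    · rintro ⟨b, -, -, rfl⟩
      rfl
    · intro h
      refine ⟨0, zero_mem _, fun _ => zero_mem _, ?_⟩
      rw [map_zero, eq_single_of_mem_totalDeg hx, (h : x 0 = 0), Pi.single_zero]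
  | succ n =>
    constructor
    · rintro ⟨b, -, hb, rfl⟩
      exact ⟨b n, hb n, rfl⟩
    · rintro ⟨b, hb, hbx⟩
      refine ⟨Pi.single n b, ?_, fun i => ?_, ?_⟩
      · rw [Nat.cast_succ, add_sub_cancel_right]
        exact single_mem_totalDeg n b
      · by_cases h : i = n
        · subst h
          rwa [Pi.single_eq_same]
        · rw [Pi.single_eq_of_ne h]
          exact zero_mem _
      · funext i
        by_cases h : i = n + 1
        · subst h
          change S.d n (Pi.single (M := X) n b n) = _
          rw [Pi.single_eq_same, hbx]
        · rw [hx i (by exact_mod_cast h)]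
          cases i with
          | zero => rfl
          | succ i =>
            change S.d i (Pi.single (M := X) n b i) = _
            rw [Pi.single_eq_of_ne (by lia), map_zero]

section

variable {k : Type u} [Field k] {X : ℕ → Type (u + 1)} [∀ i, AddCommGroup (X i)]
  [∀ i, Module k (X i)] (S : FilteredSequence k X) {H : Type*} [AddCommGroup H] [Module k H]

open FilteredComplex

theorem exists_isCohomology {n : ℕ} (φ : LinearMap.ker (S.d n) →ₗ[k] H)
    (hφ : Function.Surjective φ)
    (hker : ∀ x, φ x = 0 ↔ (x : X n) ∈ S.boundaries (fun _ => ⊤) n) :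
    ∃ ψ, S.total.IsCohomology (H := H) n ψ := by
  refine ⟨φ ∘ₗ LinearMap.codRestrict _ (LinearMap.proj n ∘ₗ Submodule.subtype _) fun x =>
    (S.total_d_eq_zero_iff x.2.1).1 x.2.2, ?_, fun x => ?_⟩
  · intro y
    obtain ⟨x, rfl⟩ := hφ y
    have hx := single_mem_totalDeg (k := k) n (x : X n)
    refine ⟨⟨Pi.single n x, hx, (S.total_d_eq_zero_iff hx).2 ?_⟩, congrArg φ (Subtype.ext ?_)⟩
    · rw [Pi.single_eq_same]
      exact x.2
    · exact Pi.single_eq_same n (x : X n)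
  · refine (hker _).trans ((S.exists_total_d_eq_iff x.2.1 _).symm.trans ?_)
    exact ⟨fun ⟨b, hb, _, e⟩ => ⟨b, hb, e⟩, fun ⟨b, hb, e⟩ => ⟨b, hb, fun _ => trivial, e⟩⟩

theorem isCohomology_of_neg {n : ℤ} (hn : n < 0) [Subsingleton H] :
    S.total.IsCohomology (H := H) n 0 where
  surjective y := ⟨0, Subsingleton.elim _ _⟩
  eq_zero_iff x := by
    have hx : (x : ∀ i, X i) = 0 := by
      exact (Submodule.mem_bot k).1 ((totalDeg_of_neg hn).le x.2.1)
    exact ⟨fun _ => ⟨0, zero_mem _, by rw [map_zero, hx]⟩, fun _ => Subsingleton.elim _ _⟩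

/-- The elements of filtration degree `p` that are cycles modulo filtration degree `p - 1`. -/
def firstCycles (n : ℕ) (p : ℤ) : Submodule k (X n) :=
  S.filt n p ⊓ (S.filt (n + 1) (p - 1)).comap (S.d n)

/-- The condition on `d` in the definition of `Z^0` holds automatically, because `d` preserves the
filtration. Hence `D^1_p` is `F_{p-1} + d F_p` in the given degree. -/
theorem exists_first_page {n : ℕ} {p : ℤ} (φ : S.firstCycles n p →ₗ[k] H)
    (hφ : Function.Surjective φ)
    (hker : ∀ x, φ x = 0 ↔ (x : X n) ∈ S.filt n (p - 1) ⊔ S.boundaries (fun i => S.filt i p) n) :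
    ∃ ψ : S.total.Z 1 p n →ₗ[k] H, Function.Surjective ψ ∧
      ∀ x, ψ x = 0 ↔ (x : ∀ i, X i) ∈ S.total.D 1 p n := by
  have hmem : ∀ {x : ∀ i, X i}, x ∈ totalDeg k X n →
      (x ∈ S.total.Z 1 p n ↔ x n ∈ S.firstCycles n p) := fun {x} hx => by
    rw [mem_Z, S.mem_total_filt_of_deg hx, S.total_d_mem_filt_iff hx]
    exact ⟨fun h => ⟨h.1, h.2.2⟩, fun h => ⟨h.1, hx, h.2⟩⟩
  refine ⟨φ ∘ₗ LinearMap.codRestrict _ (LinearMap.proj n ∘ₗ Submodule.subtype _) fun x =>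
    (hmem (mem_Z.1 x.2).2.1).1 x.2, ?_, fun x => ?_⟩
  · intro y
    obtain ⟨x, rfl⟩ := hφ y
    have hx := single_mem_totalDeg (k := k) n (x : X n)
    refine ⟨⟨Pi.single n x, (hmem hx).2 ?_⟩, congrArg φ (Subtype.ext ?_)⟩
    · rw [Pi.single_eq_same]
      exact x.2
    · exact Pi.single_eq_same n (x : X n)
  · have hx := (mem_Z.1 x.2).2.1
    refine (hker _).trans ?_
    rw [mem_D, Submodule.mem_sup]
    constructor
    · rintro ⟨a, ha, c, hc, e⟩
      have hcd := single_mem_totalDeg (k := k) n c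
      obtain ⟨b, hb, hbF, hbc⟩ := (S.exists_total_d_eq_iff hcd _).2
        (by rwa [Pi.single_eq_same])
      have had := single_mem_totalDeg (k := k) n a
      have haF : Pi.single n a ∈ S.total.filt (p - 1) := by
        rw [S.mem_total_filt_of_deg had, Pi.single_eq_same]
        exact ha
      have hbF' := S.mem_total_filt.2 hbF
      refine ⟨Pi.single n a, mem_Z.2 ⟨haF, had, ?_⟩, b, mem_Z.2 ⟨?_, hb, ?_⟩, ?_⟩
      · exact S.total.mono (by lia) (S.total.d_filt _ _ haF)
      · exact S.total.mono (by lia) hbF'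
      · exact S.total.mono (by lia) (S.total.d_filt _ _ hbF')
      · rw [hbc, ← Pi.single_add, e]
        exact (eq_single_of_mem_totalDeg hx).symm
    · rintro ⟨a, ha, b, hb, e⟩
      rw [mem_Z] at ha hb
      have hdb := S.total.d_deg _ _ hb.2.1
      rw [sub_add_cancel] at hdb
      refine ⟨a n, (S.mem_total_filt.1 ha.1) n, S.total.d b n,
        (S.exists_total_d_eq_iff hdb _).1 ⟨b, hb.2.1, ?_, rfl⟩, congrFun e n⟩
      refine S.mem_total_filt.1 (S.total.mono (by lia) hb.1)

end

end FilteredSequence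

/-! ### Exact sequences and free objects in the category of graded modules -/

namespace GrMod

variable {k A : Type u} {G : Type} [Field k] [Ring A] [Algebra k A] [AddCommGroup G] [DecidableEq G]
  {𝒜 : G → Submodule k A} [GradedAlgebra 𝒜]

theorem mono_of_injective {N M : GrMod 𝒜} (f : N ⟶ M) (hf : Function.Injective (lin f)) : Mono f :=
  ⟨fun _ _ h => hom_ext fun x => hf (LinearMap.congr_fun (congrArg lin h) x)⟩

theorem epi_of_surjective {N M : GrMod 𝒜} (f : N ⟶ M) (hf : Function.Surjective (lin f)) : Epi f :=
  ⟨fun _ _ h => hom_ext fun y => by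
    obtain ⟨x, rfl⟩ := hf y
    exact LinearMap.congr_fun (congrArg lin h) x⟩

theorem shortExact_of_exact {N M L : GrMod 𝒜} (f : N ⟶ M) (g : M ⟶ L) (w : f ≫ g = 0)
    (hinj : Function.Injective (lin f)) (hsurj : Function.Surjective (lin g))
    (hex : ∀ y, lin g y = 0 → y ∈ LinearMap.range (lin f)) :
    (ShortComplex.mk f g w).ShortExact where
  exact := ShortComplex.exact_of_f_is_kernel _ (isLimitOfExact f g w hinj hex)
  mono_f := mono_of_injective f hinj
  epi_g := epi_of_surjective g hsurj

/-- Bijective morphisms are isomorphisms. -/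
theorem isIso_of_bijective {N M : GrMod 𝒜} (f : N ⟶ M) (hf : Function.Bijective (lin f)) :
    IsIso f := by
  have := mono_of_injective f hf.1
  have := epi_of_surjective f hf.2
  exact isIso_of_mono_of_epi f

theorem mem_of_components {M : GrMod 𝒜} (p : Submodule k M) (x : M)
    (h : ∀ i, (DirectSum.decompose M.deg x i : M) ∈ p) : x ∈ p :=
  mem_iSup_of_decompose M.deg p x h

/-- The kernel and the range of a graded morphism are homogeneous, so exactness may be tested on
components. The two tests that follow rest on the same remark. -/
theorem exact_of_homogeneous {N M L : GrMod 𝒜} (f : N ⟶ M) (g : M ⟶ L)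
    (h : ∀ i, ∀ y ∈ M.deg i, lin g y = 0 → y ∈ LinearMap.range (lin f)) (y : M)
    (hy : lin g y = 0) : y ∈ LinearMap.range (lin f) := by
  refine mem_of_components ((LinearMap.range (lin f)).restrictScalars k) y fun i => ?_
  exact h i _ (SetLike.coe_mem _) (ker_homogeneous g i hy)

theorem injective_of_homogeneous {N M : GrMod 𝒜} (f : N ⟶ M)
    (h : ∀ i, ∀ y ∈ N.deg i, lin f y = 0 → y = 0) : Function.Injective (lin f) := by
  rw [← LinearMap.ker_eq_bot, eq_bot_iff]
  intro y hy
  exact mem_of_components ⊥ y fun i => h i _ (SetLike.coe_mem _) (ker_homogeneous f i hy)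

theorem surjective_of_homogeneous {N M : GrMod 𝒜} (f : N ⟶ M)
    (h : ∀ i, ∀ y ∈ M.deg i, y ∈ LinearMap.range (lin f)) : Function.Surjective (lin f) := fun y =>
  mem_of_components ((LinearMap.range (lin f)).restrictScalars k) y fun i =>
    h i _ (SetLike.coe_mem _)

theorem exists_homogeneous_preimage {N M : GrMod 𝒜} (f : N ⟶ M) {i : G} {y : M}
    (hy : y ∈ M.deg i) (h : y ∈ LinearMap.range (lin f)) : ∃ x ∈ N.deg i, lin f x = y := by
  obtain ⟨x, rfl⟩ := h
  refine ⟨_, SetLike.coe_mem (DirectSum.decompose N.deg x i), ?_⟩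
  rw [← lin_decompose, DirectSum.decompose_of_mem_same _ hy]

/-! ### Free graded modules of finite rank -/

section Free

variable (𝒜) {m : ℕ} (g : Fin m → G)

/-- The free graded module with generators in the given degrees. -/
def free : GrMod 𝒜 :=
  letI D : G → Submodule k (Fin m → A) := fun ζ => Submodule.pi Set.univ fun j => 𝒜 (ζ - g j)
  haveI hD : DirectSum.IsInternal D := by
    refine isInternal_of_proj D (fun ζ => LinearMap.pi fun j =>
      gradedProj 𝒜 (ζ - g j) ∘ₗ LinearMap.proj j) ?_ ?_ ?_
    · exact fun i x hx => funext fun j => DirectSum.decompose_of_mem_same _ (hx j trivial)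
    · exact fun i i' hi x hx => funext fun j => DirectSum.decompose_of_mem_ne _ (hx j trivial)
        fun h => hi (sub_left_injective h).symm
    · intro x
      rw [← Finset.univ_sum_single x]
      refine Submodule.sum_mem _ fun j _ => ?_
      refine mem_iSup_of_decompose 𝒜 ((⨆ i, D i).comap (LinearMap.single k (fun _ => A) j)) (x j)
        fun i => (le_iSup D (i + g j)) fun l _ => ?_
      by_cases h : l = j
      · subst h
        simp
      · simp [Pi.single_eq_of_ne h]
  { carrier := Fin m → A
    deg := D
    dec := hD.chooseDecomposition
    gradedSMul := ⟨fun {i j a x} ha hx l _ => by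
      change a * x l ∈ 𝒜 (i + j - g l)
      rw [add_sub_assoc]
      exact SetLike.mul_mem_graded ha (hx l trivial)⟩ }

variable {𝒜 g}

theorem mem_free_deg {ζ : G} {x : Fin m → A} :
    x ∈ (free 𝒜 g).deg ζ ↔ ∀ j, x j ∈ 𝒜 (ζ - g j) :=
  ⟨fun h j => h j trivial, fun h j _ => h j⟩

variable (𝒜 g) in
/-- A generator of the free graded module. -/
def freeGen (j : Fin m) : free 𝒜 g := (Pi.single j 1 : Fin m → A)

theorem freeGen_mem (j : Fin m) : freeGen 𝒜 g j ∈ (free 𝒜 g).deg (g j) := by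
  refine mem_free_deg.2 fun l => ?_
  by_cases h : l = j
  · subst h
    rw [sub_self, freeGen, Pi.single_eq_same]
    exact SetLike.one_mem_graded 𝒜
  · rw [freeGen, Pi.single_eq_of_ne h]
    exact zero_mem _

theorem eq_sum_freeGen (x : Fin m → A) :
    (x : free 𝒜 g) = ∑ j, x j • freeGen 𝒜 g j := by
  refine (pi_eq_sum_univ' x).trans ?_
  refine Finset.sum_congr rfl fun j _ => congrArg (x j • ·) ?_
  funext l
  simp [freeGen, Pi.single_apply, eq_comm]

variable {M : GrMod 𝒜}

/-- The morphism that sends the generators to the given elements. -/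
def freeLift (x : Fin m → M) (hx : ∀ j, x j ∈ M.deg (g j)) : free 𝒜 g ⟶ M :=
  ofLin (N := free 𝒜 g) (Fintype.linearCombination A x) fun i y hy => by
    replace hy := mem_free_deg.1 hy
    refine (congrArg (· ∈ M.deg i) (Fintype.linearCombination_apply A x y)).mpr ?_
    refine Submodule.sum_mem _ fun j _ => ?_
    have := M.smul_mem_deg (hy j) (hx j)
    rwa [sub_add_cancel] at this

theorem freeLift_apply (x : Fin m → M) (hx : ∀ j, x j ∈ M.deg (g j)) (y : Fin m → A) :
    lin (freeLift x hx) y = ∑ j, y j • x j := Fintype.linearCombination_apply A x y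

theorem freeLift_gen (x : Fin m → M) (hx : ∀ j, x j ∈ M.deg (g j)) (j : Fin m) :
    lin (freeLift x hx) (freeGen 𝒜 g j) = x j := by
  refine (freeLift_apply x hx _).trans ?_
  rw [Finset.sum_eq_single j]
  · simp [freeGen]
  · intro l _ h
    simp [freeGen, Pi.single_eq_of_ne h]
  · simp

theorem lin_free_apply (f : free 𝒜 g ⟶ M) (y : Fin m → A) :
    lin f y = ∑ j, y j • lin f (freeGen 𝒜 g j) := by
  refine (congrArg (lin f) (eq_sum_freeGen y)).trans ?_
  rw [map_sum]
  exact Finset.sum_congr rfl fun j _ => map_smul _ _ _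

theorem free_hom_ext {f f' : free 𝒜 g ⟶ M}
    (h : ∀ j, lin f (freeGen 𝒜 g j) = lin f' (freeGen 𝒜 g j)) : f = f' :=
  hom_ext fun y => by
    rw [lin_free_apply f y, lin_free_apply f' y]
    simp only [h]

/-- The images of the generators are lifted to preimages of the same degree, so that the lifted map
is homogeneous. -/
instance : Projective (free 𝒜 g) where
  factors {E X} f e _ := by
    have hs := surjective_of_epi e
    choose y hy hye using fun j =>
      exists_homogeneous_preimage e (lin_mem f (freeGen_mem (g := g) j)) (hs _)
    refine ⟨freeLift y hy, free_hom_ext fun j => ?_⟩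
    rw [lin_comp, LinearMap.comp_apply, freeLift_gen, hye]

theorem freeLift_surjective (x : Fin m → M) (hx : ∀ j, x j ∈ M.deg (g j))
    (h : Submodule.span A (Set.range x) = ⊤) : Function.Surjective (lin (freeLift x hx)) := by
  have h1 := (Fintype.range_linearCombination A (v := x)).trans h
  exact LinearMap.range_eq_top.1 h1

end Free

/-- A finitely generated homogeneous submodule has finitely many homogeneous generators. -/
theorem exists_homogeneous_generators_of_fg {R : Type*} [Semiring R] {M : GrMod 𝒜} [Module R M]
    {p : Submodule R M} (hp : SetLike.IsHomogeneous M.deg p) (hfg : p.FG) :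
    ∃ (m : ℕ) (g : Fin m → G) (x : Fin m → M), (∀ j, x j ∈ M.deg (g j)) ∧
      Submodule.span R (Set.range x) = p := by
  classical
  obtain ⟨S, hS⟩ := hfg
  -- The new generators are the nonzero homogeneous components of the given ones.
  let T : Finset (Σ i, M.deg i) := S.biUnion fun x =>
    (DirectSum.decompose M.deg x).support.image fun i => ⟨i, DirectSum.decompose M.deg x i⟩
  let e := T.equivFin.symm
  refine ⟨T.card, fun j => (e j).1.1, fun j => (e j).1.2, fun j => (e j).1.2.2,
    le_antisymm (Submodule.span_le.2 ?_) ?_⟩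
  · rintro _ ⟨j, rfl⟩
    obtain ⟨x, hx, h⟩ := Finset.mem_biUnion.1 (e j).2
    obtain ⟨i, -, h⟩ := Finset.mem_image.1 h
    dsimp only
    rw [← h]
    exact hp i (hS ▸ Submodule.subset_span hx)
  · rw [← hS, Submodule.span_le]
    intro x hx
    rw [SetLike.mem_coe, ← DirectSum.sum_support_decompose M.deg x]
    refine Submodule.sum_mem _ fun i hi => Submodule.subset_span ?_
    have hT : (⟨i, DirectSum.decompose M.deg x i⟩ : Σ i, M.deg i) ∈ T :=
      Finset.mem_biUnion.2 ⟨x, hx, Finset.mem_image_of_mem _ hi⟩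
    refine ⟨e.symm ⟨_, hT⟩, ?_⟩
    dsimp only
    rw [e.apply_symm_apply]

/-- A finitely generated graded module has finitely many homogeneous generators. -/
theorem exists_homogeneous_generators (M : GrMod 𝒜) [Module.Finite A M] :
    ∃ (m : ℕ) (g : Fin m → G) (x : Fin m → M), (∀ j, x j ∈ M.deg (g j)) ∧
      Submodule.span A (Set.range x) = ⊤ :=
  exists_homogeneous_generators_of_fg (p := (⊤ : Submodule A M)) (fun _ _ _ => trivial)
    Module.Finite.fg_top

end GrMod

/-! ### Symbols in associated graded modules -/

section Symbols

variable {k A : Type u} {G : Type} [Field k] [Ring A] [Algebra k A] [AddCommGroup G]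
  [DecidableEq G] {𝒜 : G → Submodule k A} [GradedAlgebra 𝒜]

omit [AddCommGroup G] in
theorem lof_grPiece_eq_zero {M : Type u} [AddCommGroup M] [Module k M] (F : ℤ → Submodule k M)
    (D : G → Submodule k M) (i : G × ℤ) (x : filtPiece F D i) :
    DirectSum.lof k (G × ℤ) (GrPiece F D) i (GrPiece.mk F D i x) = 0 ↔
      (x : M) ∈ F (i.2 - 1) := by
  rw [DirectSum.lof_eq_of, ← map_zero (DirectSum.of (GrPiece F D) i),
    (DirectSum.of_injective (β := GrPiece F D) i).eq_iff]
  refine (Submodule.Quotient.mk_eq_zero _).trans ?_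
  exact ⟨fun h => h.1, fun h => ⟨h, x.2.2⟩⟩

omit [AddCommGroup G] in
theorem lof_grPiece_congr {M : Type u} [AddCommGroup M] [Module k M] (F : ℤ → Submodule k M)
    (D : G → Submodule k M) {i j : G × ℤ} (h : i = j) (x : filtPiece F D i) (y : filtPiece F D j)
    (hxy : (x : M) = y) :
    DirectSum.lof k (G × ℤ) (GrPiece F D) i (GrPiece.mk F D i x) =
      DirectSum.lof k (G × ℤ) (GrPiece F D) j (GrPiece.mk F D j y) := by
  subst h
  rw [Subtype.ext hxy]

namespace AlgFiltration

variable (FA : AlgFiltration 𝒜)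

/-- The symbol in `gr A` of an element of `F_p A_ξ`. -/
def sym (i : G × ℤ) : filtPiece FA.layer 𝒜 i →ₗ[k] GrAlg FA :=
  DirectSum.lof k (G × ℤ) (GrPiece FA.layer 𝒜) i ∘ₗ GrPiece.mk FA.layer 𝒜 i

theorem exists_sym {i : G × ℤ} {y : GrAlg FA} (hy : y ∈ grDeg FA i) : ∃ a, FA.sym i a = y := by
  obtain ⟨y, rfl⟩ := hy
  obtain ⟨a, rfl⟩ := GrPiece.mk_surjective _ _ _ y
  exact ⟨a, rfl⟩

theorem sym_eq_zero_iff {i : G × ℤ} {a : filtPiece FA.layer 𝒜 i} :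
    FA.sym i a = 0 ↔ (a : A) ∈ FA.layer (i.2 - 1) :=
  lof_grPiece_eq_zero FA.layer 𝒜 i a

end AlgFiltration

namespace ModFiltration

variable {FA : AlgFiltration 𝒜} {M : GrMod 𝒜} (F : ModFiltration FA M)

theorem layer_mono : Monotone F.layer := F.isFiltration.mono

theorem smul_mem_layer {m n : ℤ} {a : A} {x : M} (ha : a ∈ FA.layer m) (hx : x ∈ F.layer n) :
    a • x ∈ F.layer (m + n) :=
  F.isFiltration.toGradedSMul.smul_mem ha hx

theorem decompose_mem_filtPiece {n : ℤ} {x : M} (hx : x ∈ F.layer n) (ζ : G) :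
    (DirectSum.decompose M.deg x ζ : M) ∈ filtPiece F.layer M.deg (ζ, n) :=
  ⟨F.homogeneous n ζ hx, SetLike.coe_mem _⟩

/-- The symbol in `gr M` of an element of `F_p M_ξ`. -/
def sym (i : G × ℤ) : filtPiece F.layer M.deg i →ₗ[k] F.gr :=
  DirectSum.lof k (G × ℤ) (GrPiece F.layer M.deg) i ∘ₗ GrPiece.mk F.layer M.deg i

theorem sym_mem (i : G × ℤ) (x : filtPiece F.layer M.deg i) : F.sym i x ∈ F.gr.deg i := ⟨_, rfl⟩

variable {F}

theorem exists_sym {i : G × ℤ} {y : F.gr} (hy : y ∈ F.gr.deg i) : ∃ x, F.sym i x = y := by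
  obtain ⟨y, rfl⟩ := hy
  obtain ⟨x, rfl⟩ := GrPiece.mk_surjective _ _ _ y
  exact ⟨x, rfl⟩

theorem sym_eq_zero_iff {i : G × ℤ} {x : filtPiece F.layer M.deg i} :
    F.sym i x = 0 ↔ (x : M) ∈ F.layer (i.2 - 1) :=
  lof_grPiece_eq_zero F.layer M.deg i x

theorem sym_congr {i j : G × ℤ} (h : i = j) {x : filtPiece F.layer M.deg i}
    {y : filtPiece F.layer M.deg j} (hxy : (x : M) = y) : F.sym i x = F.sym j y :=
  lof_grPiece_congr F.layer M.deg h x y hxy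

theorem sym_smul_sym (i j : G × ℤ) (a : filtPiece FA.layer 𝒜 i) (x : filtPiece F.layer M.deg j) :
    FA.sym i a • F.sym j x = F.sym (i + j) (filtPieceSMul FA F.layer M.deg i j a x) :=
  DirectSum.Gmodule.of_smul_of (GrPiece FA.layer 𝒜) (GrPiece F.layer M.deg)
    (GrPiece.mk _ _ i a) (GrPiece.mk _ _ j x)

/-- The product of symbols, with the target degree up to equality. -/
theorem sym_smul_sym_eq {i j l : G × ℤ} (h : i + j = l) {a : filtPiece FA.layer 𝒜 i}
    {x : filtPiece F.layer M.deg j} {y : filtPiece F.layer M.deg l} (hy : (a : A) • (x : M) = y) :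
    FA.sym i a • F.sym j x = F.sym l y :=
  (sym_smul_sym i j a x).trans (sym_congr h hy)

theorem gr_induction {p : Submodule k F.gr} (h : ∀ i x, F.sym i x ∈ p) (y : F.gr) : y ∈ p :=
  GrMod.mem_of_components p y fun i => by
    obtain ⟨x, hx⟩ := exists_sym (SetLike.coe_mem (DirectSum.decompose F.gr.deg y i))
    exact hx ▸ h i x

/-- Morphisms from an associated graded module are determined by their values on symbols. -/
theorem gr_linear_ext {Y : Type*} [AddCommGroup Y] [Module (GrAlg FA) Y] [Module k Y]
    [IsScalarTower k (GrAlg FA) Y] {f f' : F.gr →ₗ[GrAlg FA] Y}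
    (h : ∀ i x, f (F.sym i x) = f' (F.sym i x)) : f = f' := by
  refine LinearMap.ext fun y => ?_
  exact gr_induction (p := LinearMap.eqLocus (f.restrictScalars k) (f'.restrictScalars k)) h y

theorem gr_hom_ext {Y : GrMod (grDeg FA)} {f f' : F.gr ⟶ Y}
    (h : ∀ i x, GrMod.lin f (F.sym i x) = GrMod.lin f' (F.sym i x)) : f = f' :=
  GrMod.lin_injective (gr_linear_ext h)

end ModFiltration

/-! ### Maps induced on associated graded modules -/

namespace ModFiltration

variable {FA : AlgFiltration 𝒜} {N M : GrMod 𝒜} (FN : ModFiltration FA N)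
  (FM : ModFiltration FA M) (f : N →ₗ[A] M) (σ : G × ℤ)
  (hf : ∀ i, ∀ x ∈ filtPiece FN.layer N.deg i, f x ∈ filtPiece FM.layer M.deg (i + σ))

/-- The map on pieces of associated graded modules given by a filtered map of degree `σ`. -/
def grPieceMap (i : G × ℤ) : GrPiece FN.layer N.deg i →ₗ[k] FM.gr :=
  Submodule.liftQ _ (FM.sym (i + σ) ∘ₗ (f.restrictScalars k).restrict (hf i)) fun x hx => by
    refine sym_eq_zero_iff.2 ?_
    have := (hf (i.1, i.2 - 1) x hx).1
    rwa [show ((i.1, i.2 - 1) + σ).2 = (i + σ).2 - 1 by simp; ring] at this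

/-- The `k`-linear map on associated graded modules given by a filtered map of degree `σ`. -/
def grLinBase : FN.gr →ₗ[k] FM.gr :=
  DirectSum.toModule k (G × ℤ) FM.gr (grPieceMap FN FM f σ hf)

theorem grLinBase_sym (i : G × ℤ) (x : filtPiece FN.layer N.deg i) :
    grLinBase FN FM f σ hf (FN.sym i x) = FM.sym (i + σ) ⟨f x, hf i x x.2⟩ :=
  DirectSum.toModule_lof k (φ := grPieceMap FN FM f σ hf) i (GrPiece.mk _ _ i x)

theorem algSym_induction {p : Submodule k (GrAlg FA)} (h : ∀ i a, FA.sym i a ∈ p) (y : GrAlg FA) :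
    y ∈ p :=
  mem_iSup_of_decompose (grDeg FA) p y fun i => by
    obtain ⟨x, hx⟩ := FA.exists_sym (SetLike.coe_mem (DirectSum.decompose (grDeg FA) y i))
    exact hx ▸ h i x

/-- Both sides are bilinear in `a` and `y`, and symbols span. On symbols the identity is the
`A`-linearity of `f`. -/
theorem grLinBase_smul (a : GrAlg FA) (y : FN.gr) :
    grLinBase FN FM f σ hf (a • y) = a • grLinBase FN FM f σ hf y := by
  let φ := grLinBase FN FM f σ hf
  let L : GrAlg FA →ₗ[k] FN.gr →ₗ[k] FM.gr :=
    (Algebra.lsmul k k FN.gr).toLinearMap.compr₂ φ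
  let R : GrAlg FA →ₗ[k] FN.gr →ₗ[k] FM.gr :=
    (Algebra.lsmul k k FM.gr).toLinearMap.compl₂ φ
  suffices h : L = R from LinearMap.congr_fun (LinearMap.congr_fun h a) y
  refine LinearMap.ext fun a => ?_
  refine algSym_induction (p := LinearMap.eqLocus L R) (fun i a => ?_) a
  refine LinearMap.ext fun y => ?_
  refine gr_induction (p := LinearMap.eqLocus (L (FA.sym i a)) (R (FA.sym i a))) (fun j x => ?_) y
  change φ (FA.sym i a • FN.sym j x) = FA.sym i a • φ (FN.sym j x)
  rw [sym_smul_sym, grLinBase_sym, grLinBase_sym]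
  exact (sym_smul_sym_eq (add_assoc i j σ).symm (map_smul f (a : A) (x : N)).symm).symm

/-- The map on associated graded modules given by a filtered map of degree `σ`. -/
def grLin : FN.gr →ₗ[GrAlg FA] FM.gr where
  toFun := grLinBase FN FM f σ hf
  map_add' := map_add _
  map_smul' := grLinBase_smul FN FM f σ hf

theorem grLin_sym (i : G × ℤ) (x : filtPiece FN.layer N.deg i) :
    grLin FN FM f σ hf (FN.sym i x) = FM.sym (i + σ) ⟨f x, hf i x x.2⟩ :=
  grLinBase_sym FN FM f σ hf i x

theorem grLin_mem {i : G × ℤ} {y : FN.gr} (hy : y ∈ FN.gr.deg i) :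
    grLin FN FM f σ hf y ∈ FM.gr.deg (i + σ) := by
  obtain ⟨x, rfl⟩ := exists_sym hy
  rw [grLin_sym]
  exact FM.sym_mem _ _

end ModFiltration

namespace ModFiltration

variable {FA : AlgFiltration 𝒜} {N M L : GrMod 𝒜} (FN : ModFiltration FA N)
  (FM : ModFiltration FA M) (FL : ModFiltration FA L)

/-- A morphism is filtered if it preserves the filtrations. -/
def IsFilteredHom (f : N ⟶ M) : Prop := ∀ n, ∀ x ∈ FN.layer n, GrMod.lin f x ∈ FM.layer n

variable {FN FM FL}

/-- The morphism of associated graded modules given by a filtered morphism. -/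
def grMap {f : N ⟶ M} (hf : IsFilteredHom FN FM f) : FN.gr ⟶ FM.gr :=
  GrMod.ofLin (grLin FN FM (GrMod.lin f) 0 fun i x hx => by
    rw [add_zero]
    exact ⟨hf _ x hx.1, GrMod.lin_mem f hx.2⟩) fun i y hy => by
      have := grLin_mem FN FM (GrMod.lin f) 0 (fun i x hx => by
        rw [add_zero]
        exact ⟨hf _ x hx.1, GrMod.lin_mem f hx.2⟩) hy
      rwa [add_zero] at this

theorem grMap_sym {f : N ⟶ M} (hf : IsFilteredHom FN FM f) (i : G × ℤ)
    (x : filtPiece FN.layer N.deg i) : GrMod.lin (grMap hf) (FN.sym i x) =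
      FM.sym i ⟨GrMod.lin f x, hf _ x x.2.1, GrMod.lin_mem f x.2.2⟩ :=
  (grLin_sym FN FM (GrMod.lin f) 0 _ i x).trans (sym_congr (add_zero i) rfl)

end ModFiltration

/-- The `A`-linear map `N → M` underlying a morphism `N ⟶ M[ξ]`. -/
def GrMod.linShift {N M : GrMod 𝒜} {ξ : G} (f : N ⟶ M.shift ξ) : N →ₗ[A] M :=
  GrMod.lin (M := M.shift ξ) f

theorem GrMod.linShift_mem {N M : GrMod 𝒜} {ξ : G} (f : N ⟶ M.shift ξ) {i : G} {x : N}
    (hx : x ∈ N.deg i) : GrMod.linShift f x ∈ M.deg (i + ξ) :=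
  GrMod.lin_mem (M := M.shift ξ) f hx

theorem GrMod.hom_shift_ext {N M : GrMod 𝒜} {ξ : G} {f g : N ⟶ M.shift ξ}
    (h : GrMod.linShift f = GrMod.linShift g) : f = g :=
  GrMod.lin_injective (M := M.shift ξ) h

theorem GrMod.linShift_add {N M : GrMod 𝒜} {ξ : G} (f g : N ⟶ M.shift ξ) :
    GrMod.linShift (f + g) = GrMod.linShift f + GrMod.linShift g := rfl

theorem GrMod.linShift_smul {N M : GrMod 𝒜} {ξ : G} (c : k) (f : N ⟶ M.shift ξ) :
    GrMod.linShift (c • f) = c • GrMod.linShift f := rfl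

/-- The morphism `N ⟶ M[ξ]` given by a linear map of degree `ξ`. -/
def GrMod.ofLinShift {N M : GrMod 𝒜} {ξ : G} (f : N →ₗ[A] M)
    (hf : ∀ i, ∀ x ∈ N.deg i, f x ∈ M.deg (i + ξ)) : N ⟶ M.shift ξ :=
  GrMod.ofLin (M := M.shift ξ) f hf

theorem GrMod.linShift_ofLinShift {N M : GrMod 𝒜} {ξ : G} (f : N →ₗ[A] M)
    (hf : ∀ i, ∀ x ∈ N.deg i, f x ∈ M.deg (i + ξ)) :
    GrMod.linShift (GrMod.ofLinShift f hf) = f := rfl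

theorem GrMod.linShift_comp {L N M : GrMod 𝒜} {ξ : G} (u : L ⟶ N) (f : N ⟶ M.shift ξ) :
    GrMod.linShift (u ≫ f) = GrMod.linShift f ∘ₗ GrMod.lin u := rfl

/-! ### The filtration on Hom spaces and its graded pieces -/

namespace ModFiltration

variable {FA : AlgFiltration 𝒜} {N M L : GrMod 𝒜} (FN : ModFiltration FA N)
  (FM : ModFiltration FA M) {FL : ModFiltration FA L}

/-- The maps `N ⟶ M[ξ]` that raise the filtration degree by at most `p`. -/
def filtHom (ξ : G) (p : ℤ) : Submodule k (N ⟶ M.shift ξ) where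
  carrier := {f | ∀ n, ∀ x ∈ FN.layer n, GrMod.linShift f x ∈ FM.layer (n + p)}
  add_mem' hf hg n x hx := add_mem (hf n x hx) (hg n x hx)
  zero_mem' n _ _ := zero_mem (FM.layer (n + p))
  smul_mem' c _ hf n x hx := Submodule.smul_mem _ c (hf n x hx)

variable {FN FM}

theorem filtHom_mono (ξ : G) : Monotone (filtHom FN FM ξ) := fun _ _ h _ hf n x hx =>
  FM.layer_mono (by lia) (hf n x hx)

theorem comp_mem_filtHom {ξ : G} {p : ℤ} {u : L ⟶ N} (hu : IsFilteredHom FL FN u)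
    {f : N ⟶ M.shift ξ} (hf : f ∈ filtHom FN FM ξ p) : u ≫ f ∈ filtHom FL FM ξ p :=
  fun n x hx => hf n _ (hu n x hx)

theorem filtHom_apply_mem {ξ : G} {p : ℤ} {f : N ⟶ M.shift ξ} (hf : f ∈ filtHom FN FM ξ p)
    (i : G × ℤ) (x : N) (hx : x ∈ filtPiece FN.layer N.deg i) :
    GrMod.linShift f x ∈ filtPiece FM.layer M.deg (i + (ξ, p)) :=
  ⟨hf _ x hx.1, GrMod.linShift_mem f hx.2⟩

/-- The morphism `gr N ⟶ (gr M)[(ξ, p)]` given by a map that raises the filtration degree by at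
most `p`. -/
def grHomAux {ξ : G} {p : ℤ} {f : N ⟶ M.shift ξ} (hf : f ∈ filtHom FN FM ξ p) :
    FN.gr ⟶ FM.gr.shift (ξ, p) :=
  GrMod.ofLinShift (grLin FN FM (GrMod.linShift f) (ξ, p) (filtHom_apply_mem hf))
    fun _ _ hy => grLin_mem FN FM _ _ _ hy

theorem grHomAux_sym {ξ : G} {p : ℤ} {f : N ⟶ M.shift ξ} (hf : f ∈ filtHom FN FM ξ p)
    (i : G × ℤ) (x : filtPiece FN.layer N.deg i) :
    GrMod.linShift (grHomAux hf) (FN.sym i x) =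
      FM.sym (i + (ξ, p)) ⟨_, filtHom_apply_mem hf i x x.2⟩ := by
  rw [grHomAux, GrMod.linShift_ofLinShift, grLin_sym]

theorem gr_hom_shift_ext {Y : GrMod (grDeg FA)} {σ : G × ℤ} {f f' : FN.gr ⟶ Y.shift σ}
    (h : ∀ i x, GrMod.linShift f (FN.sym i x) = GrMod.linShift f' (FN.sym i x)) : f = f' :=
  GrMod.hom_shift_ext (gr_linear_ext h)

variable (FN FM) in
/-- The passage from filtered maps to maps of associated graded modules. -/
def grHom (ξ : G) (p : ℤ) : filtHom FN FM ξ p →ₗ[k] (FN.gr ⟶ FM.gr.shift (ξ, p)) where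
  toFun f := grHomAux f.2
  map_add' f g := gr_hom_shift_ext fun i x => by
    rw [GrMod.linShift_add, LinearMap.add_apply, grHomAux_sym, grHomAux_sym, grHomAux_sym,
      ← map_add]
    rfl
  map_smul' c f := gr_hom_shift_ext fun i x => by
    rw [RingHom.id_apply, GrMod.linShift_smul, LinearMap.smul_apply, grHomAux_sym, grHomAux_sym,
      ← map_smul]
    rfl

theorem grHom_sym {ξ : G} {p : ℤ} (f : filtHom FN FM ξ p) (i : G × ℤ)
    (x : filtPiece FN.layer N.deg i) : GrMod.linShift (grHom FN FM ξ p f) (FN.sym i x) =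
      FM.sym (i + (ξ, p)) ⟨_, filtHom_apply_mem f.2 i x x.2⟩ :=
  grHomAux_sym f.2 i x

/-- This embeds the `p`-th graded piece of the filtered Hom space into `Hom(gr N, gr M[(ξ, p)])`. If
all symbols are sent to zero, homogeneous elements of `F_n N` go to `F_{n+p-1} M`; as the layers are
homogeneous, so does every element of `F_n N`. -/
theorem grHom_eq_zero_iff {ξ : G} {p : ℤ} (f : filtHom FN FM ξ p) :
    grHom FN FM ξ p f = 0 ↔ f.1 ∈ filtHom FN FM ξ (p - 1) := by
  constructor
  · intro h n x hx
    refine GrMod.mem_of_components ((FM.layer (n + (p - 1))).comap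
      ((GrMod.linShift f.1).restrictScalars k)) x fun ζ => ?_
    have h1 := grHom_sym f (ζ, n) ⟨_, FN.decompose_mem_filtPiece hx ζ⟩
    rw [h] at h1
    have h2 := sym_eq_zero_iff.1 h1.symm
    rwa [show ((ζ, n) + (ξ, p)).2 - 1 = n + (p - 1) by simp; ring] at h2
  · intro h
    refine gr_hom_shift_ext fun i x => ?_
    refine (grHom_sym f i x).trans (sym_eq_zero_iff.2 ?_)
    have := h i.2 x x.2.1
    rwa [show i.2 + (p - 1) = (i + (ξ, p)).2 - 1 by simp; ring] at this

theorem grHom_comp {ξ : G} {p : ℤ} {u : L ⟶ N} (hu : IsFilteredHom FL FN u)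
    (f : filtHom FN FM ξ p) :
    grHom FL FM ξ p ⟨u ≫ f.1, comp_mem_filtHom hu f.2⟩ = grMap hu ≫ grHom FN FM ξ p f :=
  gr_hom_shift_ext fun i x => by
    rw [GrMod.linShift_comp, LinearMap.comp_apply, grMap_sym, grHom_sym, grHom_sym]
    rfl

end ModFiltration

end Symbols

/-! ### Strict exactness -/

section Filtered

variable {k A : Type u} {G : Type} [Field k] [Ring A] [Algebra k A] [AddCommGroup G]
  [DecidableEq G] {𝒜 : G → Submodule k A} [GradedAlgebra 𝒜] {FA : AlgFiltration 𝒜}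

namespace ModFiltration

/-- The filtration of the kernel of a morphism. -/
def kerFiltration {N M : GrMod 𝒜} (FN : ModFiltration FA N) (f : N ⟶ M) :
    ModFiltration FA (N.sub _ (GrMod.ker_homogeneous f)) :=
  letI layer : ℤ → Submodule k (N.sub _ (GrMod.ker_homogeneous f)) := fun n =>
    (FN.layer n).comap ((LinearMap.ker (GrMod.lin f)).subtype.restrictScalars k)
  { layer := layer
    isFiltration :=
      { mono := fun _ _ h => Submodule.comap_mono (FN.layer_mono h)
        is_le := fun {i j} h => Submodule.comap_mono (FN.layer_mono (Int.le_sub_one_of_lt h))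
        is_sup := fun B j h => h _ (sub_one_lt j)
        smul_mem := fun {i j a x} ha hx => FN.smul_mem_layer ha hx }
    homogeneous := fun n ζ x hx => by
      have h := GrMod.lin_decompose (N.subι _ (GrMod.ker_homogeneous f)) x ζ
      change GrMod.lin (N.subι _ (GrMod.ker_homogeneous f)) _ ∈ FN.layer n
      rw [← h]
      exact FN.homogeneous n ζ hx }

variable {N M L : GrMod 𝒜} {FN : ModFiltration FA N} {FM : ModFiltration FA M}

theorem subι_isFilteredHom (f : N ⟶ M) :
    IsFilteredHom (FN.kerFiltration f) FN (N.subι _ (GrMod.ker_homogeneous f)) :=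
  fun _ _ hx => hx

/-- A filtered morphism that is surjective on associated graded modules is strictly surjective. -/
theorem exists_lift_of_gr_surjective {f : N ⟶ M} (hf : IsFilteredHom FN FM f)
    (hM : FM.IsDiscrete) (hgr : Function.Surjective (GrMod.lin (grMap hf))) (n : ℤ) (ζ : G) (y : M)
    (hy : y ∈ filtPiece FM.layer M.deg (ζ, n)) :
    ∃ x ∈ filtPiece FN.layer N.deg (ζ, n), GrMod.lin f x = y := by
  obtain ⟨n₀, hn₀⟩ := hM
  -- Successive approximation: a preimage of the symbol of `y` leaves an error one layer lower.
  -- Discreteness ends the process at layer `n₀ - 1`, which is zero; `m` counts the layers above it.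
  have key : ∀ (m : ℕ) (y : M), y ∈ filtPiece FM.layer M.deg (ζ, n₀ - 1 + m) →
      ∃ x ∈ filtPiece FN.layer N.deg (ζ, n₀ - 1 + m), GrMod.lin f x = y := by
    intro m
    induction m with
    | zero =>
      intro y hy
      have h0 : y = 0 := by
        exact (Submodule.mem_bot k).1 ((hn₀ _ (by simp)).le hy.1)
      exact ⟨0, zero_mem _, by rw [map_zero, h0]⟩
    | succ m ih =>
      intro y hy
      obtain ⟨z, hz, hzy⟩ := GrMod.exists_homogeneous_preimage (grMap hf)
        (FM.sym_mem (ζ, n₀ - 1 + (m + 1 : ℕ)) ⟨y, hy⟩) (hgr _)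
      obtain ⟨x, rfl⟩ := exists_sym hz
      rw [grMap_sym, ← sub_eq_zero, ← map_sub, sym_eq_zero_iff] at hzy
      have h1 : GrMod.lin f x - y ∈ filtPiece FM.layer M.deg (ζ, n₀ - 1 + m) :=
        ⟨FM.layer_mono (by push_cast; lia) hzy, sub_mem (GrMod.lin_mem f x.2.2) hy.2⟩
      obtain ⟨x', hx', e⟩ := ih _ h1
      refine ⟨x - x', sub_mem x.2 ⟨FN.layer_mono (by push_cast; lia) hx'.1, hx'.2⟩, ?_⟩
      rw [map_sub, e, sub_sub_cancel]
  rcases lt_or_ge n n₀ with h | h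
  · have h0 : y = 0 := by
      exact (Submodule.mem_bot k).1 ((hn₀ _ h).le hy.1)
    exact ⟨0, zero_mem _, by rw [map_zero, h0]⟩
  · have := key (n - n₀ + 1).toNat y
    rw [show n₀ - 1 + ((n - n₀ + 1).toNat : ℤ) = n by lia] at this
    exact this hy

theorem surjective_of_gr_surjective {f : N ⟶ M} (hf : IsFilteredHom FN FM f)
    (hM : FM.IsDiscrete) (hM' : FM.IsExhaustive)
    (hgr : Function.Surjective (GrMod.lin (grMap hf))) : Function.Surjective (GrMod.lin f) := by
  refine GrMod.surjective_of_homogeneous f fun i y hy => ?_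
  obtain ⟨n, hn⟩ := hM' y
  obtain ⟨x, -, e⟩ := exists_lift_of_gr_surjective hf hM hgr n i y ⟨hn, hy⟩
  exact ⟨x, e⟩

/-- The kernel carries the induced filtration, so an element lies in a lower layer of the kernel as
soon as it does in `N`. -/
theorem gr_subι_injective (f : N ⟶ M) :
    Function.Injective (GrMod.lin (grMap (subι_isFilteredHom (FN := FN) f))) := by
  refine GrMod.injective_of_homogeneous _ fun i y hy h => ?_
  obtain ⟨x, rfl⟩ := exists_sym hy
  rw [grMap_sym, sym_eq_zero_iff] at h
  exact sym_eq_zero_iff.2 h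

theorem gr_subι_comp {f : N ⟶ M} (hf : IsFilteredHom FN FM f) :
    grMap (subι_isFilteredHom (FN := FN) f) ≫ grMap hf = 0 := by
  refine gr_hom_ext fun i x => ?_
  rw [GrMod.lin_comp, LinearMap.comp_apply, grMap_sym, grMap_sym, GrMod.lin_zero,
    LinearMap.zero_apply, sym_eq_zero_iff]
  exact (congrArg (· ∈ FM.layer (i.2 - 1))
    (GrMod.lin_apply_of_comp_eq_zero (GrMod.subι_comp f) (x : N.sub _ _))).mpr (zero_mem _)

/-- If the symbol of `x ∈ F_n` is killed, then `f x` lies in `F_{n-1} M`, and by strictness `f x = f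
x'` with `x' ∈ F_{n-1} N`. So `x - x'` is an element of the kernel with the same symbol as `x`. -/
theorem gr_subι_exact {f : N ⟶ M} (hf : IsFilteredHom FN FM f)
    (hM : FM.IsDiscrete) (hgr : Function.Surjective (GrMod.lin (grMap hf))) (y : FN.gr)
    (hy : GrMod.lin (grMap hf) y = 0) :
    y ∈ LinearMap.range (GrMod.lin (grMap (subι_isFilteredHom (FN := FN) f))) := by
  refine GrMod.exact_of_homogeneous _ (grMap hf) (fun i y hy h => ?_) y hy
  obtain ⟨x, rfl⟩ := exists_sym hy
  rw [grMap_sym, sym_eq_zero_iff] at h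
  obtain ⟨x', hx', e⟩ := exists_lift_of_gr_surjective hf hM hgr (i.2 - 1) i.1 _
    ⟨h, GrMod.lin_mem f x.2.2⟩
  have hz : (x - x' : N) ∈ LinearMap.ker (GrMod.lin f) := by
    rw [LinearMap.mem_ker, map_sub, e, sub_self]
  have hzF : (x - x' : N) ∈ FN.layer i.2 :=
    sub_mem x.2.1 (FN.layer_mono (by lia) hx'.1)
  have hzD : (x - x' : N) ∈ N.deg i.1 := sub_mem x.2.2 hx'.2
  refine ⟨(FN.kerFiltration f).sym i ⟨⟨_, hz⟩, hzF, hzD⟩, ?_⟩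
  rw [grMap_sym, ← sub_eq_zero, ← map_sub, sym_eq_zero_iff]
  change (x - x' - x : N) ∈ _
  rw [sub_sub_cancel_left]
  exact neg_mem hx'.1

end ModFiltration

/-! ### Filtered free modules -/

theorem AlgFiltration.layer_mono (FA : AlgFiltration 𝒜) : Monotone FA.layer :=
  FA.isFiltration.mono

section FilteredFree

variable (FA) {m : ℕ} (g : Fin m → G × ℤ)

/-- The free graded module with generators in the given bidegrees. -/
abbrev filteredFree : GrMod 𝒜 := GrMod.free 𝒜 fun j => (g j).1

/-- The filtration of the free graded module with generators in the given bidegrees. -/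
def freeFiltration : ModFiltration FA (filteredFree (𝒜 := 𝒜) g) :=
  letI layer : ℤ → Submodule k (Fin m → A) := fun n =>
    Submodule.pi Set.univ fun j => FA.layer (n - (g j).2)
  haveI mono : Monotone layer := fun _ _ h _ hx j hj =>
    FA.layer_mono (sub_le_sub_right h _) (hx j hj)
  { layer := layer
    isFiltration :=
      { mono := mono
        is_le := fun {i j} h => mono (Int.le_sub_one_of_lt h)
        is_sup := fun B j h => h _ (sub_one_lt j)
        smul_mem := fun {i j a x} ha hx l _ => by
          change a * x l ∈ FA.layer (i + j - (g l).2)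
          rw [add_sub_assoc]
          exact FA.isFiltration.toGradedMonoid.mul_mem ha (hx l trivial) }
    homogeneous := fun n ζ x hx j _ => by
      let c : filteredFree (𝒜 := 𝒜) g → A := fun x => (x : Fin m → A) j
      -- Taking a coordinate commutes with taking homogeneous components, up to the degree of the
      -- generator.
      have key : ∀ y : filteredFree (𝒜 := 𝒜) g,
          c (DirectSum.decompose (filteredFree (𝒜 := 𝒜) g).deg y ζ : filteredFree (𝒜 := 𝒜) g) =
            DirectSum.decompose 𝒜 (c y) (ζ - (g j).1) := by
        intro y
        induction y using DirectSum.Decomposition.inductionOn (filteredFree (𝒜 := 𝒜) g).deg with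
        | zero =>
          change _ = (DirectSum.decompose 𝒜 (0 : A) _ : A)
          rw [DirectSum.decompose_zero, DirectSum.decompose_zero]
          rfl
        | @homogeneous i y =>
          have hy : c y.1 ∈ 𝒜 (i - (g j).1) := y.2 j trivial
          by_cases h : i = ζ
          · subst h
            rw [DirectSum.decompose_of_mem_same _ y.2, DirectSum.decompose_of_mem_same _ hy]
          · rw [DirectSum.decompose_of_mem_ne _ y.2 h, DirectSum.decompose_of_mem_ne _ hy
              fun e => h (sub_left_injective e)]
            rfl
        | add y y' h h' =>
          change _ = (DirectSum.decompose 𝒜 (c y + c y') _ : A)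
          rw [DirectSum.decompose_add, DirectSum.decompose_add, DirectSum.add_apply,
            DirectSum.add_apply, AddMemClass.coe_add, AddMemClass.coe_add, ← h, ← h']
          rfl
      exact (congrArg (· ∈ FA.layer (n - (g j).2)) (key x)).mpr (FA.homogeneous _ _ (hx j trivial)) }

variable {FA g}

theorem mem_freeFiltration {n : ℤ} {x : Fin m → A} :
    x ∈ (freeFiltration FA g).layer n ↔ ∀ j, x j ∈ FA.layer (n - (g j).2) :=
  ⟨fun h j => h j trivial, fun h j _ => h j⟩

theorem freeGen_mem_filtPiece (j : Fin m) : GrMod.freeGen 𝒜 (fun j => (g j).1) j ∈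
    filtPiece (freeFiltration FA g).layer (filteredFree (𝒜 := 𝒜) g).deg (g j) := by
  refine ⟨mem_freeFiltration.2 fun l => ?_, GrMod.freeGen_mem (g := fun j => (g j).1) j⟩
  by_cases h : l = j
  · subst h
    rw [sub_self, GrMod.freeGen, Pi.single_eq_same]
    exact FA.isFiltration.toGradedMonoid.one_mem
  · rw [GrMod.freeGen, Pi.single_eq_of_ne h]
    exact zero_mem _

theorem freeFiltration_isDiscrete (hFA : FA.IsConnected) : (freeFiltration FA g).IsDiscrete := by
  obtain ⟨s, hs⟩ := (Set.finite_range fun j => (g j).2).bddBelow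
  refine ⟨s, fun n hn => (Submodule.eq_bot_iff _).2 fun x hx => funext fun j => ?_⟩
  have h := mem_freeFiltration.1 hx j
  have hj : s ≤ (g j).2 := hs ⟨j, rfl⟩
  rwa [hFA.neg _ (by lia), Submodule.mem_bot] at h

theorem freeFiltration_isExhaustive (hFA : FA.IsConnected) :
    (freeFiltration FA g).IsExhaustive := by
  intro x
  choose n hn using fun j => hFA.exhaustive ((x : Fin m → A) j)
  obtain ⟨t, ht⟩ := (Set.finite_range fun j => n j + (g j).2).bddAbove
  refine ⟨t, mem_freeFiltration.2 fun j => FA.layer_mono ?_ (hn j)⟩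
  have : n j + (g j).2 ≤ t := ht ⟨j, rfl⟩
  lia

variable (FA g) in
/-- The comparison morphism from the free module over `gr A` to `gr` of the free module. -/
def freeToGr : GrMod.free (grDeg FA) g ⟶ (freeFiltration FA g).gr :=
  GrMod.freeLift (fun j => (freeFiltration FA g).sym (g j) ⟨_, freeGen_mem_filtPiece j⟩)
    fun _ => (freeFiltration FA g).sym_mem _ _

theorem mem_filtPiece_free {i : G × ℤ} {x : Fin m → A}
    (hx : x ∈ filtPiece (freeFiltration FA g).layer (filteredFree (𝒜 := 𝒜) g).deg i) (j : Fin m) :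
    x j ∈ filtPiece FA.layer 𝒜 (i - g j) :=
  ⟨mem_freeFiltration.1 hx.1 j, GrMod.mem_free_deg.1 hx.2 j⟩

/-- The vector of symbols of the coordinates, taken in the bidegrees `i - g j`, goes to the symbol
of the vector. Bijectivity of the comparison is read off from this formula. -/
theorem freeToGr_apply {i : G × ℤ} {x : Fin m → A}
    (hx : x ∈ filtPiece (freeFiltration FA g).layer (filteredFree (𝒜 := 𝒜) g).deg i) :
    GrMod.lin (freeToGr FA g) (fun j => FA.sym (i - g j) ⟨x j, mem_filtPiece_free hx j⟩) =
      (freeFiltration FA g).sym i ⟨x, hx⟩ := by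
  have hsmul : ∀ j, x j • GrMod.freeGen 𝒜 (fun j => (g j).1) j ∈
      filtPiece (freeFiltration FA g).layer (filteredFree (𝒜 := 𝒜) g).deg i := fun j => by
    have h1 := mem_filtPiece_free hx j
    have h2 := freeGen_mem_filtPiece (FA := FA) (g := g) j
    exact (congrArg (fun l => x j • GrMod.freeGen 𝒜 (fun j => (g j).1) j ∈
      filtPiece (freeFiltration FA g).layer (filteredFree (𝒜 := 𝒜) g).deg l)
      (sub_add_cancel i (g j))).mp (filtPieceSMul FA (freeFiltration FA g).layer
        (filteredFree (𝒜 := 𝒜) g).deg (i - g j) (g j) ⟨_, h1⟩ ⟨_, h2⟩).2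
  refine (GrMod.freeLift_apply _ _ _).trans ?_
  have h : (⟨x, hx⟩ : filtPiece (freeFiltration FA g).layer (filteredFree (𝒜 := 𝒜) g).deg i) =
      ∑ j, ⟨_, hsmul j⟩ := by
    refine Subtype.ext ?_
    rw [AddSubmonoidClass.coe_finsetSum]
    exact GrMod.eq_sum_freeGen x
  rw [h, map_sum]
  exact Finset.sum_congr rfl fun j _ => ModFiltration.sym_smul_sym_eq (sub_add_cancel _ _) rfl

theorem exists_free_sym {i : G × ℤ} {y : Fin m → GrAlg FA}
    (hy : y ∈ (GrMod.free (grDeg FA) g).deg i) :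
    ∃ x, ∃ hx : x ∈ filtPiece (freeFiltration FA g).layer (filteredFree (𝒜 := 𝒜) g).deg i,
      y = fun j => FA.sym (i - g j) ⟨x j, mem_filtPiece_free hx j⟩ := by
  choose a ha using fun j => FA.exists_sym (GrMod.mem_free_deg.1 hy j)
  exact ⟨fun j => a j, ⟨mem_freeFiltration.2 fun j => (a j).2.1,
    GrMod.mem_free_deg.2 fun j => (a j).2.2⟩, funext fun j => (ha j).symm⟩

/-- Homogeneous elements on the left are vectors of symbols. The symbol of a vector vanishes exactly
when every coordinate drops by one layer, that is, when every coordinate symbol vanishes. -/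
theorem freeToGr_bijective : Function.Bijective (GrMod.lin (freeToGr FA g)) := by
  constructor
  · refine GrMod.injective_of_homogeneous _ fun i y hy h => ?_
    obtain ⟨x, hx, rfl⟩ := exists_free_sym hy
    replace h := ModFiltration.sym_eq_zero_iff.1 ((freeToGr_apply hx).symm.trans h)
    funext j
    refine FA.sym_eq_zero_iff.2 ?_
    have := mem_freeFiltration.1 h j
    rwa [show i.2 - 1 - (g j).2 = (i - g j).2 - 1 by simp; ring] at this
  · refine GrMod.surjective_of_homogeneous _ fun i y hy => ?_
    obtain ⟨x, rfl⟩ := ModFiltration.exists_sym hy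
    exact ⟨_, freeToGr_apply x.2⟩

instance : IsIso (freeToGr FA g) := GrMod.isIso_of_bijective _ freeToGr_bijective

instance : Projective (freeFiltration FA g).gr :=
  Projective.of_iso (asIso (freeToGr FA g)) inferInstance

theorem gr_free_finite : Module.Finite (GrAlg FA) (freeFiltration FA g).gr := by
  have : Module.Finite (GrAlg FA) (GrMod.free (grDeg FA) g) :=
    inferInstanceAs (Module.Finite (GrAlg FA) (Fin m → GrAlg FA))
  exact Module.Finite.of_surjective (GrMod.lin (freeToGr FA g)) freeToGr_bijective.2

variable {M : GrMod 𝒜} {FM : ModFiltration FA M}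

theorem freeLift_isFilteredHom (x : Fin m → M)
    (hx : ∀ j, x j ∈ filtPiece FM.layer M.deg (g j)) :
    ModFiltration.IsFilteredHom (freeFiltration FA g) FM
      (GrMod.freeLift (g := fun j => (g j).1) x fun j => (hx j).2) := by
  intro n y hy
  refine (congrArg (· ∈ FM.layer n) (GrMod.freeLift_apply _ _ y)).mpr ?_
  refine Submodule.sum_mem _ fun j _ => ?_
  have := FM.smul_mem_layer (mem_freeFiltration.1 hy j) (hx j).1
  rwa [sub_add_cancel] at this

/-- The layers of a filtered free module are spanned by multiples `a • e_j` whose filtration degrees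
add up, so the generators control how far a map raises the filtration. With finitely many generators
this makes the filtered Hom space exhaustive and bounded below. -/
theorem mem_filtHom_free_iff {ξ : G} {p : ℤ} {f : filteredFree (𝒜 := 𝒜) g ⟶ M.shift ξ} :
    f ∈ ModFiltration.filtHom (freeFiltration FA g) FM ξ p ↔
      ∀ j, GrMod.linShift f (GrMod.freeGen 𝒜 (fun j => (g j).1) j) ∈ FM.layer ((g j).2 + p) := by
  constructor
  · exact fun hf j => hf _ _ (freeGen_mem_filtPiece j).1
  · intro h n y hy
    refine (congrArg (· ∈ FM.layer (n + p)) (GrMod.lin_free_apply f y)).mpr ?_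
    refine Submodule.sum_mem _ fun j _ => ?_
    have := FM.smul_mem_layer (mem_freeFiltration.1 hy j) (h j)
    rwa [show n - (g j).2 + ((g j).2 + p) = n + p by ring] at this

/-- Morphisms out of `gr` of a filtered free module lift to filtered morphisms. -/
theorem grHom_free_surjective (ξ : G) (p : ℤ) : Function.Surjective
    (ModFiltration.grHom (freeFiltration FA g) FM ξ p) := by
  intro φ
  -- Each generator is sent to a representative of the symbol that its own symbol is mapped to.
  choose x hx using fun j => ModFiltration.exists_sym (GrMod.linShift_mem φ
    ((freeFiltration FA g).sym_mem (g j) ⟨_, freeGen_mem_filtPiece j⟩))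
  let f : filteredFree (𝒜 := 𝒜) g ⟶ M.shift ξ :=
    GrMod.freeLift (M := M.shift ξ) (fun j => (x j : M)) fun j => (x j).2.2
  have hgen : ∀ j, GrMod.linShift f (GrMod.freeGen 𝒜 (fun j => (g j).1) j) = x j :=
    GrMod.freeLift_gen (M := M.shift ξ) _ _
  have hf : f ∈ ModFiltration.filtHom (freeFiltration FA g) FM ξ p :=
    mem_filtHom_free_iff.2 fun j => (hgen j).symm ▸ (x j).2.1
  refine ⟨⟨f, hf⟩, (cancel_epi (freeToGr FA g)).1 (GrMod.free_hom_ext fun j => ?_)⟩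
  rw [GrMod.lin_comp, GrMod.lin_comp, LinearMap.comp_apply, LinearMap.comp_apply, freeToGr,
    GrMod.freeLift_gen]
  refine (ModFiltration.grHom_sym ⟨f, hf⟩ _ _).trans (Eq.trans ?_ (hx j))
  exact ModFiltration.sym_congr rfl (hgen j)

theorem filtHom_free_exhaustive (hFM : FM.IsExhaustive) {ξ : G}
    (f : filteredFree (𝒜 := 𝒜) g ⟶ M.shift ξ) :
    ∃ p, f ∈ ModFiltration.filtHom (freeFiltration FA g) FM ξ p := by
  choose n hn using fun j => hFM (GrMod.linShift f (GrMod.freeGen 𝒜 (fun j => (g j).1) j))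
  obtain ⟨t, ht⟩ := (Set.finite_range fun j => n j - (g j).2).bddAbove
  refine ⟨t, mem_filtHom_free_iff.2 fun j => FM.layer_mono ?_ (hn j)⟩
  have : n j - (g j).2 ≤ t := ht ⟨j, rfl⟩
  lia

theorem filtHom_free_bounded (hFM : FM.IsDiscrete) (ξ : G) :
    ∃ p, ModFiltration.filtHom (freeFiltration FA g) FM ξ p = ⊥ := by
  obtain ⟨n₀, hn₀⟩ := hFM
  obtain ⟨t, ht⟩ := (Set.finite_range fun j => (g j).2).bddAbove
  -- For this `p`, every generator goes to a layer of index at most `n₀ - 1`, hence to zero.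
  refine ⟨n₀ - 1 - t, (Submodule.eq_bot_iff _).2 fun f hf => GrMod.free_hom_ext fun j => ?_⟩
  have h := mem_filtHom_free_iff.1 hf j
  have hj : (g j).2 ≤ t := ht ⟨j, rfl⟩
  rw [hn₀ _ (by lia), Submodule.mem_bot] at h
  exact h

theorem hom_free_finite {ξ : G} (hM : ∀ ζ, FiniteDimensional k (M.deg ζ)) :
    FiniteDimensional k (filteredFree (𝒜 := 𝒜) g ⟶ M.shift ξ) := by
  let Φ : (filteredFree (𝒜 := 𝒜) g ⟶ M.shift ξ) →ₗ[k] (∀ j, M.deg ((g j).1 + ξ)) :=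
    { toFun := fun f j => ⟨GrMod.linShift f (GrMod.freeGen 𝒜 (fun j => (g j).1) j),
        GrMod.linShift_mem f (GrMod.freeGen_mem (g := fun j => (g j).1) j)⟩
      map_add' := fun _ _ => rfl
      map_smul' := fun _ _ => rfl }
  exact FiniteDimensional.of_injective Φ fun f f' h => GrMod.free_hom_ext fun j =>
    congrArg Subtype.val (congrFun h j)

end FilteredFree

end Filtered

/-! ### Filtered free resolutions -/

section FilteredResolution

variable {k A : Type u} {G : Type} [Field k] [Ring A] [Algebra k A] [AddCommGroup G]
  [DecidableEq G] {𝒜 : G → Submodule k A} [GradedAlgebra 𝒜] {FA : AlgFiltration 𝒜}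

theorem ModFiltration.gr_surjective_of_strict {N M : GrMod 𝒜} {FN : ModFiltration FA N}
    {FM : ModFiltration FA M} {f : N ⟶ M} (hf : IsFilteredHom FN FM f)
    (h : ∀ n, ∀ y ∈ FM.layer n, ∃ x ∈ FN.layer n, GrMod.lin f x = y) :
    Function.Surjective (GrMod.lin (grMap hf)) := by
  refine GrMod.surjective_of_homogeneous _ fun i y hy => ?_
  obtain ⟨y, rfl⟩ := exists_sym hy
  obtain ⟨x, hx, e⟩ := h i.2 y y.2.1
  refine ⟨FN.sym i ⟨_, FN.decompose_mem_filtPiece hx i.1⟩, ?_⟩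
  rw [grMap_sym]
  refine sym_congr rfl ?_
  dsimp only
  rw [← GrMod.lin_decompose, e, DirectSum.decompose_of_mem_same _ y.2.2]

theorem ModFiltration.IsStandard.isDiscrete {N : GrMod 𝒜} {FN : ModFiltration FA N}
    (hFA : FA.IsConnected) (h : FN.IsStandard) : FN.IsDiscrete := by
  obtain ⟨V, -, -, -, hV⟩ := h
  refine ⟨0, fun n hn => ?_⟩
  rw [hV, Submodule.span_eq_bot]
  rintro _ ⟨a, ha, v, -, rfl⟩
  rw [hFA.neg n hn, Submodule.mem_bot] at ha
  rw [ha, zero_smul]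

theorem ModFiltration.IsStandard.isExhaustive {N : GrMod 𝒜} {FN : ModFiltration FA N}
    (hFA : FA.IsConnected) (h : FN.IsStandard) : FN.IsExhaustive := by
  obtain ⟨V, -, -, hspan, hV⟩ := h
  intro x
  have hx : x ∈ Submodule.span A (V : Set N) := hspan ▸ trivial
  induction hx using Submodule.span_induction with
  | mem x hx =>
    refine ⟨0, ?_⟩
    rw [hV]
    exact Submodule.subset_span ⟨1, FA.isFiltration.toGradedMonoid.one_mem, x, hx,
      (one_smul A x).symm⟩
  | zero => exact ⟨0, zero_mem _⟩
  | add x y _ _ hx hy =>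
    obtain ⟨m, hm⟩ := hx
    obtain ⟨n, hn⟩ := hy
    exact ⟨max m n, add_mem (FN.layer_mono (le_max_left m n) hm)
      (FN.layer_mono (le_max_right m n) hn)⟩
  | smul a x _ hx =>
    obtain ⟨m, hm⟩ := hFA.exhaustive a
    obtain ⟨n, hn⟩ := hx
    exact ⟨m + n, FN.smul_mem_layer hm hn⟩

/-- The standard filtration is the image of that of a free module on homogeneous generators of `V`
over `k`, all placed in filtration degree `0`. So `gr N` is a quotient of a finitely generated
module. -/
theorem ModFiltration.IsStandard.gr_finite {N : GrMod 𝒜} {FN : ModFiltration FA N}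
    (h : FN.IsStandard) : Module.Finite (GrAlg FA) FN.gr := by
  obtain ⟨V, hVhom, hVfin, -, hV⟩ := h
  obtain ⟨m, g, v, hv, hspan⟩ := GrMod.exists_homogeneous_generators_of_fg hVhom
    ((Submodule.fg_iff_finiteDimensional V).2 hVfin)
  let g' : Fin m → G × ℤ := fun j => (g j, 0)
  have hvV : ∀ j, v j ∈ V := fun j => hspan ▸ Submodule.subset_span ⟨j, rfl⟩
  have hv' : ∀ j, v j ∈ filtPiece FN.layer N.deg (g' j) := fun j => by
    refine ⟨?_, hv j⟩
    rw [hV]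
    exact Submodule.subset_span ⟨1, FA.isFiltration.toGradedMonoid.one_mem, v j, hvV j,
      (one_smul A _).symm⟩
  have hf := freeLift_isFilteredHom (FA := FA) (g := g') v hv'
  have := gr_free_finite (FA := FA) (g := g')
  refine Module.Finite.of_surjective (GrMod.lin (ModFiltration.grMap hf))
    (ModFiltration.gr_surjective_of_strict hf fun n y hy => ?_)
  let L : Submodule k N := ((freeFiltration FA g').layer n).map
    ((GrMod.lin (GrMod.freeLift (g := fun j => (g' j).1) v fun j => (hv' j).2)).restrictScalars k)
  suffices hL : FN.layer n ≤ L from hL hy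
  rw [hV, Submodule.span_le]
  rintro _ ⟨a, ha, w, hw, rfl⟩
  rw [← hspan] at hw
  induction hw using Submodule.span_induction with
  | mem w hw =>
    obtain ⟨j, rfl⟩ := hw
    refine ⟨(Pi.single j a : Fin m → A), mem_freeFiltration.2 fun l => ?_,
      (GrMod.freeLift_apply (g := fun j => (g' j).1) v (fun j => (hv' j).2)
        (Pi.single j a)).trans ?_⟩
    · have e : n - (g' l).2 = n := sub_zero n
      rw [e]
      by_cases h : l = j
      · subst h
        rwa [Pi.single_eq_same]
      · rw [Pi.single_eq_of_ne h]
        exact zero_mem _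
    · rw [Finset.sum_eq_single j]
      · rw [Pi.single_eq_same]
      · intro l _ h
        rw [Pi.single_eq_of_ne h, zero_smul]
      · simp
  | zero =>
    rw [smul_zero]
    exact zero_mem L
  | add x y _ _ hx hy =>
    rw [smul_add]
    exact add_mem (S := Submodule k N) hx hy
  | smul c x _ hx =>
    rw [smul_comm]
    exact Submodule.smul_mem L c hx

variable (FA) in
/-- A graded module with a discrete exhaustive filtration and a finitely generated associated
graded module. -/
structure FilteredModule where
  obj : GrMod 𝒜
  filt : ModFiltration FA obj
  discrete : filt.IsDiscrete
  exhaustive : filt.IsExhaustive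
  finite : Module.Finite (GrAlg FA) filt.gr

/-- A graded module with a standard filtration. -/
def ModFiltration.IsStandard.filteredModule {N : GrMod 𝒜} {FN : ModFiltration FA N}
    (h : FN.IsStandard) (hFA : FA.IsConnected) : FilteredModule FA where
  obj := N
  filt := FN
  discrete := h.isDiscrete hFA
  exhaustive := h.isExhaustive hFA
  finite := h.gr_finite

namespace FilteredModule

variable (X : FilteredModule FA)

/-- The generators are chosen in `gr X` and lifted to elements of `X`, which makes the cover
surjective on `gr` and not merely on `X`. -/
theorem exists_cover : ∃ (m : ℕ) (g : Fin m → G × ℤ) (π : filteredFree (𝒜 := 𝒜) g ⟶ X.obj)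
    (hπ : ModFiltration.IsFilteredHom (freeFiltration FA g) X.filt π),
    Function.Surjective (GrMod.lin (ModFiltration.grMap hπ)) := by
  have := X.finite
  obtain ⟨m, g, y, hy, hspan⟩ := X.filt.gr.exists_homogeneous_generators
  choose x hx using fun j => ModFiltration.exists_sym (hy j)
  have hf := freeLift_isFilteredHom (FA := FA) (g := g) (fun j => (x j : X.obj)) fun j => (x j).2
  refine ⟨m, g, _, hf, ?_⟩
  rw [← LinearMap.range_eq_top, eq_top_iff, ← hspan, Submodule.span_le]
  rintro _ ⟨j, rfl⟩
  refine ⟨(freeFiltration FA g).sym (g j) ⟨_, freeGen_mem_filtPiece j⟩, ?_⟩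
  rw [ModFiltration.grMap_sym, ← hx j]
  exact ModFiltration.sym_congr rfl (GrMod.freeLift_gen _ _ j)

/-- The number of generators of the chosen filtered free cover. -/
def coverRank : ℕ := X.exists_cover.choose

/-- The bidegrees of the generators of the chosen filtered free cover. -/
def coverDeg : Fin X.coverRank → G × ℤ := X.exists_cover.choose_spec.choose

/-- The chosen filtered free cover. -/
def cover : filteredFree (𝒜 := 𝒜) X.coverDeg ⟶ X.obj :=
  X.exists_cover.choose_spec.choose_spec.choose

theorem cover_isFilteredHom :
    ModFiltration.IsFilteredHom (freeFiltration FA X.coverDeg) X.filt X.cover :=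
  X.exists_cover.choose_spec.choose_spec.choose_spec.choose

theorem gr_cover_surjective :
    Function.Surjective (GrMod.lin (ModFiltration.grMap X.cover_isFilteredHom)) :=
  X.exists_cover.choose_spec.choose_spec.choose_spec.choose_spec

theorem cover_surjective : Function.Surjective (GrMod.lin X.cover) :=
  ModFiltration.surjective_of_gr_surjective X.cover_isFilteredHom X.discrete X.exhaustive
    X.gr_cover_surjective

variable (hFA : FA.IsConnected) [IsNoetherianRing (GrAlg FA)]

/-- The kernel of the chosen filtered free cover. -/
def syzygy : FilteredModule FA where
  obj := _
  filt := (freeFiltration FA X.coverDeg).kerFiltration X.cover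
  discrete := by
    obtain ⟨n₀, hn₀⟩ := freeFiltration_isDiscrete (g := X.coverDeg) hFA
    exact ⟨n₀, fun n hn => (Submodule.eq_bot_iff _).2 fun x hx => Subtype.ext
      ((Submodule.mem_bot k).1 ((hn₀ n hn).le hx))⟩
  exhaustive x := freeFiltration_isExhaustive hFA x.1
  finite := by
    -- `gr` of the kernel embeds in `gr` of the free cover, a finitely generated module over the
    -- left noetherian ring `gr A`.
    have := gr_free_finite (FA := FA) (g := X.coverDeg)
    exact Module.Finite.of_injective _
      (ModFiltration.gr_subι_injective (FN := freeFiltration FA X.coverDeg) X.cover)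

/-- The iterated syzygies. -/
def iterSyzygy : ℕ → FilteredModule FA
  | 0 => X
  | i + 1 => (iterSyzygy i).syzygy hFA

/-- The resolution of a filtered module by filtered free modules. -/
def syzygySequence : SyzygySequence (GrMod 𝒜) where
  K i := (X.iterSyzygy hFA i).obj
  P i := filteredFree (𝒜 := 𝒜) (X.iterSyzygy hFA i).coverDeg
  ι i := GrMod.subι _ _ (GrMod.ker_homogeneous (X.iterSyzygy hFA i).cover)
  π i := (X.iterSyzygy hFA i).cover
  w _ := GrMod.subι_comp _
  shortExact i := GrMod.shortExact_of_exact _ _ _ Subtype.val_injective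
    (X.iterSyzygy hFA i).cover_surjective fun y hy => ⟨⟨y, hy⟩, rfl⟩
  projective _ := inferInstance

/-- The resolution of the associated graded module that is given by the filtered resolution. -/
def grSyzygySequence : SyzygySequence (GrMod (grDeg FA)) where
  K i := (X.iterSyzygy hFA i).filt.gr
  P i := (freeFiltration FA (X.iterSyzygy hFA i).coverDeg).gr
  ι i := ModFiltration.grMap (ModFiltration.subι_isFilteredHom
    (FN := freeFiltration FA (X.iterSyzygy hFA i).coverDeg) (X.iterSyzygy hFA i).cover)
  π i := ModFiltration.grMap (X.iterSyzygy hFA i).cover_isFilteredHom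
  w _ := ModFiltration.gr_subι_comp _
  shortExact i := GrMod.shortExact_of_exact _ _ _ (ModFiltration.gr_subι_injective _)
    (X.iterSyzygy hFA i).gr_cover_surjective
    (ModFiltration.gr_subι_exact _ (X.iterSyzygy hFA i).discrete
      (X.iterSyzygy hFA i).gr_cover_surjective)
  projective _ := inferInstance

end FilteredModule

end FilteredResolution

/-! ### The spectral sequence of a filtered module -/

section FilteredExt

variable {k A : Type u} {G : Type} [Field k] [Ring A] [Algebra k A] [AddCommGroup G]
  [DecidableEq G] {𝒜 : G → Submodule k A} [GradedAlgebra 𝒜] {FA : AlgFiltration 𝒜}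

/-- An exhaustive filtration of a finite dimensional space reaches the whole space. -/
theorem exists_eq_top_of_exhaustive {k H : Type*} [Field k] [AddCommGroup H] [Module k H]
    [FiniteDimensional k H] {F : ℤ → Submodule k H} (hmono : Monotone F)
    (hex : ∀ x, ∃ p, x ∈ F p) : ∃ p, F p = ⊤ := by
  choose n hn using fun i => hex (Module.finBasis k H i)
  obtain ⟨t, ht⟩ := (Set.finite_range n).bddAbove
  refine ⟨t, eq_top_iff.2 ?_⟩
  rw [← (Module.finBasis k H).span_eq, Submodule.span_le]
  rintro _ ⟨i, rfl⟩
  exact hmono (ht ⟨i, rfl⟩) (hn i)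

namespace FilteredModule

variable (X : FilteredModule FA) (hFA : FA.IsConnected) [IsNoetherianRing (GrAlg FA)]

/-- The filtration of a term of the resolution. -/
abbrev resFilt (i : ℕ) : ModFiltration FA ((X.syzygySequence hFA).P i) :=
  freeFiltration FA (X.iterSyzygy hFA i).coverDeg

theorem ι_isFilteredHom (i : ℕ) : ModFiltration.IsFilteredHom (X.iterSyzygy hFA (i + 1)).filt
    (X.resFilt hFA i) ((X.syzygySequence hFA).ι i) :=
  ModFiltration.subι_isFilteredHom _

theorem π_isFilteredHom (i : ℕ) : ModFiltration.IsFilteredHom (X.resFilt hFA i)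
    (X.iterSyzygy hFA i).filt ((X.syzygySequence hFA).π i) :=
  (X.iterSyzygy hFA i).cover_isFilteredHom

variable {M : GrMod 𝒜} {FM : ModFiltration FA M}

theorem homD_mem_filtHom {ξ : G} {p : ℤ} {i : ℕ} {f : (X.syzygySequence hFA).P i ⟶ M.shift ξ}
    (hf : f ∈ ModFiltration.filtHom (X.resFilt hFA i) FM ξ p) :
    (X.syzygySequence hFA).homD (M.shift ξ) k i f ∈
      ModFiltration.filtHom (X.resFilt hFA (i + 1)) FM ξ p := by
  rw [SyzygySequence.homD_apply]
  exact ModFiltration.comp_mem_filtHom (X.π_isFilteredHom hFA (i + 1))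
    (ModFiltration.comp_mem_filtHom (X.ι_isFilteredHom hFA i) hf)

variable (FM) in
/-- The passage from filtered maps out of the resolution to maps out of its associated graded
resolution. -/
def comparison (ξ : G) (p : ℤ) (i : ℕ) : ModFiltration.filtHom (X.resFilt hFA i) FM ξ p →ₗ[k]
    ((X.grSyzygySequence hFA).P i ⟶ FM.gr.shift (ξ, p)) :=
  ModFiltration.grHom (X.resFilt hFA i) FM ξ p

theorem comparison_surjective (ξ : G) (p : ℤ) (i : ℕ) :
    Function.Surjective (X.comparison hFA FM ξ p i) :=
  grHom_free_surjective ξ p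

theorem comparison_eq_zero_iff {ξ : G} {p : ℤ} {i : ℕ}
    {f : ModFiltration.filtHom (X.resFilt hFA i) FM ξ p} :
    X.comparison hFA FM ξ p i f = 0 ↔
      f.1 ∈ ModFiltration.filtHom (X.resFilt hFA i) FM ξ (p - 1) :=
  ModFiltration.grHom_eq_zero_iff f

/-- Passage to symbols respects composition with filtered morphisms, and the differential of the
resolution is a composite of two of them; so the comparison commutes with the differentials. -/
theorem comparison_homD {ξ : G} {p : ℤ} {i : ℕ}
    (f : ModFiltration.filtHom (X.resFilt hFA i) FM ξ p) :
    X.comparison hFA FM ξ p (i + 1) ⟨_, X.homD_mem_filtHom hFA f.2⟩ =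
      (X.grSyzygySequence hFA).homD (FM.gr.shift (ξ, p)) k i (X.comparison hFA FM ξ p i f) := by
  have h1 := ModFiltration.grHom_comp (X.ι_isFilteredHom hFA i) f
  have h2 := ModFiltration.grHom_comp (X.π_isFilteredHom hFA (i + 1))
    ⟨_, ModFiltration.comp_mem_filtHom (X.ι_isFilteredHom hFA i) f.2⟩
  refine Eq.trans ?_ ((h2.trans (congrArg (_ ≫ ·) h1)).trans
    (SyzygySequence.homD_apply (X.grSyzygySequence hFA) _ i (X.comparison hFA FM ξ p i f)).symm)
  exact congrArg (X.comparison hFA FM ξ p (i + 1))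
    (Subtype.ext (SyzygySequence.homD_apply _ _ _ _))

/-- The filtered complex of morphisms from the resolution. -/
def homSequence (hM : FM.IsDiscrete) (hM' : FM.IsExhaustive) (ξ : G) :
    FilteredSequence k fun i => ULift.{u + 1} ((X.syzygySequence hFA).P i ⟶ M.shift ξ) where
  -- Lifting puts the Hom spaces in the universe `u + 1` of the Ext spaces.
  d i := ULift.moduleEquiv.symm.toLinearMap ∘ₗ (X.syzygySequence hFA).homD (M.shift ξ) k i ∘ₗ
    ULift.moduleEquiv.toLinearMap
  dd i x := by
    have hw : (X.syzygySequence hFA).ι (i + 1) ≫ (X.syzygySequence hFA).π (i + 1) = 0 :=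
      (X.syzygySequence hFA).w (i + 1)
    refine ULift.ext _ _ ?_
    change (X.syzygySequence hFA).homD (M.shift ξ) k (i + 1)
      ((X.syzygySequence hFA).homD (M.shift ξ) k i x.down) = 0
    rw [SyzygySequence.homD_apply, SyzygySequence.homD_apply, reassoc_of% hw, zero_comp, comp_zero]
  filt i p := (ModFiltration.filtHom (X.resFilt hFA i) FM ξ p).comap ULift.moduleEquiv.toLinearMap
  mono _ _ _ h := Submodule.comap_mono (ModFiltration.filtHom_mono ξ h)
  d_filt _ _ _ hx := X.homD_mem_filtHom hFA hx
  exhaustive _ x := filtHom_free_exhaustive hM' x.down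
  bounded i := by
    obtain ⟨p, hp⟩ := filtHom_free_bounded (FA := FA) (g := (X.iterSyzygy hFA i).coverDeg) hM ξ
    exact ⟨p, (Submodule.eq_bot_iff _).2 fun x hx =>
      ULift.ext _ _ ((Submodule.mem_bot k).1 (hp.le hx))⟩

theorem exists_ext_presentation (ξ : G) (i : ℕ) :
    ∃ φ : LinearMap.ker ((X.syzygySequence hFA).homD (M.shift ξ) k i) →ₗ[k] GrExt i X.obj M ξ,
      Function.Surjective φ ∧ ∀ f, φ f = 0 ↔
        f.1 ∈ (X.syzygySequence hFA).homBoundaries (M.shift ξ) k i :=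
  haveI := HasExt.standard (GrMod 𝒜)
  (X.syzygySequence hFA).exists_ext_of_cocycles (M.shift ξ) i

theorem exists_gr_ext_presentation (FM : ModFiltration FA M) (ξ : G) (p : ℤ) (i : ℕ) :
    ∃ φ : LinearMap.ker ((X.grSyzygySequence hFA).homD (FM.gr.shift (ξ, p)) k i) →ₗ[k]
        GrExt i X.filt.gr FM.gr (ξ, p),
      Function.Surjective φ ∧ ∀ f, φ f = 0 ↔
        f.1 ∈ (X.grSyzygySequence hFA).homBoundaries (FM.gr.shift (ξ, p)) k i :=
  haveI := HasExt.standard (GrMod (grDeg FA))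
  (X.grSyzygySequence hFA).exists_ext_of_cocycles (FM.gr.shift (ξ, p)) i

include hFA in
-- Ext is a quotient of a space of cocycles, and a map out of a free module of finite rank is
-- determined by finitely many elements of components of `M`.
theorem finite_ext (hM : ∀ ζ, FiniteDimensional k (M.deg ζ)) (ξ : G) (n : ℤ) :
    FiniteDimensional k (GrExtInt n X.obj M ξ) := by
  cases n with
  | ofNat i =>
    obtain ⟨φ, hφ, -⟩ := X.exists_ext_presentation hFA (M := M) ξ i
    have : FiniteDimensional k ((X.syzygySequence hFA).P i ⟶ M.shift ξ) :=
      hom_free_finite (g := (X.iterSyzygy hFA i).coverDeg) hM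
    exact Module.Finite.of_surjective φ hφ
  | negSucc i => exact inferInstanceAs (FiniteDimensional k PUnit.{u + 2})

variable (hM : FM.IsDiscrete) (hM' : FM.IsExhaustive) (ξ : G)

theorem exists_isCohomology (n : ℤ) :
    ∃ ψ, (X.homSequence hFA hM hM' ξ).total.IsCohomology (H := GrExtInt n X.obj M ξ) n ψ := by
  cases n with
  | ofNat i =>
    obtain ⟨φ, hφ, hker⟩ := X.exists_ext_presentation hFA (M := M) ξ i
    let e : LinearMap.ker ((X.homSequence hFA hM hM' ξ).d i) →ₗ[k]
        LinearMap.ker ((X.syzygySequence hFA).homD (M.shift ξ) k i) :=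
      LinearMap.restrict ULift.moduleEquiv.toLinearMap fun x hx =>
        congrArg ULift.down (LinearMap.mem_ker.1 hx)
    refine (X.homSequence hFA hM hM' ξ).exists_isCohomology (n := i) (H := GrExt i X.obj M ξ)
      (φ ∘ₗ e) (fun y => ?_) fun x => ?_
    · obtain ⟨f, rfl⟩ := hφ y
      exact ⟨⟨ULift.up f.1, LinearMap.mem_ker.2 (ULift.ext _ _ f.2)⟩, rfl⟩
    · refine (hker _).trans ?_
      change x.1.down ∈ _ ↔ x.1 ∈ _
      cases i with
      | zero => exact ⟨fun h => ULift.ext _ _ h, fun h => congrArg ULift.down h⟩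
      | succ j =>
        constructor
        · rintro ⟨f, hf⟩
          exact ⟨ULift.up f, trivial, ULift.ext _ _ hf⟩
        · rintro ⟨f, -, hf⟩
          exact ⟨f.down, congrArg ULift.down hf⟩
  | negSucc i =>
    have : Subsingleton (GrExtInt (Int.negSucc i) X.obj M ξ) :=
      inferInstanceAs (Subsingleton PUnit.{u + 2})
    exact ⟨_, (X.homSequence hFA hM hM' ξ).isCohomology_of_neg (Int.negSucc_lt_zero i)⟩

/-- A map in `F_p` has its differential in `F_{p-1}` exactly when its comparison is a cocycle over
`gr A`. The comparison is surjective with kernel `F_{p-1}`, so the preimage of the coboundaries is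
`F_{p-1} + d F_p`. Composing with the presentation of Ext over `gr A` identifies the first page. -/
theorem exists_first_page_nat (i : ℕ) (p : ℤ) :
    ∃ ψ : (X.homSequence hFA hM hM' ξ).total.Z 1 p i →ₗ[k] GrExt i X.filt.gr FM.gr (ξ, p),
      Function.Surjective ψ ∧
      ∀ x, ψ x = 0 ↔ x.1 ∈ (X.homSequence hFA hM hM' ξ).total.D 1 p i := by
  obtain ⟨φ, hφ, hker⟩ := X.exists_gr_ext_presentation hFA FM ξ p i
  have hd : ∀ f : ModFiltration.filtHom (X.resFilt hFA i) FM ξ p,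
      X.comparison hFA FM ξ p i f ∈
          LinearMap.ker ((X.grSyzygySequence hFA).homD (FM.gr.shift (ξ, p)) k i) ↔
        (X.syzygySequence hFA).homD (M.shift ξ) k i f.1 ∈
          ModFiltration.filtHom (X.resFilt hFA (i + 1)) FM ξ (p - 1) := fun f => by
    rw [LinearMap.mem_ker, ← X.comparison_homD hFA f, comparison_eq_zero_iff]
  let e : (X.homSequence hFA hM hM' ξ).firstCycles i p →ₗ[k]
      LinearMap.ker ((X.grSyzygySequence hFA).homD (FM.gr.shift (ξ, p)) k i) :=
    LinearMap.codRestrict _ (X.comparison hFA FM ξ p i ∘ₗ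
      LinearMap.restrict ULift.moduleEquiv.toLinearMap fun x hx => hx.1)
      fun x => (hd ⟨x.1.down, x.2.1⟩).2 x.2.2
  refine (X.homSequence hFA hM hM' ξ).exists_first_page (φ ∘ₗ e) (fun y => ?_) fun x => ?_
  · obtain ⟨f, rfl⟩ := hφ y
    obtain ⟨f', hf'⟩ := X.comparison_surjective hFA ξ p i f.1
    have h : X.comparison hFA FM ξ p i f' ∈
        LinearMap.ker ((X.grSyzygySequence hFA).homD (FM.gr.shift (ξ, p)) k i) := by
      rw [hf']
      exact f.2
    exact ⟨⟨ULift.up f'.1, f'.2, (hd f').1 h⟩, congrArg φ (Subtype.ext hf')⟩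
  · have hx : x.1.down ∈ ModFiltration.filtHom (X.resFilt hFA i) FM ξ p := x.2.1
    refine (hker _).trans ?_
    change X.comparison hFA FM ξ p i ⟨x.1.down, hx⟩ ∈ _ ↔ _
    cases i with
    | zero =>
      refine (Submodule.mem_bot k).trans ?_
      refine (X.comparison_eq_zero_iff hFA).trans ?_
      change _ ↔ x.1 ∈ _ ⊔ (⊥ : Submodule k _)
      rw [sup_bot_eq]
      rfl
    | succ j =>
      rw [Submodule.mem_sup]
      constructor
      · rintro ⟨h, hh⟩
        -- Lifting the cochain over `gr A` to a filtered map `f` gives a coboundary that agrees with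
        -- `x` modulo `F_{p-1}`.
        obtain ⟨f, rfl⟩ := X.comparison_surjective hFA ξ p j h
        rw [← X.comparison_homD hFA f, eq_comm, ← sub_eq_zero, ← map_sub,
          comparison_eq_zero_iff] at hh
        exact ⟨ULift.up (x.1.down - (X.syzygySequence hFA).homD (M.shift ξ) k j f.1), hh,
          ULift.up ((X.syzygySequence hFA).homD (M.shift ξ) k j f.1), ⟨ULift.up f.1, f.2, rfl⟩,
          ULift.ext _ _ (sub_add_cancel _ _)⟩
      · rintro ⟨y, hy, _, ⟨f, hf, rfl⟩, e⟩
        have hf' : f.down ∈ ModFiltration.filtHom (X.resFilt hFA j) FM ξ p := hf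
        refine ⟨X.comparison hFA FM ξ p j ⟨f.down, hf'⟩, ?_⟩
        rw [← X.comparison_homD hFA ⟨f.down, hf'⟩, eq_comm, ← sub_eq_zero, ← map_sub,
          comparison_eq_zero_iff]
        have hxy : x.1.down - (X.syzygySequence hFA).homD (M.shift ξ) k j f.down = y.down :=
          sub_eq_of_eq_add (congrArg ULift.down e).symm
        exact (congrArg (· ∈ ModFiltration.filtHom (X.resFilt hFA (j + 1)) FM ξ (p - 1)) hxy).mpr hy

theorem exists_first_page (n p : ℤ) :
    ∃ ψ : (X.homSequence hFA hM hM' ξ).total.Z 1 p n →ₗ[k] GrExtInt n X.filt.gr FM.gr (ξ, p),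
      Function.Surjective ψ ∧
      ∀ x, ψ x = 0 ↔ x.1 ∈ (X.homSequence hFA hM hM' ξ).total.D 1 p n := by
  cases n with
  | ofNat i => exact X.exists_first_page_nat hFA hM hM' ξ i p
  | negSucc i =>
    have : Subsingleton (GrExtInt (Int.negSucc i) X.filt.gr FM.gr (ξ, p)) :=
      inferInstanceAs (Subsingleton PUnit.{u + 2})
    refine ⟨0, fun y => ⟨0, Subsingleton.elim _ _⟩, fun x => iff_of_true (Subsingleton.elim _ _) ?_⟩
    have hx : x.1 = 0 := (Submodule.mem_bot k).1
      ((FilteredSequence.totalDeg_of_neg (Int.negSucc_lt_zero i)).le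
        (FilteredComplex.mem_Z.1 x.2).2.1)
    rw [hx]
    exact zero_mem _

include hFA hM hM' in
/-- The convergent spectral sequence of graded Ext spaces. -/
theorem exists_spectralSequence : ∃ E : HomologicalSS k,
    (∀ p q : ℤ, Nonempty (E.term (p, q) 0 ≅ GrExtInt (-p - q) X.filt.gr FM.gr (ξ, p))) ∧
    ∃ c : E.Convergence (fun n => GrExtInt (-n) X.obj M ξ),
      (∀ ζ, FiniteDimensional k (M.deg ζ)) → c.IsFinite := by
  -- The homological degree `n` of the abutment is the cohomological degree `-n` of the Hom complex.
  choose ψ hψ using fun n : ℤ => X.exists_isCohomology hFA hM hM' ξ (-n)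
  refine ⟨(X.homSequence hFA hM hM' ξ).total.spectralSequence, fun p q => ?_,
    FilteredComplex.convergence (H := fun n => GrExtInt (-n) X.obj M ξ) hψ, fun hfin n => ?_⟩
  · obtain ⟨φ, hφ, hker⟩ := X.exists_first_page hFA hM hM' ξ (-(p + q)) p
    rw [show -p - q = -(p + q) by ring]
    exact FilteredComplex.nonempty_term_iso (pq := (p, q)) φ hφ hker
  · have := X.finite_ext hFA hfin ξ (-n)
    let c := FilteredComplex.convergence (H := fun n => GrExtInt (-n) X.obj M ξ) hψ
    obtain ⟨s, hs⟩ := c.bounded_below n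
    obtain ⟨t, ht⟩ := exists_eq_top_of_exhaustive (c.mono n) (c.exhaustive n)
    exact ⟨s, t, hs, ht⟩

end FilteredModule

/-! ### Dimension bounds from convergence -/

namespace HomologicalSS

variable {E : HomologicalSS k} {H : ℤ → ModuleCat.{u + 1} k}

theorem rank_EInfinity_le (pq : ℤ × ℤ) :
    Module.rank k (E.EInfinity pq) ≤ Module.rank k (E.term pq 0) :=
  (rank_quotient_le _).trans (Submodule.rank_le _)

/-- The graded pieces of `H_n` are the terms `E^∞_{p,n-p}`, which are subquotients of the first
page. -/
theorem Convergence.rank_le (c : E.Convergence H) (n : ℤ) :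
    Module.rank k (H n) ≤ Cardinal.sum fun p => Module.rank k (E.term (p, n - p) 0) := by
  obtain ⟨s, hs⟩ := c.bounded_below n
  refine (rank_le_sum_of_filtration (c.filt n) (c.mono n) (c.exhaustive n) hs).trans ?_
  refine Cardinal.sum_le_sum _ _ fun p => ?_
  obtain ⟨e⟩ := c.iso p (n - p)
  rw [add_sub_cancel] at e
  rw [← e.rank_eq]
  exact rank_EInfinity_le _

end HomologicalSS

namespace FilteredModule

variable (X : FilteredModule FA) (hFA : FA.IsConnected) [IsNoetherianRing (GrAlg FA)]
  {M : GrMod 𝒜} {FM : ModFiltration FA M} (hM : FM.IsDiscrete) (hM' : FM.IsExhaustive)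

include hFA hM hM' in
theorem rank_ext_le (i : ℕ) (ξ : G) : Module.rank k (GrExt i X.obj M ξ) ≤
    Cardinal.sum fun p : ℤ => Module.rank k (GrExt i X.filt.gr FM.gr (ξ, p)) := by
  obtain ⟨E, hE, c, -⟩ := X.exists_spectralSequence hFA hM hM' ξ
  have h := c.rank_le (-(i : ℤ))
  rw [neg_neg] at h
  refine h.trans (Cardinal.sum_le_sum _ _ fun p => ?_)
  obtain ⟨e⟩ := hE p (-(i : ℤ) - p)
  rw [show -p - (-(i : ℤ) - p) = i by ring] at e
  exact e.toLinearEquiv.rank_eq.le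

include hFA hM hM' in
theorem subsingleton_ext (i : ℕ) (ξ : G)
    (h : ∀ p, Subsingleton (GrExt i X.filt.gr FM.gr (ξ, p))) :
    Subsingleton (GrExt i X.obj M ξ) := by
  rw [← rank_zero_iff (R := k), ← nonpos_iff_eq_zero]
  refine (X.rank_ext_le hFA hM hM' i ξ).trans ?_
  simp

end FilteredModule

end FilteredExt

/-! ### Projective dimension -/

section ProjectiveDimension

variable {k A : Type u} {G : Type} [Field k] [Ring A] [Algebra k A] [AddCommGroup G]
  [DecidableEq G] {𝒜 : G → Submodule k A} [GradedAlgebra 𝒜] {FA : AlgFiltration 𝒜}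

open Classical in
/-- The filtration of a module that is concentrated in degree zero. -/
def trivialFiltration (hFA : FA.IsConnected) (M : GrMod 𝒜) : ModFiltration FA M :=
  letI layer : ℤ → Submodule k M := fun n => if 0 ≤ n then ⊤ else ⊥
  haveI mono : Monotone layer := fun m n h => by
    by_cases hm : 0 ≤ m
    · exact le_of_le_of_eq le_top (if_pos (hm.trans h)).symm
    · exact le_of_eq_of_le (if_neg hm) bot_le
  { layer := layer
    isFiltration :=
      { mono := mono
        is_le := fun {i j} h => mono (Int.le_sub_one_of_lt h)
        is_sup := fun B j h => h _ (sub_one_lt j)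
        smul_mem := fun {i j a x} ha hx => by
          change x ∈ (if 0 ≤ j then ⊤ else ⊥ : Submodule k M) at hx
          change a • x ∈ (if 0 ≤ i + j then ⊤ else ⊥ : Submodule k M)
          by_cases hj : 0 ≤ j
          · by_cases hi : 0 ≤ i
            · rw [if_pos (add_nonneg hi hj)]
              trivial
            · rw [hFA.neg i (lt_of_not_ge hi), Submodule.mem_bot] at ha
              rw [ha, zero_smul]
              exact zero_mem _
          · rw [if_neg hj, Submodule.mem_bot] at hx
            rw [hx, smul_zero]
            exact zero_mem _ }
    homogeneous := fun n ζ x hx => by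
      by_cases hn : 0 ≤ n
      · exact (if_pos hn : layer n = ⊤).ge trivial
      · have h0 : x = 0 := (Submodule.mem_bot k).1 ((if_neg hn : layer n = ⊥).le hx)
        rw [h0, DirectSum.decompose_zero]
        exact zero_mem _ }

theorem trivialFiltration_of_nonneg (hFA : FA.IsConnected) (M : GrMod 𝒜) {n : ℤ} (hn : 0 ≤ n) :
    (trivialFiltration hFA M).layer n = ⊤ := if_pos hn

theorem trivialFiltration_of_neg (hFA : FA.IsConnected) (M : GrMod 𝒜) {n : ℤ} (hn : n < 0) :
    (trivialFiltration hFA M).layer n = ⊥ := if_neg (not_le.2 hn)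

theorem trivialFiltration_isDiscrete (hFA : FA.IsConnected) (M : GrMod 𝒜) :
    (trivialFiltration hFA M).IsDiscrete :=
  ⟨0, fun _ => trivialFiltration_of_neg hFA M⟩

theorem trivialFiltration_isExhaustive (hFA : FA.IsConnected) (M : GrMod 𝒜) :
    (trivialFiltration hFA M).IsExhaustive := fun _ =>
  ⟨0, (trivialFiltration_of_nonneg hFA M le_rfl).ge trivial⟩

/-- Shifting by zero does nothing. -/
def GrMod.shiftZero (M : GrMod 𝒜) : M.shift 0 ≅ M where
  hom := GrMod.ofLin (N := M.shift 0) LinearMap.id fun i x hx =>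
    (congrArg (fun j => x ∈ M.deg j) (add_zero i)).mp hx
  inv := GrMod.ofLin (M := M.shift 0) LinearMap.id fun i x hx =>
    (congrArg (fun j => x ∈ M.deg j) (add_zero i)).mpr hx
  hom_inv_id := rfl
  inv_hom_id := rfl

/-- The graded Ext space in degree zero is the Ext space. -/
theorem subsingleton_ext_of_grExt {N M : GrMod 𝒜} {i : ℕ} (h : Subsingleton (GrExt i N M 0)) :
    letI := HasExt.standard (GrMod 𝒜)
    Subsingleton (Abelian.Ext.{u + 1} N M i) := by
  let := HasExt.standard (GrMod 𝒜)
  have h' : Subsingleton (Abelian.Ext.{u + 1} N (M.shift 0) i) := h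
  refine ⟨fun e e' => ?_⟩
  have key : ∀ e : Abelian.Ext.{u + 1} N M i, e = 0 := fun e => by
    -- Every class factors through the isomorphism `M ≅ M[0]`, hence through a space that vanishes.
    rw [← e.comp_mk₀_id, ← M.shiftZero.inv_hom_id, ← Abelian.Ext.mk₀_comp_mk₀,
      ← Abelian.Ext.comp_assoc_of_second_deg_zero,
      Subsingleton.elim (e.comp (Abelian.Ext.mk₀ M.shiftZero.inv) (add_zero i)) 0,
      Abelian.Ext.zero_comp]
  rw [key e, key e']

namespace FilteredModule

variable (X : FilteredModule FA) (hFA : FA.IsConnected) [IsNoetherianRing (GrAlg FA)]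

include hFA in
-- The dimension bound needs the target only to have some discrete exhaustive filtration. The one
-- jumping at `0` exists on every `Y`, so vanishing over `gr A` in degree `i` gives `Ext^i(X, Y) =
-- 0` for all `Y`.
theorem hasProjectiveDimensionLT {n : ℕ} (h : HasProjectiveDimensionLT X.filt.gr n) :
    HasProjectiveDimensionLT X.obj n where
  subsingleton' i hi Y :=
    subsingleton_ext_of_grExt (X.subsingleton_ext hFA (trivialFiltration_isDiscrete hFA Y)
      (trivialFiltration_isExhaustive hFA Y) i 0 fun _ => h.subsingleton' i hi (Y := _))

include hFA in
theorem projectiveDimension_le : projectiveDimension X.obj ≤ projectiveDimension X.filt.gr :=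
  sInf_le_sInf fun _ hn i hi => X.hasProjectiveDimensionLT hFA (hn i hi)

end FilteredModule

end ProjectiveDimension

/-! ### The trivial module -/

section Chi

variable {k A : Type u} [Field k] [Ring A] [Algebra k A] {r : ℕ}
  {𝒜 : (Fin r → ℤ) → Submodule k A} [GradedAlgebra 𝒜] {FA : AlgFiltration 𝒜}

/-- The degree-zero component vanishes on the left ideal: for homogeneous `b` and `x` of degrees `ζ,
ξ ≥ 0` with `ξ ≠ 0`, the sum `ζ + ξ` is not `0`. Quantifying over all left multiples `b * x` lets
the induction pass through multiplication by ring elements. -/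
theorem one_notMem_gradedMaximalIdeal (h𝒜 : IsConnectedGrading 𝒜) :
    (1 : A) ∉ gradedMaximalIdeal 𝒜 := by
  intro h1
  have hproj : ∀ x ∈ gradedMaximalIdeal 𝒜, ∀ b : A, gradedProj 𝒜 0 (b * x) = 0 := by
    intro x hx
    induction hx using Submodule.span_induction with
    | mem x hx =>
      obtain ⟨ξ, hξ, hx⟩ := hx
      intro b
      refine (Submodule.mem_bot k).1 (mem_iSup_of_decompose 𝒜 (Submodule.comap
        (gradedProj 𝒜 0 ∘ₗ LinearMap.mulRight k x) ⊥) b fun ζ => ?_)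
      have hb := SetLike.coe_mem (DirectSum.decompose 𝒜 b ζ)
      change gradedProj 𝒜 0 ((DirectSum.decompose 𝒜 b ζ : A) * x) = 0
      by_cases hx0 : 0 ≤ ξ
      · by_cases hζ : 0 ≤ ζ
        · refine DirectSum.decompose_of_mem_ne 𝒜 (SetLike.mul_mem_graded hb hx) fun h => hξ ?_
          exact le_antisymm (h ▸ le_add_of_nonneg_left hζ) hx0
        · rw [(Submodule.mem_bot k).1 ((h𝒜.nonneg ζ hζ).le hb), zero_mul, map_zero]
      · rw [h𝒜.nonneg ξ hx0, Submodule.mem_bot] at hx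
        rw [hx, mul_zero, map_zero]
    | zero => simp
    | add x y _ _ hx hy => exact fun b => by rw [mul_add, map_add, hx, hy, add_zero]
    | smul a x _ hx => exact fun b => by rw [smul_eq_mul, ← mul_assoc, hx]
  have h0 := hproj 1 h1 1
  rw [mul_one, gradedProj_apply, DirectSum.decompose_of_mem_same _ SetLike.GradedOne.one_mem] at h0
  have := h𝒜.nontrivial
  exact one_ne_zero h0

theorem residue_eq_zero {B : Type u} {G : Type} [Ring B] [Algebra k B] [AddCommGroup G]
    [DecidableEq G] {ℬ : G → Submodule k B} [GradedAlgebra ℬ] {i : G} (hi : i ≠ 0)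
    {x : GrMod.residue ℬ} (hx : x ∈ (GrMod.residue ℬ).deg i) : x = 0 := by
  obtain ⟨a, ha, rfl⟩ := hx
  exact (Submodule.Quotient.mk_eq_zero (gradedMaximalIdeal ℬ)).2
    (Submodule.subset_span ⟨i, hi, ha⟩)

variable (𝒜) in
/-- The generator of the trivial module. -/
def residueOne : GrMod.residue 𝒜 := (gradedMaximalIdeal 𝒜).mkQ 1

theorem residueOne_mem : residueOne 𝒜 ∈ (GrMod.residue 𝒜).deg 0 :=
  ⟨(1 : A), SetLike.one_mem_graded 𝒜, rfl⟩

theorem residueOne_ne_zero (h𝒜 : IsConnectedGrading 𝒜) : residueOne 𝒜 ≠ 0 := fun h =>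
  one_notMem_gradedMaximalIdeal h𝒜 ((Submodule.Quotient.mk_eq_zero _).1 h)

theorem exists_smul_residueOne (h𝒜 : IsConnectedGrading 𝒜) {x : GrMod.residue 𝒜}
    (hx : x ∈ (GrMod.residue 𝒜).deg 0) : ∃ c : k, x = algebraMap k A c • residueOne 𝒜 := by
  obtain ⟨a, ha, rfl⟩ := hx
  have ha' : a ∈ 𝒜 0 := ha
  rw [h𝒜.zero] at ha'
  obtain ⟨c, rfl⟩ := ha'
  exact ⟨c, congrArg (gradedMaximalIdeal 𝒜).mkQ (mul_one _).symm⟩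

/-- The filtration of the trivial module. -/
abbrev residueFilt (hFA : FA.IsConnected) : ModFiltration FA (GrMod.residue 𝒜) :=
  trivialFiltration hFA (GrMod.residue 𝒜)

/-- The trivial module is concentrated in degree `0` and its filtration jumps only at `0`, so its
only possible symbols have bidegree `(0, 0)`. -/
theorem residueFilt_sym_eq_zero (hFA : FA.IsConnected) {i : (Fin r → ℤ) × ℤ} (hi : i ≠ 0)
    (x : filtPiece (residueFilt (𝒜 := 𝒜) hFA).layer (GrMod.residue 𝒜).deg i) :
    (residueFilt hFA).sym i x = 0 := by
  rw [ModFiltration.sym_eq_zero_iff]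
  by_cases h : i.1 = 0
  · rcases lt_trichotomy i.2 0 with h2 | h2 | h2
    · rw [(Submodule.mem_bot k).1 ((trivialFiltration_of_neg hFA _ h2).le x.2.1)]
      exact zero_mem _
    · exact absurd (Prod.ext h h2) hi
    · exact (trivialFiltration_of_nonneg hFA _ (by lia)).ge trivial
  · rw [residue_eq_zero h x.2.2]
    exact zero_mem _

/-- The generator of the trivial module, as an element of filtration degree zero. -/
def residueGen (hFA : FA.IsConnected) :
    filtPiece (residueFilt (𝒜 := 𝒜) hFA).layer (GrMod.residue 𝒜).deg 0 :=
  ⟨residueOne 𝒜, (trivialFiltration_of_nonneg hFA _ le_rfl).ge trivial, residueOne_mem⟩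

theorem smul_residueGen_mem (hFA : FA.IsConnected) {i : (Fin r → ℤ) × ℤ} {a : GrAlg FA}
    (ha : a ∈ grDeg FA i) :
    a • (residueFilt hFA).sym 0 (residueGen hFA) ∈ (residueFilt hFA).gr.deg i := by
  have h := (residueFilt hFA).gr.smul_mem_deg ha ((residueFilt hFA).sym_mem 0 (residueGen hFA))
  rwa [add_zero] at h

theorem gradedMaximalIdeal_le_ker (hFA : FA.IsConnected) : gradedMaximalIdeal (grDeg FA) ≤
    LinearMap.ker (LinearMap.toSpanSingleton (GrAlg FA) (residueFilt hFA).gr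
      ((residueFilt hFA).sym 0 (residueGen hFA))) := by
  refine Submodule.span_le.2 ?_
  rintro a ⟨i, hi, ha⟩
  obtain ⟨x, hx⟩ := ModFiltration.exists_sym (smul_residueGen_mem hFA ha)
  rw [SetLike.mem_coe, LinearMap.mem_ker, LinearMap.toSpanSingleton_apply, ← hx]
  exact residueFilt_sym_eq_zero hFA hi x

/-- The comparison of the trivial module over `gr A` with `gr` of the trivial module. -/
def residueToGr (hFA : FA.IsConnected) : GrMod.residue (grDeg FA) ⟶ (residueFilt hFA).gr :=
  GrMod.ofLin (N := GrMod.residue (grDeg FA))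
    (Submodule.liftQ _ _ (gradedMaximalIdeal_le_ker hFA)) (by
      rintro i _ ⟨a, ha, rfl⟩
      exact smul_residueGen_mem hFA ha)

theorem residueToGr_mk (hFA : FA.IsConnected) (a : GrAlg FA) :
    GrMod.lin (residueToGr hFA) ((gradedMaximalIdeal (grDeg FA)).mkQ a) =
      a • (residueFilt hFA).sym 0 (residueGen hFA) := rfl

theorem residueToGr_surjective (h𝒜 : IsConnectedGrading 𝒜) (hFA : FA.IsConnected) :
    Function.Surjective (GrMod.lin (residueToGr hFA)) := by
  refine GrMod.surjective_of_homogeneous _ fun i y hy => ?_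
  obtain ⟨x, rfl⟩ := ModFiltration.exists_sym hy
  by_cases hi : i = 0
  · subst hi
    obtain ⟨c, hc⟩ := exists_smul_residueOne h𝒜 x.2.2
    refine ⟨(gradedMaximalIdeal (grDeg FA)).mkQ (FA.sym 0 (scalarPiece FA c)), ?_⟩
    rw [residueToGr_mk]
    exact ModFiltration.sym_smul_sym_eq (add_zero 0) hc.symm
  · rw [residueFilt_sym_eq_zero hFA hi]
    exact zero_mem _

/-- Only bidegree `(0, 0)` matters. There `F_0 A = k`, so the element is represented by a scalar; it
kills the generator only if it is zero, because `1` is not in the ideal `𝔪`. -/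
theorem residueToGr_injective (h𝒜 : IsConnectedGrading 𝒜) (hFA : FA.IsConnected) :
    Function.Injective (GrMod.lin (residueToGr hFA)) := by
  refine GrMod.injective_of_homogeneous _ fun i y hy h => ?_
  by_cases hi : i = 0
  · subst hi
    obtain ⟨a, ha, rfl⟩ := hy
    obtain ⟨a, rfl⟩ := FA.exists_sym ha
    have ha' : (a : A) ∈ FA.layer 0 := a.2.1
    rw [hFA.zero] at ha'
    obtain ⟨c, hc⟩ := ha'
    have h1 := (ModFiltration.sym_smul_sym (F := residueFilt hFA) 0 0 a
      (residueGen hFA)).symm.trans h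
    have h2 := (Submodule.mem_bot k).1 ((trivialFiltration_of_neg hFA _ (by simp)).le
      (ModFiltration.sym_eq_zero_iff.1 h1))
    have h3 : c • residueOne 𝒜 = 0 := by
      rw [← algebraMap_smul A c]
      exact (congrArg (· • residueOne 𝒜) hc).trans h2
    have hc0 : c = 0 := (smul_eq_zero.1 h3).resolve_right (residueOne_ne_zero h𝒜)
    have ha0 : a = 0 := Subtype.ext (by rw [← hc, hc0, map_zero]; rfl)
    refine (congrArg (fun a => (gradedMaximalIdeal (grDeg FA)).mkQ (FA.sym 0 a)) ha0).trans ?_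
    exact (congrArg (gradedMaximalIdeal (grDeg FA)).mkQ (map_zero (FA.sym 0))).trans (map_zero _)
  · exact residue_eq_zero hi hy

/-- The trivial module, filtered. -/
def residueModule (h𝒜 : IsConnectedGrading 𝒜) (hFA : FA.IsConnected) : FilteredModule FA where
  obj := GrMod.residue 𝒜
  filt := residueFilt hFA
  discrete := trivialFiltration_isDiscrete hFA _
  exhaustive := trivialFiltration_isExhaustive hFA _
  finite := Module.Finite.of_surjective
    (LinearMap.toSpanSingleton (GrAlg FA) (residueFilt hFA).gr
      ((residueFilt hFA).sym 0 (residueGen hFA))) fun y => by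
    obtain ⟨x, rfl⟩ := residueToGr_surjective h𝒜 hFA y
    obtain ⟨a, rfl⟩ := (gradedMaximalIdeal (grDeg FA)).mkQ_surjective x
    exact ⟨a, rfl⟩

theorem rank_grExt_le_of_isIso {B : Type u} {G : Type} [Ring B] [Algebra k B] [AddCommGroup G]
    [DecidableEq G] {ℬ : G → Submodule k B} [GradedAlgebra ℬ] {N N' : GrMod ℬ} (f : N ⟶ N')
    [IsIso f] (M : GrMod ℬ) (i : ℕ) (ξ : G) :
    Module.rank k (GrExt i N' M ξ) ≤ Module.rank k (GrExt i N M ξ) := by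
  let := HasExt.standard (GrMod ℬ)
  let φ : Abelian.Ext.{u + 1} N' (M.shift ξ) i →ₗ[k] Abelian.Ext.{u + 1} N (M.shift ξ) i :=
    (Abelian.Ext.mk₀ f).precompOfLinear k (M.shift ξ) (zero_add i)
  refine LinearMap.rank_le_of_injective φ ((injective_iff_map_eq_zero φ).2 fun e he => ?_)
  replace he : (Abelian.Ext.mk₀ f).comp e (zero_add i) = 0 := he
  have h := congrArg (fun e => (Abelian.Ext.mk₀ (inv f)).comp e (zero_add i)) he
  simpa using h

theorem sum_sum_eq {ι κ : Type*} (b : ι × κ → Cardinal.{u}) :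
    (Cardinal.sum fun i => Cardinal.sum fun j => b (i, j)) = Cardinal.sum b := by
  have h : b = fun x => Cardinal.mk (b x).out := funext fun x => (Cardinal.mk_out _).symm
  rw [h]
  simp only [← Cardinal.mk_sigma]
  exact Cardinal.mk_congr ⟨fun x => ⟨(x.1, x.2.1), x.2.2⟩, fun x => ⟨x.1.1, x.1.2, x.2⟩,
    fun _ => rfl, fun _ => rfl⟩

/-- The dimension bound for the trivial module, summed over `ξ`, bounds the total dimension over `A`
by the sum over all pairs `(ξ, p)`, which is the total dimension over `gr A`. The isomorphism
`residueToGr` replaces `gr k` by the trivial module of `gr A`. -/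
theorem chi_of_gr_chi (h𝒜 : IsConnectedGrading 𝒜) (hFA : FA.IsConnected)
    [IsNoetherianRing (GrAlg FA)] {M : GrMod 𝒜} {FM : ModFiltration FA M} (hM : FM.IsDiscrete)
    (hM' : FM.IsExhaustive) (hχ : FM.gr.Chi) : M.Chi := by
  intro i
  have hfin := Module.rank_lt_aleph0_iff.2 (hχ i)
  have := GrMod.isIso_of_bijective _
    ⟨residueToGr_injective h𝒜 hFA, residueToGr_surjective h𝒜 hFA⟩
  refine Module.rank_lt_aleph0_iff.1 (lt_of_le_of_lt ?_ hfin)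
  rw [rank_directSum, rank_directSum, ← sum_sum_eq]
  refine Cardinal.sum_le_sum _ _ fun ξ => ?_
  refine ((residueModule h𝒜 hFA).rank_ext_le hFA hM hM' i ξ).trans ?_
  exact Cardinal.sum_le_sum _ _ fun p => rank_grExt_le_of_isIso (residueToGr hFA) FM.gr i (ξ, p)

end Chi

/-! ### Coinduced modules -/

section Coinduced

variable {k A : Type u} {G : Type} [Field k] [Ring A] [Algebra k A] [AddCommGroup G]
  [DecidableEq G] (𝒜 : G → Submodule k A) [GradedAlgebra 𝒜]
  {V : Type u} [AddCommGroup V] [Module k V] (E : G → Submodule k V) [DirectSum.Decomposition E]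

/-- The linear maps `A → V` that are homogeneous of degree `ξ`. -/
def homogeneousMaps (ξ : G) : Submodule k (A →ₗ[k] V) where
  carrier := {f | ∀ ζ, ∀ a ∈ 𝒜 ζ, f a ∈ E (ζ + ξ)}
  add_mem' hf hg ζ a ha := add_mem (hf ζ a ha) (hg ζ a ha)
  zero_mem' ζ _ _ := zero_mem (E (ζ + ξ))
  smul_mem' c _ hf ζ a ha := Submodule.smul_mem _ c (hf ζ a ha)

/-- The component of degree `ξ` of a linear map from a graded space to `V`. -/
def homogeneousPart {W : Type u} [AddCommGroup W] [Module k W] (D : G → Submodule k W)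
    [DirectSum.Decomposition D] (ξ : G) : (W →ₗ[k] V) →ₗ[k] (W →ₗ[k] V) where
  toFun f := DirectSum.toModule k G V (fun ζ => gradedProj E (ζ + ξ) ∘ₗ f ∘ₗ (D ζ).subtype) ∘ₗ
    (DirectSum.decomposeLinearEquiv D).toLinearMap
  map_add' f g := by
    rw [← LinearMap.add_comp]
    congr 1
    ext ζ x
    simp
  map_smul' c f := by
    rw [RingHom.id_apply, ← LinearMap.smul_comp]
    congr 1
    ext ζ x
    simp

theorem homogeneousPart_apply {W : Type u} [AddCommGroup W] [Module k W] (D : G → Submodule k W)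
    [DirectSum.Decomposition D] (ξ : G) (f : W →ₗ[k] V) {ζ : G} {x : W} (hx : x ∈ D ζ) :
    homogeneousPart E D ξ f x = gradedProj E (ζ + ξ) (f x) := by
  lift x to D ζ using hx
  simp [homogeneousPart]

omit [AddCommGroup G] in
theorem linearMap_ext_homogeneous {W Y : Type u} [AddCommGroup W] [Module k W] [AddCommGroup Y]
    [Module k Y] (D : G → Submodule k W) [DirectSum.Decomposition D] {f g : W →ₗ[k] Y}
    (h : ∀ i, ∀ x ∈ D i, f x = g x) : f = g :=
  LinearMap.ext fun x => mem_iSup_of_decompose D (LinearMap.eqLocus f g) x fun i =>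
    h i _ (SetLike.coe_mem _)

/-- The finite sums of homogeneous linear maps `A → V`. -/
abbrev gradedMaps : Submodule k (A →ₗ[k] V) := ⨆ ξ, homogeneousMaps 𝒜 E ξ

/-- The projection to degree `ξ` sends `f` to the map that on degree `ζ` is `f` followed by the
projection to degree `ζ + ξ`. It preserves finite sums of homogeneous maps. -/
theorem gradedMaps_isInternal : DirectSum.IsInternal fun ξ =>
    (homogeneousMaps 𝒜 E ξ).comap (gradedMaps 𝒜 E).subtype := by
  have hsame : ∀ i, ∀ f ∈ homogeneousMaps 𝒜 E i, homogeneousPart E 𝒜 i f = f := fun i f hf =>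
    linearMap_ext_homogeneous 𝒜 fun ζ a ha => by
      rw [homogeneousPart_apply E 𝒜 i f ha]
      exact DirectSum.decompose_of_mem_same E (hf ζ a ha)
  have hne : ∀ i j, i ≠ j → ∀ f ∈ homogeneousMaps 𝒜 E j, homogeneousPart E 𝒜 i f = 0 :=
    fun i j hij f hf => linearMap_ext_homogeneous 𝒜 fun ζ a ha => by
      rw [homogeneousPart_apply E 𝒜 i f ha]
      exact DirectSum.decompose_of_mem_ne E (hf ζ a ha) fun h => hij (add_left_cancel h).symm
  have hmap : ∀ i, ∀ f ∈ gradedMaps 𝒜 E, homogeneousPart E 𝒜 i f ∈ gradedMaps 𝒜 E := fun i f hf =>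
    (iSup_le fun j f hf => by
      by_cases h : i = j
      · subst h
        rw [Submodule.mem_comap, hsame i f hf]
        exact Submodule.mem_iSup_of_mem i hf
      · rw [Submodule.mem_comap, hne i j h f hf]
        exact zero_mem _ : gradedMaps 𝒜 E ≤ (gradedMaps 𝒜 E).comap (homogeneousPart E 𝒜 i)) hf
  refine isInternal_of_proj _ (fun i => (homogeneousPart E 𝒜 i).restrict (hmap i)) ?_ ?_ ?_
  · exact fun i f hf => Subtype.ext (hsame i f.1 hf)
  · exact fun i j hij f hf => Subtype.ext (hne i j hij f.1 hf)
  · intro f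
    have key : gradedMaps 𝒜 E ≤ (⨆ ξ, (homogeneousMaps 𝒜 E ξ).comap
        (gradedMaps 𝒜 E).subtype).map (gradedMaps 𝒜 E).subtype := iSup_le fun ξ f hf =>
      ⟨⟨f, Submodule.mem_iSup_of_mem ξ hf⟩, Submodule.mem_iSup_of_mem ξ hf, rfl⟩
    obtain ⟨f', hf', e⟩ := key f.2
    rwa [← Subtype.ext e]

omit [DirectSum.Decomposition E] in
-- This concerns the left action `(a f)(b) = f (b a)` on maps: degrees add.
theorem comp_mulRight_mem_homogeneousMaps {i j : G} {a : A} (ha : a ∈ 𝒜 i) {f : A →ₗ[k] V}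
    (hf : f ∈ homogeneousMaps 𝒜 E j) :
    f ∘ₗ LinearMap.mulRight k a ∈ homogeneousMaps 𝒜 E (i + j) := fun ζ b hb => by
  rw [← add_assoc]
  exact hf _ _ (SetLike.mul_mem_graded hb ha)

omit [DirectSum.Decomposition E] in
theorem comp_mulRight_mem_gradedMaps (a : A) {f : A →ₗ[k] V} (hf : f ∈ gradedMaps 𝒜 E) :
    f ∘ₗ LinearMap.mulRight k a ∈ gradedMaps 𝒜 E := by
  refine mem_iSup_of_decompose 𝒜 ((gradedMaps 𝒜 E).comap
    ((LinearMap.mul k A).flip.compr₂ f)) a fun i => ?_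
  have h : gradedMaps 𝒜 E ≤ (gradedMaps 𝒜 E).comap
      (LinearMap.lcomp k V (LinearMap.mulRight k (DirectSum.decompose 𝒜 a i : A))) :=
    iSup_le fun j f hf => Submodule.mem_iSup_of_mem (i + j)
      (comp_mulRight_mem_homogeneousMaps 𝒜 E (SetLike.coe_mem _) hf)
  exact h hf

/-- The coinduced module of a graded vector space. -/
def coinduced : GrMod 𝒜 :=
  letI mod : Module A (gradedMaps 𝒜 E) :=
    { smul := fun a f => ⟨f.1 ∘ₗ LinearMap.mulRight k a, comp_mulRight_mem_gradedMaps 𝒜 E a f.2⟩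
      one_smul := fun f => Subtype.ext (LinearMap.ext fun b => congrArg f.1 (mul_one b))
      mul_smul := fun a b f => Subtype.ext (LinearMap.ext fun c =>
        congrArg f.1 (mul_assoc c a b).symm)
      smul_zero := fun _ => rfl
      smul_add := fun _ _ _ => rfl
      add_smul := fun a b f => Subtype.ext (LinearMap.ext fun c =>
        (congrArg f.1 (mul_add c a b)).trans (map_add _ _ _))
      zero_smul := fun f => Subtype.ext (LinearMap.ext fun c =>
        (congrArg f.1 (mul_zero c)).trans (map_zero _)) }
  { carrier := gradedMaps 𝒜 E
    moduleAlg := mod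
    tower := ⟨fun c a f => Subtype.ext (LinearMap.ext fun b =>
      (congrArg f.1 (mul_smul_comm c b a)).trans (map_smul _ _ _))⟩
    deg := fun ξ => (homogeneousMaps 𝒜 E ξ).comap (gradedMaps 𝒜 E).subtype
    dec := (gradedMaps_isInternal 𝒜 E).chooseDecomposition
    gradedSMul := ⟨fun {_ _ _ _} ha hf => comp_mulRight_mem_homogeneousMaps 𝒜 E ha hf⟩ }

variable {𝒜 E} {Y : GrMod 𝒜}

/-- The action map `A → Y` of an element, followed by a linear map. -/
def evalMap (h : Y →ₗ[k] V) : Y →ₗ[k] (A →ₗ[k] V) :=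
  ((Algebra.lsmul k k Y).toLinearMap.compr₂ h).flip

omit [DirectSum.Decomposition E] in
theorem evalMap_mem {h : Y →ₗ[k] V} (hh : ∀ i, ∀ y ∈ Y.deg i, h y ∈ E i) {i : G} {y : Y}
    (hy : y ∈ Y.deg i) : evalMap h y ∈ homogeneousMaps 𝒜 E i := fun _ _ ha =>
  hh _ _ (Y.smul_mem_deg ha hy)

/-- The morphism to a coinduced module given by a graded linear map. -/
def coinducedLift (h : Y →ₗ[k] V) (hh : ∀ i, ∀ y ∈ Y.deg i, h y ∈ E i) : Y ⟶ coinduced 𝒜 E :=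
  GrMod.ofLin (M := coinduced 𝒜 E)
    { toFun := fun y => ⟨evalMap h y, mem_iSup_of_decompose Y.deg
        ((gradedMaps 𝒜 E).comap (evalMap h)) y fun i =>
          Submodule.mem_iSup_of_mem i (evalMap_mem hh (SetLike.coe_mem _))⟩
      map_add' := fun y y' => Subtype.ext (map_add (evalMap h) y y')
      map_smul' := fun a y => Subtype.ext (LinearMap.ext fun b =>
        congrArg h (smul_smul b a y)) }
    fun _ _ hy => evalMap_mem hh hy

/-- Evaluation at `1`. -/
def coinducedEval : coinduced 𝒜 E →ₗ[k] V :=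
  LinearMap.applyₗ (1 : A) ∘ₗ (gradedMaps 𝒜 E).subtype

theorem coinducedEval_mem {i : G} {f : coinduced 𝒜 E} (hf : f ∈ (coinduced 𝒜 E).deg i) :
    coinducedEval f ∈ E i := by
  have h := hf 0 1 (SetLike.one_mem_graded 𝒜)
  rwa [zero_add] at h

/-- By linearity `f(y)(b) = f(b y)(1)`, so a morphism is recovered from its values at `1`. This is
the uniqueness half of the adjunction between coinduction and the forgetful functor to graded vector
spaces. -/
theorem coinduced_hom_ext {f g : Y ⟶ coinduced 𝒜 E}
    (h : ∀ y, coinducedEval (GrMod.lin f y) = coinducedEval (GrMod.lin g y)) : f = g := by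
  have key : ∀ (f : Y ⟶ coinduced 𝒜 E) (y : Y) (b : A),
      (GrMod.lin f y).1 b = coinducedEval (GrMod.lin f (b • y)) := fun f y b => by
    rw [map_smul]
    exact (congrArg (GrMod.lin f y).1 (one_mul b)).symm
  exact GrMod.hom_ext fun y => Subtype.ext (LinearMap.ext fun b => by rw [key, key, h])

/-- By adjunction it suffices to extend a graded `k`-linear map to `V`. A monomorphism has a
`k`-linear retraction, and taking the degree-zero part of the resulting extension makes it graded
without changing it on `X`. -/
instance : Injective (coinduced 𝒜 E) where
  factors {X Y} g f _ := by
    obtain ⟨ρ, hρ⟩ := ((GrMod.lin f).restrictScalars k).exists_leftInverse_of_injective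
      (LinearMap.ker_eq_bot.2 (GrMod.injective_of_mono f))
    let h : Y →ₗ[k] V := homogeneousPart E Y.deg 0
      (coinducedEval ∘ₗ (GrMod.lin g).restrictScalars k ∘ₗ ρ)
    have hh : ∀ i, ∀ y ∈ Y.deg i, h y ∈ E i := fun i y hy => by
      have := homogeneousPart_apply E Y.deg 0
        (coinducedEval ∘ₗ (GrMod.lin g).restrictScalars k ∘ₗ ρ) hy
      rw [add_zero] at this
      rw [show h y = _ from this]
      exact SetLike.coe_mem _
    refine ⟨coinducedLift h hh, coinduced_hom_ext fun x => ?_⟩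
    have key : h ∘ₗ (GrMod.lin f).restrictScalars k =
        coinducedEval ∘ₗ (GrMod.lin g).restrictScalars k :=
      linearMap_ext_homogeneous X.deg fun i x hx => by
        refine (homogeneousPart_apply E Y.deg 0 _ (GrMod.lin_mem f hx)).trans ?_
        rw [add_zero]
        change gradedProj E i (coinducedEval (GrMod.lin g (ρ (GrMod.lin f x)))) = _
        rw [show ρ (GrMod.lin f x) = x from LinearMap.congr_fun hρ x]
        exact DirectSum.decompose_of_mem_same E (coinducedEval_mem (GrMod.lin_mem g hx))
    refine Eq.trans ?_ (LinearMap.congr_fun key x)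
    exact congrArg h (one_smul A _)

/-- A module `Y` maps to its coinduced module by `y ↦ (a ↦ a y)`, and evaluation at `1` recovers
`y`. -/
instance : EnoughInjectives (GrMod 𝒜) where
  presentation Y := ⟨{
    J := coinduced 𝒜 Y.deg
    injective := inferInstance
    f := coinducedLift LinearMap.id fun _ _ hy => hy
    mono := GrMod.mono_of_injective _ fun y y' h => by
      have := congrArg coinducedEval h
      exact ((one_smul A y).symm.trans this).trans (one_smul A y') }⟩

end Coinduced

/-! ### Essential extensions and injectivity -/

section Essential

variable {k A : Type u} {G : Type} [Field k] [Ring A] [Algebra k A] [AddCommGroup G]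
  [DecidableEq G] {𝒜 : G → Submodule k A} [GradedAlgebra 𝒜]

namespace GrMod

/-- A morphism is essential if every nonzero homogeneous submodule of its target meets its image. -/
def IsEssential {C J : GrMod 𝒜} (j : C ⟶ J) : Prop :=
  ∀ p : Submodule A J, SetLike.IsHomogeneous J.deg p → Disjoint p (LinearMap.range (lin j)) → p = ⊥

theorem isHomogeneous_comap {M N : GrMod 𝒜} (f : M ⟶ N) {p : Submodule A N}
    (hp : SetLike.IsHomogeneous N.deg p) :
    SetLike.IsHomogeneous M.deg (p.comap (lin f)) := fun i x hx => by
  change lin f _ ∈ p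
  rw [← lin_decompose]
  exact hp i hx

/-- Every monomorphism becomes essential after passing to a quotient of its target. -/
theorem exists_essential_quotient {C I : GrMod 𝒜} (ι : C ⟶ I) [Mono ι] :
    ∃ (J : GrMod 𝒜) (q : I ⟶ J), Mono (ι ≫ q) ∧ IsEssential (ι ≫ q) := by
  -- Divide by a homogeneous submodule maximal among those meeting the image of `C` trivially.
  obtain ⟨p, ⟨hp, hpι⟩, hmax⟩ := zorn_le₀ {p : Submodule A I | SetLike.IsHomogeneous I.deg p ∧
      Disjoint p (LinearMap.range (lin ι))} fun c hc hchain => by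
    rcases c.eq_empty_or_nonempty with rfl | hne
    · refine ⟨⊥, ⟨fun i x hx => ?_, disjoint_bot_left⟩, by simp⟩
      rw [(Submodule.mem_bot A).1 hx, DirectSum.decompose_zero]
      exact zero_mem _
    · refine ⟨sSup c, ⟨fun i x hx => ?_, ?_⟩, fun z hz => le_sSup hz⟩
      · obtain ⟨y, hy, hxy⟩ := (Submodule.mem_sSup_of_directed hne hchain.directedOn).1 hx
        exact le_sSup hy ((hc hy).1 i hxy)
      · rw [Submodule.disjoint_def]
        intro x hx hx'
        obtain ⟨y, hy, hxy⟩ := (Submodule.mem_sSup_of_directed hne hchain.directedOn).1 hx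
        exact Submodule.disjoint_def.1 (hc hy).2 x hxy hx'
  refine ⟨I.quot p hp, I.quotπ p hp, mono_of_injective _ ?_, fun K hK hdis => ?_⟩
  · refine (injective_iff_map_eq_zero _).2 fun x hx => ?_
    have h1 : lin ι x ∈ p := (Submodule.Quotient.mk_eq_zero p).1 hx
    exact injective_of_mono ι ((Submodule.disjoint_def.1 hpι _ h1 ⟨x, rfl⟩).trans (map_zero _).symm)
  · have hle : p ≤ K.comap (lin (I.quotπ p hp)) := fun x hx => by
      have h0 : lin (I.quotπ p hp) x = 0 := (Submodule.Quotient.mk_eq_zero p).2 hx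
      rw [Submodule.mem_comap, h0]
      exact zero_mem _
    -- If `K` meets the image of `C` in the quotient trivially, its preimage again meets the image
    -- of `C` in `I` trivially; maximality puts this preimage inside `p`, so `K` is zero.
    have hmem := hmax (y := K.comap (lin (I.quotπ p hp))) ⟨isHomogeneous_comap _ hK, by
      rw [Submodule.disjoint_def]
      rintro _ hx ⟨c, rfl⟩
      have h0 : lin (I.quotπ p hp) (lin ι c) = 0 := Submodule.disjoint_def.1 hdis _ hx ⟨c, rfl⟩
      exact Submodule.disjoint_def.1 hpι _ ((Submodule.Quotient.mk_eq_zero p).1 h0) ⟨c, rfl⟩⟩ hle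
    rw [eq_bot_iff]
    intro y hy
    obtain ⟨x, rfl⟩ := p.mkQ_surjective y
    exact (Submodule.Quotient.mk_eq_zero p).2 (hmem hy)

/-- A module that is a direct factor in all its extensions by cyclic modules has no proper essential
extensions. -/
theorem surjective_of_isEssential {C J : GrMod 𝒜} (j : C ⟶ J) [Mono j] (hj : IsEssential j)
    (hC : ∀ (i : G) (R : Submodule A (free 𝒜 fun _ : Fin 1 => i))
      (hR : SetLike.IsHomogeneous (free 𝒜 fun _ : Fin 1 => i).deg R) (f : (free 𝒜 _).sub R hR ⟶ C),
      ∃ g, (free 𝒜 _).subι R hR ≫ g = f) : Function.Surjective (lin j) := by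
  refine surjective_of_homogeneous j fun i z hz => ?_
  let F := free 𝒜 fun _ : Fin 1 => i
  let e : F ⟶ J := freeLift (fun _ => z) fun _ => hz
  -- `R` is the part of the cyclic free module that `e` maps into the image of `C`; on it `e` comes
  -- from a map to `C`, which by hypothesis extends to some `g` on all of `F`.
  let R : Submodule A F := (LinearMap.range (lin j)).comap (lin e)
  have hR : SetLike.IsHomogeneous F.deg R := isHomogeneous_comap e (range_homogeneous j)
  let l := KernelFork.IsLimit.lift' (isLimitOfExact j (J.quotπ _ (range_homogeneous j))
    (comp_quotπ j) (injective_of_mono j) fun _ hy => (Submodule.Quotient.mk_eq_zero _).1 hy)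
    (F.subι R hR ≫ e) (hom_ext fun x => (Submodule.Quotient.mk_eq_zero _).2 x.2)
  obtain ⟨g, hg⟩ := hC i R hR l.1
  have hl : l.1 ≫ j = F.subι R hR ≫ e := l.2
  -- If `e x - j (g x)` lies in the image of `j`, then `x ∈ R`, where `e` and `j ∘ g` agree, so the
  -- difference is zero. Essentiality then gives `K = ⊥`, and so `z = j (g 1)`.
  let K : Submodule A J := LinearMap.range (lin (e - g ≫ j))
  have hK : K = ⊥ := by
    refine hj K (range_homogeneous _) ?_
    rw [Submodule.disjoint_def]
    rintro _ ⟨x, rfl⟩ ⟨c, hc⟩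
    have hx : x ∈ R := by
      refine ⟨c + lin g x, ?_⟩
      rw [map_add, hc]
      exact sub_add_cancel (lin e x) (lin j (lin g x))
    have h1 : lin j (lin (F.subι R hR ≫ g) ⟨x, hx⟩) = lin e x := by
      rw [hg]
      exact LinearMap.congr_fun (congrArg lin hl) ⟨x, hx⟩
    exact sub_eq_zero.2 h1.symm
  have hz' : lin (e - g ≫ j) (freeGen 𝒜 _ 0) = 0 :=
    (Submodule.mem_bot A).1 (hK.le ⟨_, rfl⟩)
  refine ⟨lin g (freeGen 𝒜 _ 0), ?_⟩
  exact (sub_eq_zero.1 hz').symm.trans (freeLift_gen (fun _ => z) (fun _ => hz) 0)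

/-- Baer's criterion for graded modules, in terms of extensions by finitely generated modules. -/
theorem injective_of_ext_one [HasExt.{u + 1} (GrMod 𝒜)] (C : GrMod 𝒜)
    (h : ∀ Y : GrMod 𝒜, Module.Finite A Y → Subsingleton (Abelian.Ext.{u + 1} Y C 1)) :
    Injective C := by
  -- The map from `C` to an essential quotient `J` of an injective module turns out to be an
  -- isomorphism, which makes `C` a retract of that injective module. It is surjective because
  -- `Ext^1(F/R, C) = 0`, for `F/R` finitely generated, lets maps `R → C` extend to `F`.
  obtain ⟨J, q, hmono, hess⟩ := exists_essential_quotient (Injective.ι C)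
  have hsurj := surjective_of_isEssential _ hess fun i R hR f => by
    have hS := shortExact_of_exact ((free 𝒜 fun _ : Fin 1 => i).subι R hR)
      ((free 𝒜 fun _ : Fin 1 => i).quotπ R hR)
      (hom_ext fun x => (Submodule.Quotient.mk_eq_zero R).2 x.2) Subtype.val_injective
      R.mkQ_surjective fun y hy => ⟨⟨y, (Submodule.Quotient.mk_eq_zero R).1 hy⟩, rfl⟩
    have hfin : Module.Finite A ((free 𝒜 fun _ : Fin 1 => i).quot R hR) := by
      have : Module.Finite A (free 𝒜 fun _ : Fin 1 => i) :=
        inferInstanceAs (Module.Finite A (Fin 1 → A))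
      exact inferInstanceAs (Module.Finite A ((free 𝒜 fun _ : Fin 1 => i) ⧸ R))
    have := h _ hfin
    obtain ⟨φ, hφ⟩ := Abelian.Ext.contravariant_sequence_exact₁ hS C (Abelian.Ext.mk₀ f)
      (add_zero 1) (Subsingleton.elim _ _)
    obtain ⟨g, rfl⟩ := Abelian.Ext.homEquiv₀.symm.surjective φ
    exact ⟨g, Abelian.Ext.homEquiv₀.symm.injective (by simpa using hφ)⟩
  have := isIso_of_bijective _ ⟨injective_of_mono _, hsurj⟩
  exact Retract.injective (Y := Injective.under C)
    { i := Injective.ι C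
      r := q ≫ inv (Injective.ι C ≫ q)
      retract := by rw [← Category.assoc, IsIso.hom_inv_id] }

/-- Injective dimensions are detected by finitely generated modules. -/
theorem hasInjectiveDimensionLT_of_finite [HasExt.{u + 1} (GrMod 𝒜)] (n : ℕ) (C : GrMod 𝒜)
    (h : ∀ Y : GrMod 𝒜, Module.Finite A Y → ∀ i, n + 1 ≤ i →
      Subsingleton (Abelian.Ext.{u + 1} Y C i)) : HasInjectiveDimensionLT C (n + 1) := by
  induction n generalizing C with
  | zero =>
    exact injective_iff_hasInjectiveDimensionLT_one.1
      (injective_of_ext_one C fun Y hY => h Y hY 1 le_rfl)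
  | succ n ih =>
    have hS : (ShortComplex.mk (Injective.ι C) (cokernel.π (Injective.ι C))
      (cokernel.condition _)).ShortExact :=
      { exact := ShortComplex.exact_cokernel _ }
    refine hS.hasInjectiveDimensionLT_X₁ (n + 1) (ih _ fun Y hY i hi => ⟨fun x y => ?_⟩)
      inferInstance
    suffices key : ∀ x : Abelian.Ext.{u + 1} Y (cokernel (Injective.ι C)) i, x = 0 by
      rw [key x, key y]
    intro x
    -- The connecting map sends `x` to `Ext^{i+1}(Y, C) = 0`, so `x` comes from `Ext^i(Y, I)` with
    -- `I` injective and `i ≥ 1`, which is zero as well.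
    have := h Y hY (i + 1) (by lia)
    obtain ⟨y, rfl⟩ := Abelian.Ext.covariant_sequence_exact₃ Y hS x (n₁ := i + 1) rfl
      (Subsingleton.elim _ _)
    have hy : y = 0 := y.eq_zero_of_hasInjectiveDimensionLT 1 (by lia)
    rw [hy, Abelian.Ext.zero_comp]

end GrMod

end Essential

/-! ### Injective dimension -/

section InjectiveDimension

variable {k A : Type u} {G : Type} [Field k] [Ring A] [Algebra k A] [AddCommGroup G]
  [DecidableEq G] {𝒜 : G → Submodule k A} [GradedAlgebra 𝒜]

namespace GrMod

theorem subsingleton_of_isZero {M : GrMod 𝒜} (h : IsZero M) : Subsingleton M :=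
  ⟨fun x y => by
    have key : ∀ x : M, x = 0 := fun x =>
      LinearMap.congr_fun (congrArg lin ((IsZero.iff_id_eq_zero M).1 h)) x
    rw [key x, key y]⟩

theorem isZero_of_subsingleton (M : GrMod 𝒜) [Subsingleton M] : IsZero M :=
  (IsZero.iff_id_eq_zero M).2 (hom_ext fun _ => Subsingleton.elim _ _)

/-- A linear map, as a map from a shifted module. -/
def toShiftLin {N : GrMod 𝒜} {V : Type*} [AddCommGroup V] [Module A V] (f : N →ₗ[A] V) (σ : G) :
    N.shift σ →ₗ[A] V := f

/-- A linear map from a shifted module, as a map from the module. -/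
def ofShiftLin {N : GrMod 𝒜} {V : Type*} [AddCommGroup V] [Module A V] {σ : G}
    (f : N.shift σ →ₗ[A] V) : N →ₗ[A] V := f

/-- A linear map, as a map between shifted modules. -/
def shiftLin {N M : GrMod 𝒜} (f : N →ₗ[A] M) (σ : G) : N.shift σ →ₗ[A] M.shift σ := f

/-- The shift of a morphism. -/
def shiftMap {N M : GrMod 𝒜} (f : N ⟶ M) (σ : G) : N.shift σ ⟶ M.shift σ :=
  ofLin (shiftLin (lin f) σ) fun i _ hx => lin_mem f (i := i + σ) hx

theorem shiftMap_injective {N M : GrMod 𝒜} (f : N ⟶ M) [Mono f] (σ : G) :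
    Function.Injective (lin (shiftMap f σ)) :=
  fun _ _ h => injective_of_mono f h

/-- An extension problem with target `M[σ]` becomes one with target `M` after shifting its sources
by `-σ`. -/
instance shift_injective (M : GrMod 𝒜) [Injective M] (σ : G) : Injective (M.shift σ) where
  factors {X Y} g f _ := by
    have : Mono (shiftMap f (-σ)) := mono_of_injective (shiftMap f (-σ)) (shiftMap_injective f (-σ))
    let g' : X.shift (-σ) ⟶ M := ofLin (toShiftLin (linShift g) (-σ)) fun i x hx => by
      have h := linShift_mem g (i := i + -σ) hx
      rwa [neg_add_cancel_right] at h
    let h : Y.shift (-σ) ⟶ M := Injective.factorThru g' (shiftMap f (-σ))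
    refine ⟨ofLinShift (ofShiftLin (lin h)) fun i y hy => lin_mem h (i := i + σ) ?_,
      hom_shift_ext (LinearMap.ext fun x => ?_)⟩
    · change y ∈ Y.deg (i + σ + -σ)
      rwa [add_neg_cancel_right]
    · exact LinearMap.congr_fun (congrArg lin (Injective.comp_factorThru g' (shiftMap f (-σ)))) x

/-- The first page involves all shifts `gr M[(0, p)]`, and these must be controlled by `gr M` alone.
Shifting preserves injectives and short exact sequences, so the bound follows by induction along an
injective embedding and its quotient. -/
theorem hasInjectiveDimensionLT_shift (n : ℕ) (M : GrMod 𝒜) (h : HasInjectiveDimensionLT M n)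
    (σ : G) : HasInjectiveDimensionLT (M.shift σ) n := by
  induction n generalizing M with
  | zero =>
    have h0 : Subsingleton M := subsingleton_of_isZero (isZero_of_hasInjectiveDimensionLT_zero M)
    have : Subsingleton (M.shift σ) := h0
    exact (isZero_of_subsingleton (M.shift σ)).hasInjectiveDimensionLT_zero
  | succ n ih =>
    cases n with
    | zero =>
      have : Injective M := injective_iff_hasInjectiveDimensionLT_one.2 h
      exact injective_iff_hasInjectiveDimensionLT_one.1 inferInstance
    | succ n =>
      let j := Injective.ι M
      let q := (Injective.under M).quotπ _ (range_homogeneous j)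
      have hex : ∀ y, lin q y = 0 → y ∈ LinearMap.range (lin j) := fun y hy =>
        (Submodule.Quotient.mk_eq_zero _).1 hy
      have hS := shortExact_of_exact j q (comp_quotπ j) (injective_of_mono j)
        (Submodule.mkQ_surjective _) hex
      have hS' := shortExact_of_exact (shiftMap j σ) (shiftMap q σ)
        (hom_ext (M := ((Injective.under M).quot _ (range_homogeneous j)).shift σ) fun x =>
          (lin_apply_of_comp_eq_zero (comp_quotπ j) (show M from x) :))
        (shiftMap_injective j σ) (Submodule.mkQ_surjective _) hex
      exact hS'.hasInjectiveDimensionLT_X₁ (n + 1)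
        (ih _ (hS.hasInjectiveDimensionLT_X₃ (n + 1) inferInstance h)) inferInstance

end GrMod

variable {FA : AlgFiltration 𝒜}

/-- The image of a filtration under a morphism. -/
def ModFiltration.image {N M : GrMod 𝒜} (FN : ModFiltration FA N) (f : N ⟶ M) :
    ModFiltration FA M :=
  haveI mono : Monotone fun n => (FN.layer n).map ((GrMod.lin f).restrictScalars k) :=
    fun _ _ h => Submodule.map_mono (FN.layer_mono h)
  { layer := fun n => (FN.layer n).map ((GrMod.lin f).restrictScalars k)
    isFiltration :=
      { mono := mono
        is_le := fun {i j} h => mono (Int.le_sub_one_of_lt h)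
        is_sup := fun B j h => h _ (sub_one_lt j)
        smul_mem := by
          rintro i j a _ ha ⟨x, hx, rfl⟩
          exact ⟨a • x, FN.smul_mem_layer ha hx, map_smul (GrMod.lin f) a x⟩ }
    homogeneous := by
      rintro n ζ _ ⟨x, hx, rfl⟩
      exact ⟨_, FN.homogeneous n ζ hx, (GrMod.lin_decompose f x ζ).symm⟩ }

/-- Finitely generated modules have good filtrations. -/
theorem exists_filteredModule (hFA : FA.IsConnected) (Y : GrMod 𝒜) [Module.Finite A Y] :
    ∃ X : FilteredModule FA, X.obj = Y := by
  obtain ⟨m, g, x, hx, hspan⟩ := Y.exists_homogeneous_generators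
  let g' : Fin m → G × ℤ := fun j => (g j, 0)
  let π : filteredFree (𝒜 := 𝒜) g' ⟶ Y := GrMod.freeLift x hx
  have hπ : Function.Surjective (GrMod.lin π) := GrMod.freeLift_surjective x hx hspan
  have hf : ModFiltration.IsFilteredHom (freeFiltration FA g')
    ((freeFiltration FA g').image π) π := fun n x hx => ⟨x, hx, rfl⟩
  have := gr_free_finite (FA := FA) (g := g')
  refine ⟨{ obj := Y
            filt := (freeFiltration FA g').image π
            discrete := ?_
            exhaustive := fun y => ?_
            -- For the image filtration the cover is strict by construction, so it is surjective on
            -- `gr`.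
            finite := Module.Finite.of_surjective _
              (ModFiltration.gr_surjective_of_strict hf fun n y hy => hy) }, rfl⟩
  · obtain ⟨n₀, hn₀⟩ := freeFiltration_isDiscrete (g := g') hFA
    refine ⟨n₀, fun n hn => ?_⟩
    change ((freeFiltration FA g').layer n).map _ = ⊥
    rw [hn₀ n hn, Submodule.map_bot]
  · obtain ⟨z, rfl⟩ := hπ y
    obtain ⟨n, hn⟩ := freeFiltration_isExhaustive hFA z
    exact ⟨n, z, hn, rfl⟩

namespace ModFiltration

variable {M : GrMod 𝒜} {FM : ModFiltration FA M} (hFA : FA.IsConnected) (hM : FM.IsDiscrete) (hM' : FM.IsExhaustive)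

include hM hM' in
-- If `gr M = 0`, the zero endomorphism of `M` is surjective on `gr`, hence surjective.
theorem subsingleton_of_gr [Subsingleton FM.gr] : Subsingleton M := by
  have hf : IsFilteredHom FM FM (0 : M ⟶ M) := fun n _ _ => zero_mem (FM.layer n)
  have h := surjective_of_gr_surjective hf hM hM' fun y => ⟨0, Subsingleton.elim _ _⟩
  refine ⟨fun x y => ?_⟩
  obtain ⟨x, rfl⟩ := h x
  obtain ⟨y, rfl⟩ := h y
  rfl

variable [IsNoetherianRing (GrAlg FA)]

include hFA hM hM' in
-- By the Baer criterion only `Ext^i(Y, M)` with `Y` finitely generated matters, and such `Y` has a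
-- filtration to which the dimension bound applies. That criterion starts at bound `1`; bound `0`,
-- which means that the module is zero, is treated separately.
theorem hasInjectiveDimensionLT_of_gr {n : ℕ} (h : HasInjectiveDimensionLT FM.gr n) :
    HasInjectiveDimensionLT M n := by
  cases n with
  | zero =>
    have := GrMod.subsingleton_of_isZero (isZero_of_hasInjectiveDimensionLT_zero FM.gr)
    have := subsingleton_of_gr hM hM'
    exact (GrMod.isZero_of_subsingleton M).hasInjectiveDimensionLT_zero
  | succ n =>
    let := HasExt.standard (GrMod 𝒜)
    refine GrMod.hasInjectiveDimensionLT_of_finite n M fun Y _ i hi => ?_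
    obtain ⟨X, rfl⟩ := exists_filteredModule hFA Y
    exact subsingleton_ext_of_grExt (X.subsingleton_ext hFA hM hM' i 0 fun p =>
      (GrMod.hasInjectiveDimensionLT_shift _ _ h (0, p)).subsingleton' i hi (Y := _))

include hFA hM hM' in
theorem injectiveDimension_le : injectiveDimension M ≤ injectiveDimension FM.gr :=
  sInf_le_sInf fun _ hn i hi => hasInjectiveDimensionLT_of_gr hFA hM hM' (hn i hi)

end ModFiltration

end InjectiveDimension

end

theorem mainTheorem8 {k A : Type u} [Field k] [Ring A] [Algebra k A] {r : ℕ}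
    (𝒜 : (Fin r → ℤ) → Submodule k A) [GradedAlgebra 𝒜] (h𝒜 : IsConnectedGrading 𝒜)
    (FA : AlgFiltration 𝒜) (hFA : FA.IsConnected) (hnoeth : IsNoetherianRing (GrAlg FA))
    (N M : GrMod 𝒜) (FN : ModFiltration FA N) (FM : ModFiltration FA M)
    (hN : FN.IsStandard) (hM : FM.IsDiscrete) (hM' : FM.IsExhaustive) :
    -- the convergent spectral sequence; `E.term (p, q) 0` is the term of its first page
    (∀ ξ : Fin r → ℤ, ∃ E : HomologicalSS k,
      (∀ p q : ℤ, Nonempty (E.term (p, q) 0 ≅ GrExtInt (-p - q) FN.gr FM.gr (ξ, p))) ∧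
      ∃ c : E.Convergence (fun n => GrExtInt (-n) N M ξ),
        (∀ ζ, FiniteDimensional k (M.deg ζ)) → c.IsFinite) ∧
    -- the dimension bounds
    (∀ (i : ℕ) (ξ : Fin r → ℤ), Module.rank k (GrExt i N M ξ) ≤
      Cardinal.sum fun p : ℤ => Module.rank k (GrExt i FN.gr FM.gr (ξ, p))) ∧
    -- projective and injective dimensions in the categories of graded modules
    projectiveDimension N ≤ projectiveDimension FN.gr ∧
    injectiveDimension M ≤ injectiveDimension FM.gr ∧
    -- the property `χ`
    (FM.gr.Chi → M.Chi) := by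
  let X := hN.filteredModule hFA
  exact ⟨X.exists_spectralSequence hFA hM hM', X.rank_ext_le hFA hM hM', X.projectiveDimension_le hFA,
    ModFiltration.injectiveDimension_le hFA hM hM', chi_of_gr_chi h𝒜 hFA hM hM'⟩
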